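/- \textbf{Setting.} Let $T>0$, $H\in(\tfrac12,1)$, $d,K\in\mathbb N$. Let $\Omega=C_0([0,T],\mathbb R^d)$ be the space of continuous $\mathbb R^d$-valued paths $\omega$ with $\omega(0)=0$, with the uniform topology and its Borel $\sigma$-algebra, and let $P$ be the law on $\Omega$ of $d$-dimensional fractional Brownian motion with Hurst parameter $H$; that is, under $P$ the coordinate process $B(t,\omega)=\omega(t)$ is centred Gaussian with $\mathbb E[B_i(s)B_j(t)]=\delta_{ij}\tfrac12\left(t^{2H}+s^{2H}-|t-s|^{2H}\right)$. Put $\phi(s,t)=H(2H-1)|s-t|^{2H-2}$, $\langle f,g\rangle_\phi=\int_0^T\!\int_0^T f(s)g(t)\phi(s,t)\,ds\,dt$, $|f|_\phi^2=\langle f,f\rangle_\phi$; let $\mathcal H_\phi$ be the space of measurable $f:[0,T]\to\mathbb R$ for which the double integral $|f|_\phi^2$ converges absolutely, and put $\Phi[f](t)=\int_0^T f(s)\phi(t,s)\,ds$. For $f\in\mathcal H_\phi$ let $\int_0^T f\,dB_i$ be the fractional Wiener integral (the $L^2(P)$-limit of the elementary integrals of step functions converging to $f$ in $|\cdot|_\phi$),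 let $\mathcal E_i(f)=\exp\left\{\int_0^T f\,dB_i-\tfrac12|f|_\phi^2\right\}$, and define the Wick product with $\mathcal E_i(f)$ by $$(Y\diamond\mathcal E_i(f))(\omega)=Y\Big(\omega-\epsilon_i\int_0^{\cdot}\Phi[f](r)\,dr\Big)\,\mathcal E_i(f)(\omega),$$ where $\epsilon_1,\dots,\epsilon_d$ is the canonical basis of $\mathbb R^d$. Let $\{e_k\}_{k\ge1}\subset\mathcal H_\phi$ be a complete orthonormal system (orthonormal with dense linear span), and put $\xi_k=\Phi[e_k]$, $Z^{(i)}_k=\int_0^Te_k\,dB_i$, $\mathbf z=(Z_k^{(i)})_{k\le K,\,i\le d}$, $\frac{dB_i^K(t)}{dt}=\sum_{k=1}^K\xi_k(t)Z_k^{(i)}$. Let $b:[0,T]\times\mathbb R^d\to\mathbb R^d$, $\sigma:[0,T]\to\mathbb R^d$, $c\in\mathbb R^d$. For $0\le r\le t\le T$ let $\sigma_i^K(r,t;\cdot)$ be the orthogonal projection of $\chi_{[r,t]}\sigma_i$ on $\operatorname{span}\{e_1,\dots,e_K\}$ and $\mathcal E_i^K(r,t)=\mathcal E_i(\sigma_i^K(r,t;\cdot))$.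 A \emph{mild solution} of $$\frac{dX_i^K(t)}{dt}=b_i(t,X^K(t))+\sigma_i(t)X_i^K(t)\diamond\frac{dB_i^K(t)}{dt},\qquad X_i^K(0)=c_i,\qquad i=1,\dots,d,\qquad(1)$$ is an $\mathbb R^d$-valued process $X^K$ on $[0,T]$ such that (i) $t\mapsto X^K(t)$ is almost surely continuous; (ii) for some $p>1$, $X_i^K(t)\in L^p(\Omega)$ for all $i$ and all $t\in[0,T]$; (iii) for all $i$ and all $t\in[0,T]$, almost surely $$X_i^K(t)=c_i\,\mathcal E_i^K(0,t)+\int_0^t b_i(s,X^K(s))\diamond\mathcal E_i^K(s,t)\,ds,$$ where the integral is taken along a version of the integrand that is jointly measurable in $(s,\omega)$ and almost surely integrable in $s$. \textbf{Theorem (existence).} Assume that $b$ and its partial derivatives $\partial_{x_1}b,\dots,\partial_{x_d}b$ exist and are bounded and continuous on $[0,T]\times\mathbb R^d$, and that $\sigma$ is bounded and continuous on $[0,T]$. Then (1) has a mild solution $X^K$. Moreover it can be taken of the form $X^K_i(t,\omega)=u_i(t,\mathbf z(\omega))$, where $u:[0,T]\times\mathbb R^{K\times d}\to\mathbb R^d$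 is continuous and solves the semilinear hyperbolic system $$\partial_tu_i=b_i(t,u)+\sigma_i(t)\sum_{k=1}^K\xi_k(t)\left[x_{ki}u_i-\partial_{x_{ki}}u_i\right],\qquad u_i(0,\mathbf x)=c_i,\qquad(2)$$ in the following sense. With $\Sigma_{i,k}(r,t)=\int_r^t\sigma_i(s)\xi_k(s)\,ds$ and $\mathbf\Sigma^{(i)}(r,t)$ the $K\times d$ matrix with $i$-th column $(\Sigma_{i,1}(r,t),\dots,\Sigma_{i,K}(r,t))^T$ and zeros elsewhere, $u$ is a mild solution of (2), that is, for all $t\in[0,T]$, all $\mathbf x\in\mathbb R^{K\times d}$ and all $i$, $$u_i(t,\mathbf x)=c_i\,e^{\sum_{k=1}^K\left[x_{ki}\Sigma_{i,k}(0,t)-\frac12\Sigma_{i,k}(0,t)^2\right]}+\int_0^t b_i\big(s,u(s,\mathbf x-\mathbf\Sigma^{(i)}(s,t))\big)\,e^{\sum_{k=1}^K\left[x_{ki}\Sigma_{i,k}(s,t)-\frac12\Sigma_{i,k}(s,t)^2\right]}ds;$$ and if $\xi_1,\dots,\xi_K$ are continuous on $[0,T]$, then $u$ is a classical solution of (2):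 its first spatial derivatives exist and are continuous on $[0,T]\times\mathbb R^{K\times d}$, and (2) holds for all $t\in\,]0,T]$ and $\mathbf x\in\mathbb R^{K\times d}$ (with the one-sided time derivative at $t=T$). -/

import Mathlib

open MeasureTheory ProbabilityTheory Set Filter Topology

namespace WongZakai

noncomputable section

/-- The covariance density `φ(s,t) = H(2H-1)|s-t|^{2H-2}` of fractional Brownian motion. -/
def phi (H s t : ℝ) : ℝ := H * (2 * H - 1) * |s - t| ^ (2 * H - 2)

/-- `⟨f,g⟩_φ = ∫_0^T ∫_0^T f(s) g(t) φ(s,t) dt ds`. -/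
def phiInner (H T : ℝ) (f g : ℝ → ℝ) : ℝ :=
  ∫ s in (0 : ℝ)..T, ∫ t in (0 : ℝ)..T, f s * g t * phi H s t

/-- `|f|_φ`. -/
def phiNorm (H T : ℝ) (f : ℝ → ℝ) : ℝ := Real.sqrt (phiInner H T f f)

/-- The function space `𝓗_φ`: measurable functions on `[0,T]` for which the double integral
defining `|f|_φ²` converges (absolutely). Values outside `[0,T]` are irrelevant. -/
def Hphi (H T : ℝ) : Set (ℝ → ℝ) :=
  {f | AEStronglyMeasurable f (volume.restrict (Icc 0 T)) ∧
    Integrable (fun p : ℝ × ℝ => f p.1 * f p.2 * phi H p.1 p.2)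
      ((volume.restrict (Icc 0 T)).prod (volume.restrict (Icc 0 T)))}

/-- `Φ[f](t) = ∫_0^T f(s) φ(t,s) ds`. -/
def Phi (H T : ℝ) (f : ℝ → ℝ) (t : ℝ) : ℝ := ∫ s in (0 : ℝ)..T, f s * phi H t s

/-- Complete orthonormal systems of `𝓗_φ`: orthonormal sequences of elements of `𝓗_φ` whose
linear span is dense in `𝓗_φ`. -/
structure IsCONS (H T : ℝ) (e : ℕ → ℝ → ℝ) : Prop where
  mem : ∀ k, e k ∈ Hphi H T
  orthonormal : ∀ k l, phiInner H T (e k) (e l) = if k = l then 1 else 0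
  dense : ∀ f ∈ Hphi H T, ∀ ε > 0, ∃ a : ℕ →₀ ℝ,
    phiNorm H T (f - a.sum fun k r => r • e k) < ε

/-- `Ω = C_0([0,T], ℝ^d)`: continuous paths starting at the origin, with the topology of uniform
convergence. -/
abbrev PathSpace (T : ℝ) (d : ℕ) : Type :=
  ↥({ carrier := {ω | ∀ t : Icc (0 : ℝ) T, (t : ℝ) = 0 → ω t = 0}
      add_mem' := fun {a b} ha hb t ht => by simp [ha t ht, hb t ht]
      zero_mem' := fun t _ => by simp
      smul_mem' := fun r a ha t ht => by simp [ha t ht] } :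
    Submodule ℝ C(Icc (0 : ℝ) T, Fin d → ℝ))

/-- The Borel σ-algebra of the path space. -/
instance instMeasurableSpacePathSpace (T : ℝ) (d : ℕ) : MeasurableSpace (PathSpace T d) :=
  borel (PathSpace T d)

instance instBorelSpacePathSpace (T : ℝ) (d : ℕ) : BorelSpace (PathSpace T d) := ⟨rfl⟩

/-- The coordinate process `B_i(t, ω) = ω_i(t)`. -/
def coord {T : ℝ} {d : ℕ} (t : Icc (0 : ℝ) T) (i : Fin d) (ω : PathSpace T d) : ℝ :=
  (ω : C(Icc (0 : ℝ) T, Fin d → ℝ)) t i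

/-- `P` is the law of `d`-dimensional fractional Brownian motion with Hurst parameter `H` on
`[0,T]`: under `P` the coordinate process is centred Gaussian, its components are uncorrelated
(hence independent), and each has the fractional Brownian covariance. -/
structure IsFBM (H T : ℝ) (d : ℕ) (P : Measure (PathSpace T d)) : Prop where
  gaussian : IsGaussianProcess
    (fun (q : Icc (0 : ℝ) T × Fin d) (ω : PathSpace T d) => coord q.1 q.2 ω) P
  mean : ∀ t i, ∫ ω, coord t i ω ∂P = 0
  cov : ∀ s t i j, ∫ ω, coord s i ω * coord t j ω ∂P =
    if i = j then
      (1 / 2) * ((t : ℝ) ^ (2 * H) + (s : ℝ) ^ (2 * H) - |(t : ℝ) - s| ^ (2 * H))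
    else 0

/-- The step function `∑ₜ aₜ χ_{[0,t]}`. -/
def stepFun {T : ℝ} (g : Icc (0 : ℝ) T →₀ ℝ) (s : ℝ) : ℝ :=
  g.sum fun t a => a * (Icc (0 : ℝ) (t : ℝ)).indicator (fun _ => (1 : ℝ)) s

/-- Its elementary integral `∑ₜ aₜ B_i(t)`. -/
def stepInt {T : ℝ} {d : ℕ} (i : Fin d) (g : Icc (0 : ℝ) T →₀ ℝ) (ω : PathSpace T d) : ℝ :=
  g.sum fun t a => a * coord t i ω

/-- `I` is (a version of) the fractional Wiener integral `∫_0^T f dB_i`: the `L²(P)`-limit of the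
elementary integrals of step functions that converge to `f` in `𝓗_φ`. -/
def IsWienerIntegral (H : ℝ) {T : ℝ} {d : ℕ} (P : Measure (PathSpace T d)) (i : Fin d)
    (f : ℝ → ℝ) (I : PathSpace T d → ℝ) : Prop :=
  Measurable I ∧ MemLp I 2 P ∧ ∃ g : ℕ → (Icc (0 : ℝ) T →₀ ℝ),
    (∀ n, f - stepFun (g n) ∈ Hphi H T) ∧
    Tendsto (fun n => phiNorm H T (f - stepFun (g n))) atTop (𝓝 0) ∧
    Tendsto (fun n => eLpNorm (stepInt i (g n) - I) 2 P) atTop (𝓝 0)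

open Classical in
/-- The fractional Wiener integral `∫_0^T f dB_i` (a version of it; it is unique up to
`P`-null sets and exists for `f ∈ 𝓗_φ`). -/
def wienerInt (H : ℝ) {T : ℝ} {d : ℕ} (P : Measure (PathSpace T d)) (i : Fin d)
    (f : ℝ → ℝ) : PathSpace T d → ℝ :=
  if h : ∃ I, IsWienerIntegral H P i f I then h.choose else 0

/-- The stochastic exponential `𝓔_i(f) = exp(∫ f dB_i - |f|_φ²/2)`. -/
def stochExp (H : ℝ) {T : ℝ} {d : ℕ} (P : Measure (PathSpace T d)) (i : Fin d)
    (f : ℝ → ℝ) (ω : PathSpace T d) : ℝ :=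
  Real.exp (wienerInt H P i f ω - (1 / 2) * phiInner H T f f)

lemma intervalIntegrable_phi {H : ℝ} (hH : 1 / 2 < H) (s a b : ℝ) :
    IntervalIntegrable (fun t => phi H t s) volume a b := by
  unfold phi
  have key : ∀ x y : ℝ, IntervalIntegrable (fun t : ℝ => |t| ^ (2 * H - 2)) volume x y := by
    have h0 : ∀ y : ℝ, 0 ≤ y → IntervalIntegrable (fun t : ℝ => |t| ^ (2 * H - 2)) volume 0 y := by
      intro y hy
      refine (intervalIntegral.intervalIntegrable_rpow' (r := 2 * H - 2) (by linarith)).congr ?_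
      intro t ht
      rw [uIoc_of_le hy] at ht
      simp [abs_of_pos ht.1]
    have h1 : ∀ y : ℝ, IntervalIntegrable (fun t : ℝ => |t| ^ (2 * H - 2)) volume 0 y := by
      intro y
      rcases le_total 0 y with hy | hy
      · exact h0 y hy
      · have := (h0 (-y) (by linarith)).comp_sub_left 0
        simpa using this
    exact fun x y => (h1 x).symm.trans (h1 y)
  have := (key (a - s) (b - s)).comp_sub_right s
  simpa using this.const_mul (H * (2 * H - 1))

/-- For integrable `f` on `[0,T]` the function `Φ[f]` is integrable on `[0,T]`. -/
lemma intervalIntegrable_Phi {H T : ℝ} (hH : 1 / 2 < H) (hT : 0 ≤ T) {f : ℝ → ℝ}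
    (hf : IntervalIntegrable f volume 0 T) : IntervalIntegrable (Phi H T f) volume 0 T := by
  rw [intervalIntegrable_iff_integrableOn_Ioc_of_le hT] at hf ⊢
  have hmeas : Measurable fun p : ℝ × ℝ => phi H p.1 p.2 := by unfold phi; fun_prop
  have hi : Integrable (fun p : ℝ × ℝ => f p.2 * phi H p.1 p.2)
      ((volume.restrict (Ioc 0 T)).prod (volume.restrict (Ioc 0 T))) := by
    have hm : AEStronglyMeasurable (fun p : ℝ × ℝ => f p.2 * phi H p.1 p.2)
        ((volume.restrict (Ioc 0 T)).prod (volume.restrict (Ioc 0 T))) :=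
      hf.aestronglyMeasurable.comp_snd.mul hmeas.aestronglyMeasurable
    rw [integrable_prod_iff' hm]
    have hs : ∀ s, IntegrableOn (fun t => phi H t s) (Ioc 0 T) := fun s =>
      (intervalIntegrable_iff_integrableOn_Ioc_of_le hT).1 (intervalIntegrable_phi hH s 0 T)
    refine ⟨Eventually.of_forall fun s => (hs s).const_mul (f s), ?_⟩
    simp only [norm_mul, integral_const_mul]
    refine Integrable.mul_bdd (c := ∫ t in (-T)..T, ‖phi H t 0‖) hf.norm ?_ ?_
    · exact (hmeas.norm.stronglyMeasurable.integral_prod_left').aestronglyMeasurable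
    · filter_upwards [ae_restrict_mem measurableSet_Ioc] with s hs'
      rw [Real.norm_of_nonneg (integral_nonneg fun _ => norm_nonneg _),
        ← intervalIntegral.integral_of_le hT]
      have : ∀ t, phi H t s = phi H (t - s) 0 := fun t => by simp [phi]
      simp_rw [this]
      rw [intervalIntegral.integral_comp_sub_right (fun t => ‖phi H t 0‖)]
      exact intervalIntegral.integral_mono_interval (by linarith [hs'.2]) (by linarith)
        (by linarith [hs'.1]) (Eventually.of_forall fun _ => norm_nonneg _)
        (intervalIntegrable_phi hH 0 _ _).norm
  have := hi.integral_prod_left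
  refine this.congr (Eventually.of_forall fun t => ?_)
  simp only [Phi]
  rw [intervalIntegral.integral_of_le hT]

/-- Elements of `𝓗_φ` are integrable on `[0,T]`. -/
lemma intervalIntegrable_of_mem_Hphi {H T : ℝ} (hH : 1 / 2 < H) (hH1 : H < 1) (hT : 0 < T)
    {f : ℝ → ℝ} (hf : f ∈ Hphi H T) : IntervalIntegrable f volume 0 T := by
  rw [intervalIntegrable_iff_integrableOn_Icc_of_le hT.le]
  obtain ⟨hm, hi⟩ := hf
  by_cases h0 : f =ᵐ[volume.restrict (Icc 0 T)] 0
  · exact (integrable_zero _ _ _).congr h0.symm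
  have h1 : ∃ᵐ s ∂(volume.restrict (Icc 0 T)), f s ≠ 0 := by
    rw [EventuallyEq, not_eventually] at h0
    simpa using h0
  obtain ⟨s, hfs, hsi, hs⟩ := (h1.and_eventually
    (hi.prod_right_ae.and (ae_restrict_mem measurableSet_Icc))).exists
  have hc : 0 < H * (2 * H - 1) * T ^ (2 * H - 2) := by
    have : 0 < T ^ (2 * H - 2) := Real.rpow_pos_of_pos hT _
    have h2 : 0 < 2 * H - 1 := by linarith
    have h3 : 0 < H := by linarith
    positivity
  have hfs' : 0 < |f s| := abs_pos.2 hfs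
  refine (hsi.const_mul ((|f s| * (H * (2 * H - 1) * T ^ (2 * H - 2)))⁻¹)).mono hm ?_
  have hne : ∀ᵐ t ∂(volume.restrict (Icc 0 T)), t ≠ s :=
    ae_restrict_of_ae (by simp [ae_iff])
  filter_upwards [ae_restrict_mem measurableSet_Icc, hne] with t ht hts
  have hpos : 0 < |s - t| := abs_pos.2 (sub_ne_zero.2 (Ne.symm hts))
  have hle : |s - t| ≤ T := by
    rw [abs_le]; constructor <;> linarith [hs.1, hs.2, ht.1, ht.2]
  have hr : T ^ (2 * H - 2) ≤ |s - t| ^ (2 * H - 2) :=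
    Real.rpow_le_rpow_of_nonpos hpos hle (by linarith)
  have hphi : H * (2 * H - 1) * T ^ (2 * H - 2) ≤ |phi H s t| := by
    refine le_trans ?_ (le_abs_self _)
    have h2 : 0 ≤ H * (2 * H - 1) := mul_nonneg (by linarith) (by linarith)
    exact mul_le_mul_of_nonneg_left hr h2
  simp only [Real.norm_eq_abs, abs_mul, abs_inv, abs_abs]
  have hc' : |H| * |2 * H - 1| * |T ^ (2 * H - 2)| = H * (2 * H - 1) * T ^ (2 * H - 2) := by
    rw [← abs_mul, ← abs_mul, abs_of_pos hc]
  rw [hc', inv_mul_eq_div, le_div_iff₀ (by positivity)]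
  calc |f t| * (|f s| * (H * (2 * H - 1) * T ^ (2 * H - 2)))
      = |f s| * |f t| * (H * (2 * H - 1) * T ^ (2 * H - 2)) := by ring
    _ ≤ |f s| * |f t| * |phi H s t| := by gcongr

open Classical in
/-- The Cameron–Martin path `ε_i ∫_0^· Φ[f](r) dr`, where `ε_i` is the `i`-th basis vector.
(The `else` branch does not occur for `f` integrable on `[0,T]`, in particular for `f ∈ 𝓗_φ`.) -/
def cmPath (H T : ℝ) {d : ℕ} (i : Fin d) (f : ℝ → ℝ) : PathSpace T d :=
  if h : IntervalIntegrable (Phi H T f) volume 0 T then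
    ⟨⟨fun t => Pi.single i (∫ r in (0 : ℝ)..(t : ℝ), Phi H T f r), by
        have hc := intervalIntegral.continuousOn_primitive_interval' h left_mem_uIcc
        have hc' : Continuous fun t : Icc (0 : ℝ) T => ∫ r in (0 : ℝ)..(t : ℝ), Phi H T f r := by
          refine (hc.mono fun x hx => ?_).domRestrict
          rw [uIcc_of_le (hx.1.trans hx.2)]
          exact hx
        exact (continuous_single i).comp hc'⟩,
      fun t ht => by simp [ht]⟩
  else 0

/-- The translation operator `(T_{-Φ[f]_i} Y)(ω) = Y(ω - ε_i ∫_0^· Φ[f](r) dr)`. -/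
def translate (H : ℝ) {T : ℝ} {d : ℕ} (i : Fin d) (f : ℝ → ℝ) (Y : PathSpace T d → ℝ)
    (ω : PathSpace T d) : ℝ :=
  Y (ω - cmPath H T i f)

/-- The Wick product `Y ⋄ 𝓔_i(f) = (T_{-Φ[f]_i} Y) · 𝓔_i(f)`. -/
def wickExp (H : ℝ) {T : ℝ} {d : ℕ} (P : Measure (PathSpace T d)) (i : Fin d)
    (f : ℝ → ℝ) (Y : PathSpace T d → ℝ) (ω : PathSpace T d) : ℝ :=
  translate H i f Y ω * stochExp H P i f ω

/-- `σ_i^K(r,t;·)`: the orthogonal projection in `𝓗_φ` of `χ_{[r,t]} σ_i` on the span of the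
first `K` elements of the orthonormal system `e`. -/
def sigmaK {d : ℕ} (H T : ℝ) (e : ℕ → ℝ → ℝ) (K : ℕ) (σ : ℝ → Fin d → ℝ) (i : Fin d)
    (r t : ℝ) : ℝ → ℝ :=
  ∑ k : Fin K, phiInner H T ((Icc r t).indicator fun s => σ s i) (e k) • e k

/-- Boundedness, continuity and differentiability of the coefficients. -/
structure CoeffAssumption (T : ℝ) {d : ℕ} (b : ℝ → (Fin d → ℝ) → Fin d → ℝ)
    (σ : ℝ → Fin d → ℝ) : Prop where
  b_cont : ContinuousOn (fun p : ℝ × (Fin d → ℝ) => b p.1 p.2) (Icc 0 T ×ˢ univ)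
  b_bdd : ∃ M : ℝ, ∀ t ∈ Icc 0 T, ∀ x i, |b t x i| ≤ M
  db_exists : ∀ t ∈ Icc 0 T, ∀ x i j,
    LineDifferentiableAt ℝ (fun y => b t y i) x (Pi.single j (1 : ℝ))
  db_cont : ∀ i j, ContinuousOn
    (fun p : ℝ × (Fin d → ℝ) => lineDeriv ℝ (fun y => b p.1 y i) p.2 (Pi.single j (1 : ℝ)))
    (Icc 0 T ×ˢ univ)
  db_bdd : ∃ M : ℝ, ∀ t ∈ Icc 0 T, ∀ x i j,
    |lineDeriv ℝ (fun y => b t y i) x (Pi.single j (1 : ℝ))| ≤ M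
  σ_cont : ContinuousOn σ (Icc 0 T)
  σ_bdd : ∃ M : ℝ, ∀ t ∈ Icc 0 T, ∀ i, |σ t i| ≤ M

/-- `X` is a mild solution of `dX_i/dt = b_i(t,X) + σ_i X_i ⋄ dB_i^K/dt`, `X_i(0) = c_i`.
The Wick products `b_i(s,X(s)) ⋄ 𝓔_i^K(s,t)` are random variables defined up to null sets for
each `s`, so the `ds`-integral is taken along a jointly measurable version `G` of this family;
by Fubini's theorem its value does not depend on the version, up to a null set. -/
structure IsMildSolution (H : ℝ) {T : ℝ} {d : ℕ} (P : Measure (PathSpace T d))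
    (e : ℕ → ℝ → ℝ) (K : ℕ) (b : ℝ → (Fin d → ℝ) → Fin d → ℝ) (σ : ℝ → Fin d → ℝ)
    (c : Fin d → ℝ) (X : ℝ → PathSpace T d → Fin d → ℝ) : Prop where
  measurable : ∀ t ∈ Icc 0 T, Measurable (X t)
  continuous : ∀ᵐ ω ∂P, ContinuousOn (fun t => X t ω) (Icc 0 T)
  memLp : ∃ p : ℝ, 1 < p ∧ ∀ i, ∀ t ∈ Icc 0 T,
    MemLp (fun ω => X t ω i) (ENNReal.ofReal p) P
  equation : ∀ i, ∀ t ∈ Icc 0 T, ∃ G : ℝ → PathSpace T d → ℝ,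
    Measurable (Function.uncurry G) ∧
    (∀ s ∈ Icc 0 t,
      G s =ᵐ[P] wickExp H P i (sigmaK H T e K σ i s t) (fun ω => b s (X s ω) i)) ∧
    ∀ᵐ ω ∂P, IntervalIntegrable (fun s => G s ω) volume 0 t ∧
      X t ω i = c i * stochExp H P i (sigmaK H T e K σ i 0 t) ω + ∫ s in (0 : ℝ)..t, G s ω

/-- The matrix `𝐳 = (Z_k^{(i)})` of Gaussian coordinates `Z_k^{(i)} = ∫_0^T e_k dB_i`. -/
def gaussCoords (H : ℝ) {T : ℝ} {d : ℕ} (P : Measure (PathSpace T d)) (e : ℕ → ℝ → ℝ) (K : ℕ)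
    (ω : PathSpace T d) : Matrix (Fin K) (Fin d) ℝ :=
  Matrix.of fun k i => wienerInt H P i (e k) ω

/-- `u` is a classical solution on `[0,T] × ℝ^{K×d}` of
`∂_t u_i = b_i(t,u) + σ_i(t) ∑_k ξ_k(t) (x_{ki} u_i - ∂_{x_{ki}} u_i)`, `u_i(0,x) = c_i`,
where `ξ_k = Φ[e_k]`. -/
structure IsClassicalSolution (H T : ℝ) {d : ℕ} (e : ℕ → ℝ → ℝ) (K : ℕ)
    (b : ℝ → (Fin d → ℝ) → Fin d → ℝ) (σ : ℝ → Fin d → ℝ) (c : Fin d → ℝ)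
    (u : ℝ → Matrix (Fin K) (Fin d) ℝ → Fin d → ℝ) : Prop where
  cont : ContinuousOn (fun p : ℝ × Matrix (Fin K) (Fin d) ℝ => u p.1 p.2) (Icc 0 T ×ˢ univ)
  dx_exists : ∀ t ∈ Icc 0 T, ∀ x i k j,
    LineDifferentiableAt ℝ (fun y => u t y i) x (Matrix.single k j (1 : ℝ))
  dx_cont : ∀ i k j, ContinuousOn
    (fun p : ℝ × Matrix (Fin K) (Fin d) ℝ =>
      lineDeriv ℝ (fun y => u p.1 y i) p.2 (Matrix.single k j (1 : ℝ)))
    (Icc 0 T ×ˢ univ)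
  initial : ∀ x, u 0 x = c
  pde : ∀ t ∈ Ioc 0 T, ∀ x i, HasDerivWithinAt (fun s => u s x i)
    (b t (u t x) i + σ t i * ∑ k : Fin K, Phi H T (e k) t *
      (x k i * u t x i - lineDeriv ℝ (fun y => u t y i) x (Matrix.single k i (1 : ℝ))))
    (Icc 0 T) t

/-- `Σ_{i,k}(r,t) = ∫_r^t σ_i(s) ξ_k(s) ds` with `ξ_k = Φ[e_k]`. -/
def Sig {d : ℕ} (H T : ℝ) (e : ℕ → ℝ → ℝ) (σ : ℝ → Fin d → ℝ) (i : Fin d) (k : ℕ)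
    (r t : ℝ) : ℝ :=
  ∫ s in r..t, σ s i * Phi H T (e k) s

/-- The `K × d` matrix with `i`-th column `(Σ_{i,1}(r,t), …, Σ_{i,K}(r,t))` and zeros elsewhere. -/
def SigMat {d : ℕ} (H T : ℝ) (e : ℕ → ℝ → ℝ) (K : ℕ) (σ : ℝ → Fin d → ℝ) (i : Fin d)
    (r t : ℝ) : Matrix (Fin K) (Fin d) ℝ :=
  Matrix.of fun k j => if j = i then Sig H T e σ i k r t else 0

/-- `u` is a mild solution (integrated along characteristics) of the same hyperbolic system. -/
structure IsMildPDESolution (H T : ℝ) {d : ℕ} (e : ℕ → ℝ → ℝ) (K : ℕ)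
    (b : ℝ → (Fin d → ℝ) → Fin d → ℝ) (σ : ℝ → Fin d → ℝ) (c : Fin d → ℝ)
    (u : ℝ → Matrix (Fin K) (Fin d) ℝ → Fin d → ℝ) : Prop where
  cont : ContinuousOn (fun p : ℝ × Matrix (Fin K) (Fin d) ℝ => u p.1 p.2) (Icc 0 T ×ˢ univ)
  equation : ∀ t ∈ Icc 0 T, ∀ x i, u t x i =
    c i * Real.exp (∑ k : Fin K,
      (x k i * Sig H T e σ i k 0 t - (1 / 2) * Sig H T e σ i k 0 t ^ 2)) +
    ∫ s in (0 : ℝ)..t, b s (u s (x - SigMat H T e K σ i s t)) i *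
      Real.exp (∑ k : Fin K,
        (x k i * Sig H T e σ i k s t - (1 / 2) * Sig H T e σ i k s t ^ 2))

end

end WongZakai

/-! Gaussian coordinates turn the stochastic equation into a deterministic one. On `[0,T]` the
projection `sigmaK` has coefficients `Sig` in the basis `e k`, so its stochastic exponential is
almost surely the explicit exponential of the matrix z of Gaussian coordinates that occurs in the
mild form of (2). By Cameron–Martin, the translation hidden in the Wick product lowers the i-th
column of z by the corresponding `Sig` and leaves the other columns alone. Substituting z for x in
the mild form of (2) therefore gives the mild form of (1).

Deterministic side. Component i is transported along its own characteristic, so the system does not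
reduce to an ODE on a single curve and is treated as a fixed point problem. The decisive identity is
`quad_shift_add`: exp(|x|²/2) is transported exactly by the exponential kernel. In the norm weighted
by exp(-|x|²/2 - l t) the kernel disappears, time integration gains a factor 1/l, and Picard
iteration contracts (`exists_characteristic_solution`). The same theorem admits coefficients
depending on x and so solves the linearised equations. A Gronwall argument with pointwise limits
(`tendsto_zero_of_characteristic_ineq`) identifies their solutions with the spatial derivatives
(`exists_hasFDerivAt`). For the time derivative, the cocycle property of the kernel makes u along
one characteristic an explicit product, differentiable by the fundamental theorem of calculus; the
spatial increment is then subtracted (`hasDerivWithinAt`). Boundedness of b also gives the growth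
bound exp(R ∑|x|), which, unlike exp(|x|²/2), is square integrable under Gaussian laws.

Probabilistic side. The kernel `phi` is a Gram kernel, because Riesz kernels compose
(`lintegral_phiRoot_mul`). Hence `phiInner` is a positive form satisfying Cauchy–Schwarz. Step
functions are dense, and their inner products are the covariances of fractional Brownian motion.
Thus the Wiener integral exists, is almost surely unique and linear, and is Gaussian. Cameron–Martin
(`map_sub_cmPath`) is checked on moment generating functions of finite combinations of coordinates,
which determine a measure on path space. It makes translation preserve null sets, and this transfers
the formula for shifted Wiener integrals from step functions to all integrands
(`wienerInt_sub_cmPath`). -/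

namespace WongZakai

/-! ### Weighted Picard iteration along characteristics. -/

/-- The translation `x ↦ x - (a i · t - a i · s)` in the `i`-th column of a matrix. -/
def shift {K d : ℕ} (a : Fin d → Fin K → ℝ → ℝ) (i : Fin d) (s t : ℝ) (x : Fin K → Fin d → ℝ) :
    Fin K → Fin d → ℝ :=
  fun k j => x k j - if j = i then a i k t - a i k s else 0

/-- The exponential factor transported along the characteristics. -/
noncomputable def expKer {K d : ℕ} (a : Fin d → Fin K → ℝ → ℝ) (i : Fin d) (s t : ℝ)
    (x : Fin K → Fin d → ℝ) : ℝ :=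
  Real.exp (∑ k, (x k i * (a i k t - a i k s) - (1 / 2) * (a i k t - a i k s) ^ 2))

/-- Half the squared Euclidean norm of a matrix. -/
noncomputable def quad {K d : ℕ} (x : Fin K → Fin d → ℝ) : ℝ := (1 / 2) * ∑ k, ∑ j, x k j ^ 2

section Characteristics

variable {K d : ℕ} (a : Fin d → Fin K → ℝ → ℝ) (i : Fin d)

/-- Completing the square in column i: (x - δ)²/2 + (xδ - δ²/2) = x²/2. Hence exp(quad) solves the
homogeneous transport problem exactly, which makes it the weight for every estimate below. -/
lemma quad_shift_add (s t : ℝ) (x : Fin K → Fin d → ℝ) :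
    quad (shift a i s t x) +
      ∑ k, (x k i * (a i k t - a i k s) - (1 / 2) * (a i k t - a i k s) ^ 2) = quad x := by
  unfold quad shift
  rw [Finset.mul_sum, Finset.mul_sum, ← Finset.sum_add_distrib]
  refine Finset.sum_congr rfl fun k _ => ?_
  rw [← Finset.add_sum_erase _ _ (Finset.mem_univ i),
    ← Finset.add_sum_erase (a := i) _ (fun j => x k j ^ 2) (Finset.mem_univ i)]
  have : ∑ j ∈ Finset.univ.erase i, (x k j - if j = i then a i k t - a i k s else 0) ^ 2 =
      ∑ j ∈ Finset.univ.erase i, x k j ^ 2 := by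
    refine Finset.sum_congr rfl fun j hj => ?_
    simp [(Finset.mem_erase.1 hj).1]
  rw [this]
  simp only [if_true]
  ring

lemma exp_quad_shift_mul_expKer (s t : ℝ) (x : Fin K → Fin d → ℝ) :
    Real.exp (quad (shift a i s t x)) * expKer a i s t x = Real.exp (quad x) := by
  rw [expKer, ← Real.exp_add, quad_shift_add]

lemma expKer_pos (s t : ℝ) (x : Fin K → Fin d → ℝ) : 0 < expKer a i s t x := Real.exp_pos _

lemma quad_nonneg (x : Fin K → Fin d → ℝ) : 0 ≤ quad x := by unfold quad; positivity

lemma one_le_exp_quad (x : Fin K → Fin d → ℝ) : 1 ≤ Real.exp (quad x) :=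
  Real.one_le_exp (quad_nonneg x)

lemma expKer_le_exp_quad (s t : ℝ) (x : Fin K → Fin d → ℝ) :
    expKer a i s t x ≤ Real.exp (quad x) := by
  rw [← exp_quad_shift_mul_expKer a i s t x]
  exact le_mul_of_one_le_left (expKer_pos a i s t x).le (one_le_exp_quad _)

lemma shift_add (s t : ℝ) (x h : Fin K → Fin d → ℝ) :
    shift a i s t (x + h) = shift a i s t x + h := by
  ext k j; simp [shift]; ring

@[fun_prop]
lemma continuous_quad : Continuous (quad : (Fin K → Fin d → ℝ) → ℝ) := by
  unfold quad; fun_prop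

variable {a} in
lemma continuous_shift {X : Type*} [TopologicalSpace X] (ha : ∀ i k, Continuous (a i k))
    {s t : X → ℝ} {x : X → Fin K → Fin d → ℝ} (hs : Continuous s) (ht : Continuous t)
    (hx : Continuous x) : Continuous fun p => shift a i (s p) (t p) (x p) := by
  unfold WongZakai.shift
  refine continuous_pi fun k => continuous_pi fun j => ?_
  have h1 := (ha i k).comp hs
  have h2 := (ha i k).comp ht
  simp only [Function.comp_def] at h1 h2
  split_ifs <;> fun_prop

variable {a} in
lemma continuous_expKer {X : Type*} [TopologicalSpace X] (ha : ∀ i k, Continuous (a i k))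
    {s t : X → ℝ} {x : X → Fin K → Fin d → ℝ} (hs : Continuous s) (ht : Continuous t)
    (hx : Continuous x) : Continuous fun p => expKer a i (s p) (t p) (x p) := by
  unfold WongZakai.expKer
  refine Real.continuous_exp.comp (continuous_finsetSum _ fun k _ => ?_)
  have h1 := (ha i k).comp hs
  have h2 := (ha i k).comp ht
  simp only [Function.comp_def] at h1 h2
  fun_prop

/-- The gain 1/l is the source of contraction: a large l beats any Lipschitz constant. -/
lemma integral_exp_mul_le {l t : ℝ} (hl : 0 < l) :
    ∫ s in (0 : ℝ)..t, Real.exp (l * s) ≤ Real.exp (l * t) / l := by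
  rw [intervalIntegral.integral_comp_mul_left (fun s => Real.exp s) hl.ne', integral_exp]
  simp only [mul_zero, Real.exp_zero, smul_eq_mul]
  rw [div_eq_inv_mul]
  gcongr
  linarith

/-- The basic weighted estimate for integrals along characteristics. -/
lemma norm_integral_le_of_characteristic_bound {l t A : ℝ} (hl : 0 < l) (ht : 0 ≤ t) (hA : 0 ≤ A)
    {x : Fin K → Fin d → ℝ} {F : ℝ → ℝ}
    (hF : ∀ s ∈ Ioc 0 t, |F s| ≤
      A * Real.exp (l * s) * Real.exp (quad (shift a i s t x)) * expKer a i s t x) :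
    |∫ s in (0 : ℝ)..t, F s| ≤ A / l * Real.exp (l * t) * Real.exp (quad x) := by
  have h1 : ‖∫ s in (0 : ℝ)..t, F s‖ ≤
      ∫ s in (0 : ℝ)..t, A * Real.exp (quad x) * Real.exp (l * s) := by
    refine intervalIntegral.norm_integral_le_of_norm_le ht (ae_of_all _ fun s hs => ?_)
      (Continuous.intervalIntegrable (by fun_prop) _ _)
    refine (hF s hs).trans (le_of_eq ?_)
    -- Weight at the foot of the characteristic times kernel equals the weight at x, independently
    -- of s; only exp(l s) remains to be integrated.
    rw [← exp_quad_shift_mul_expKer a i s t x]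
    ring
  rw [Real.norm_eq_abs, intervalIntegral.integral_const_mul] at h1
  refine h1.trans ?_
  have := integral_exp_mul_le (t := t) hl
  calc A * Real.exp (quad x) * ∫ s in (0 : ℝ)..t, Real.exp (l * s)
      ≤ A * Real.exp (quad x) * (Real.exp (l * t) / l) := by gcongr
    _ = _ := by ring

/-- The truncation of the real line to `[0,T]`. -/
noncomputable def clip (T t : ℝ) : ℝ := max 0 (min t T)

@[fun_prop]
lemma continuous_clip (T : ℝ) : Continuous (clip T) := by unfold clip; fun_prop

lemma clip_mem {T : ℝ} (hT : 0 ≤ T) (t : ℝ) : clip T t ∈ Icc 0 T :=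
  ⟨le_max_left _ _, max_le hT (min_le_right _ _)⟩

lemma clip_of_mem {T t : ℝ} (ht : t ∈ Icc 0 T) : clip T t = t := by
  simp [clip, ht.1, ht.2]

/-- Existence of solutions of semilinear integral equations along characteristics, among the
functions that grow at most like `exp (quad x)`. -/
theorem exists_characteristic_solution (ha : ∀ i k, Continuous (a i k)) {T L C : ℝ} (hT : 0 ≤ T)
    (hL : 0 ≤ L) {f : ℝ → (Fin K → Fin d → ℝ) → Fin d → ℝ}
    (hf : Continuous fun p : ℝ × (Fin K → Fin d → ℝ) => f p.1 p.2)
    (hfC : ∀ t ∈ Icc 0 T, ∀ x i, |f t x i| ≤ C * Real.exp (quad x))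
    {β : ℝ → (Fin K → Fin d → ℝ) → (Fin d → ℝ) → Fin d → ℝ}
    (hβ : Continuous fun p : ℝ × (Fin K → Fin d → ℝ) × (Fin d → ℝ) => β p.1 p.2.1 p.2.2)
    (hβL : ∀ s ∈ Icc 0 T, ∀ y U V i, |β s y U i - β s y V i| ≤ L * ‖U - V‖)
    (hβC : ∀ s ∈ Icc 0 T, ∀ y i, |β s y 0 i| ≤ C * Real.exp (quad y)) :
    ∃ U : ℝ → (Fin K → Fin d → ℝ) → Fin d → ℝ,
      (Continuous fun p : ℝ × (Fin K → Fin d → ℝ) => U p.1 p.2) ∧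
      (∃ C', ∀ t ∈ Icc 0 T, ∀ x, ‖U t x‖ ≤ C' * Real.exp (quad x)) ∧
      ∀ t ∈ Icc 0 T, ∀ x i, U t x i = f t x i +
        ∫ s in (0 : ℝ)..t, β s (shift a i s t x) (U s (shift a i s t x)) i * expKer a i s t x := by
  -- For d = 0 the bounds on f and β are vacuous and say nothing about the sign of C.
  rcases isEmpty_or_nonempty (Fin d) with hd | ⟨⟨i₀⟩⟩
  · exact ⟨fun _ _ _ => 0, continuous_const, ⟨0, fun t _ x => by
      rw [Subsingleton.elim (fun _ => (0 : ℝ)) (0 : Fin d → ℝ), norm_zero, zero_mul]⟩, fun _ _ _ i => hd.elim i⟩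
  have hC : 0 ≤ C := by
    have := (abs_nonneg _).trans (hfC 0 ⟨le_rfl, hT⟩ 0 i₀)
    exact nonneg_of_mul_nonneg_left this (Real.exp_pos _)
  -- Chosen so that l > 0 and L / l ≤ 1 / 2.
  set l : ℝ := 2 * L + 1 with hl
  have hl0 : 0 < l := by positivity
  -- the unweighted function of a weighted one
  let W : BoundedContinuousFunction (ℝ × (Fin K → Fin d → ℝ)) (Fin d → ℝ) →
      ℝ → (Fin K → Fin d → ℝ) → Fin d → ℝ :=
    fun V s y => (Real.exp (l * s) * Real.exp (quad y)) • V (s, y)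
  have hWc : ∀ V, Continuous fun p : ℝ × (Fin K → Fin d → ℝ) => W V p.1 p.2 := by
    intro V; simp only [W, Prod.mk.eta]; fun_prop
  let J : BoundedContinuousFunction (ℝ × (Fin K → Fin d → ℝ)) (Fin d → ℝ) →
      ℝ → (Fin K → Fin d → ℝ) → Fin d → ℝ := fun V t x i => f t x i +
        ∫ s in (0 : ℝ)..t, β s (shift a i s t x) (W V s (shift a i s t x)) i * expKer a i s t x
  have hJi : ∀ V i, Continuous fun p : (ℝ × (Fin K → Fin d → ℝ)) × ℝ =>
      β p.2 (shift a i p.2 p.1.1 p.1.2) (W V p.2 (shift a i p.2 p.1.1 p.1.2)) i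
        * expKer a i p.2 p.1.1 p.1.2 := by
    intro V i
    have h1 : Continuous fun p : (ℝ × (Fin K → Fin d → ℝ)) × ℝ => shift a i p.2 p.1.1 p.1.2 :=
      continuous_shift i ha (by fun_prop) (by fun_prop) (by fun_prop)
    have h2 : Continuous fun p : (ℝ × (Fin K → Fin d → ℝ)) × ℝ => expKer a i p.2 p.1.1 p.1.2 :=
      continuous_expKer i ha (by fun_prop) (by fun_prop) (by fun_prop)
    have h3 := (hWc V).comp (continuous_snd.prodMk h1)
    have h4 := hβ.comp (continuous_snd.prodMk (h1.prodMk h3))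
    exact ((continuous_apply i).comp h4).mul h2
  have hJc : ∀ V, Continuous fun p : ℝ × (Fin K → Fin d → ℝ) => J V p.1 p.2 := by
    intro V
    refine continuous_pi fun i => ((continuous_apply i).comp hf).add ?_
    exact intervalIntegral.continuous_parametric_intervalIntegral_of_continuous
      (hJi V i) continuous_fst
  have hint : ∀ V i t x, IntervalIntegrable (fun s => β s (shift a i s t x)
      (W V s (shift a i s t x)) i * expKer a i s t x) volume 0 t := fun V i t x =>
    Continuous.intervalIntegrable ((hJi V i).comp (by fun_prop : Continuous fun s : ℝ =>
      (((t, x), s) : (ℝ × (Fin K → Fin d → ℝ)) × ℝ))) _ _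
  have hWb : ∀ V V' : BoundedContinuousFunction (ℝ × (Fin K → Fin d → ℝ)) (Fin d → ℝ), ∀ s y,
      ‖W V s y - W V' s y‖ ≤ dist V V' * Real.exp (l * s) * Real.exp (quad y) := by
    intro V V' s y
    simp only [W, ← smul_sub, norm_smul, Real.norm_eq_abs, abs_mul, Real.abs_exp]
    rw [← dist_eq_norm]
    have := BoundedContinuousFunction.dist_coe_le_dist (f := V) (g := V') (s, y)
    calc _ ≤ Real.exp (l * s) * Real.exp (quad y) * dist V V' := by gcongr
      _ = _ := by ring
  have hdiff : ∀ V V', ∀ t ∈ Icc 0 T, ∀ x i, |J V t x i - J V' t x i| ≤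
      L * dist V V' / l * Real.exp (l * t) * Real.exp (quad x) := by
    intro V V' t ht x i
    simp only [J, add_sub_add_left_eq_sub]
    rw [← intervalIntegral.integral_sub (hint V i t x) (hint V' i t x)]
    refine norm_integral_le_of_characteristic_bound a i hl0 ht.1 (by positivity) fun s hs => ?_
    rw [← sub_mul, abs_mul, abs_of_pos (expKer_pos a i s t x)]
    have := hβL s ⟨hs.1.le, hs.2.trans ht.2⟩ (shift a i s t x) (W V s (shift a i s t x))
      (W V' s (shift a i s t x)) i
    have h2 := hWb V V' s (shift a i s t x)
    have h3 := (expKer_pos a i s t x).le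
    gcongr
    calc _ ≤ _ := this
      _ ≤ L * (dist V V' * Real.exp (l * s) * Real.exp (quad (shift a i s t x))) := by gcongr
      _ = _ := by ring
  have hzero : ∀ t ∈ Icc 0 T, ∀ x i, |J 0 t x i| ≤
      (C + C / l) * Real.exp (l * t) * Real.exp (quad x) := by
    intro t ht x i
    refine (abs_add_le _ _).trans ?_
    have h1 : |f t x i| ≤ C * Real.exp (l * t) * Real.exp (quad x) := by
      refine (hfC t ht x i).trans ?_
      have : 1 ≤ Real.exp (l * t) := Real.one_le_exp (mul_nonneg hl0.le ht.1)
      gcongr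
      exact le_mul_of_one_le_right hC this
    have h2 : |∫ s in (0 : ℝ)..t, β s (shift a i s t x) (W 0 s (shift a i s t x)) i *
        expKer a i s t x| ≤ C / l * Real.exp (l * t) * Real.exp (quad x) := by
      refine norm_integral_le_of_characteristic_bound a i hl0 ht.1 hC fun s hs => ?_
      rw [abs_mul, abs_of_pos (expKer_pos a i s t x)]
      have h3 := (expKer_pos a i s t x).le
      gcongr
      have : W 0 s (shift a i s t x) = 0 := by simp [W]
      rw [this]
      refine (hβC s ⟨hs.1.le, hs.2.trans ht.2⟩ _ i).trans ?_
      have : 1 ≤ Real.exp (l * s) := Real.one_le_exp (mul_nonneg hl0.le hs.1.le)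
      gcongr
      exact le_mul_of_one_le_right hC this
    linarith
  have hbd : ∀ V, ∀ t ∈ Icc 0 T, ∀ x i, |J V t x i| ≤
      (C + C / l + L * dist V 0 / l) * Real.exp (l * t) * Real.exp (quad x) := by
    intro V t ht x i
    have h1 := hdiff V 0 t ht x i
    have h2 := hzero t ht x i
    have h3 := abs_sub_abs_le_abs_sub (J V t x i) (J 0 t x i)
    linarith
  -- The fixed point is sought in the weighted unknown V = exp(-l t - quad x) u. Freezing time
  -- outside [0,T] by `clip` keeps the image bounded on the whole real line, so the complete space
  -- of bounded continuous functions can be used.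
  let Op : BoundedContinuousFunction (ℝ × (Fin K → Fin d → ℝ)) (Fin d → ℝ) →
      BoundedContinuousFunction (ℝ × (Fin K → Fin d → ℝ)) (Fin d → ℝ) := fun V =>
    BoundedContinuousFunction.ofNormedAddCommGroup
      (fun p => (Real.exp (-(l * clip T p.1)) * Real.exp (-quad p.2)) • J V (clip T p.1) p.2)
      (((by fun_prop : Continuous fun p : ℝ × (Fin K → Fin d → ℝ) =>
        Real.exp (-(l * clip T p.1)) * Real.exp (-quad p.2))).smul
        ((hJc V).comp (by fun_prop : Continuous fun p : ℝ × (Fin K → Fin d → ℝ) =>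
          (clip T p.1, p.2))))
      (C + C / l + L * dist V 0 / l) (fun p => by
        rw [pi_norm_le_iff_of_nonneg (by positivity)]
        intro i
        have := hbd V (clip T p.1) (clip_mem hT _) p.2 i
        simp only [Pi.smul_apply, smul_eq_mul, Real.norm_eq_abs, abs_mul, Real.exp_neg,
          abs_inv, Real.abs_exp]
        rw [← mul_inv, inv_mul_le_iff₀ (by positivity)]
        linarith)
  have hOp : ContractingWith (1 / 2) Op := by
    refine ⟨by rw [← NNReal.coe_lt_coe]; norm_num, LipschitzWith.of_dist_le_mul fun V V' => ?_⟩
    rw [BoundedContinuousFunction.dist_le (by positivity)]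
    intro p
    rw [dist_pi_le_iff (by positivity)]
    intro i
    have := hdiff V V' (clip T p.1) (clip_mem hT _) p.2 i
    have h2 : L * dist V V' / l ≤ 1 / 2 * dist V V' := by
      rw [div_le_iff₀ hl0]
      have : (0 : ℝ) ≤ dist V V' := dist_nonneg
      nlinarith
    simp only [Op, BoundedContinuousFunction.coe_ofNormedAddCommGroup, Pi.smul_apply, smul_eq_mul,
      Real.dist_eq, ← mul_sub, abs_mul, Real.exp_neg, abs_inv, Real.abs_exp]
    rw [← mul_inv, inv_mul_le_iff₀ (by positivity)]
    refine this.trans ?_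
    have h3 : 0 ≤ Real.exp (l * clip T p.1) * Real.exp (quad p.2) := by positivity
    have := mul_le_mul_of_nonneg_right h2 h3
    simp only [NNReal.coe_div, NNReal.coe_one, NNReal.coe_ofNat]
    linarith
  obtain ⟨V, hV⟩ : ∃ V, Op V = V := ⟨_, hOp.fixedPoint_isFixedPt⟩
  refine ⟨W V, hWc V, ⟨Real.exp (l * T) * ‖V‖, fun t ht x => ?_⟩, fun t ht x i => ?_⟩
  · simp only [W, norm_smul, Real.norm_eq_abs, abs_mul, Real.abs_exp]
    have h1 := V.norm_coe_le_norm (t, x)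
    have h2 : Real.exp (l * t) ≤ Real.exp (l * T) := by
      rw [Real.exp_le_exp]; exact mul_le_mul_of_nonneg_left ht.2 hl0.le
    calc _ ≤ Real.exp (l * T) * Real.exp (quad x) * ‖V‖ := by gcongr
      _ = _ := by ring
  -- For t in [0,T] the clip is the identity and the weights cancel, leaving the integral equation.
  · have h1 : V (t, x) i = (Op V) (t, x) i := by rw [hV]
    have h2 : W V t x i = J V t x i := by
      simp only [W, Pi.smul_apply, smul_eq_mul]
      rw [h1]
      simp only [Op, BoundedContinuousFunction.coe_ofNormedAddCommGroup, Pi.smul_apply,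
        smul_eq_mul, clip_of_mem ht, Real.exp_neg]
      field_simp
    exact h2

end Characteristics

end WongZakai

/-! ### Gronwall inequalities along characteristics. -/

namespace WongZakai

section Gronwall

variable {K d : ℕ} {a : Fin d → Fin K → ℝ → ℝ}

/-- A Gronwall inequality along characteristics. -/
lemma norm_le_of_characteristic_ineq {T L C B : ℝ}
    (hL : 0 ≤ L) (hC : 0 ≤ C) {m : ℝ → (Fin K → Fin d → ℝ) → Fin d → ℝ}
    (hmB : ∀ t ∈ Icc 0 T, ∀ x, ‖m t x‖ ≤ B * Real.exp (quad x))
    (hm : ∀ t ∈ Icc 0 T, ∀ x i, |m t x i| ≤ C * Real.exp (quad x) +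
      L * ∫ s in (0 : ℝ)..t, ‖m s (shift a i s t x)‖ * expKer a i s t x) :
    ∀ t ∈ Icc 0 T, ∀ x, ‖m t x‖ ≤ 2 * C * Real.exp ((2 * L + 1) * t) * Real.exp (quad x) := by
  have hl0 : 0 < 2 * L + 1 := by positivity
  -- The a priori bound B only starts the iteration. Each use of the inequality halves the excess
  -- over 2C, because C + (2C + q)/2 = 2C + q/2; letting J tend to infinity removes B.
  have key : ∀ J : ℕ, ∀ t ∈ Icc 0 T, ∀ x, ‖m t x‖ ≤
      (2 * C + |B| / 2 ^ J) * Real.exp ((2 * L + 1) * t) * Real.exp (quad x) := by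
    intro J
    induction J with
    | zero =>
      intro t ht x
      refine (hmB t ht x).trans ?_
      have h1 : 1 ≤ Real.exp ((2 * L + 1) * t) := Real.one_le_exp (mul_nonneg hl0.le ht.1)
      gcongr
      calc B ≤ (2 * C + |B| / 2 ^ 0) * 1 := by
            have := le_abs_self B
            simp only [pow_zero, div_one, mul_one]; linarith
        _ ≤ _ := by gcongr
    | succ J ih =>
      intro t ht x
      rw [pi_norm_le_iff_of_nonneg (by positivity)]
      intro i
      have h1 := norm_integral_le_of_characteristic_bound a i hl0 ht.1
        (A := 2 * C + |B| / 2 ^ J) (by positivity) (x := x)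
        (F := fun s => ‖m s (shift a i s t x)‖ * expKer a i s t x) (fun s hs => by
          rw [abs_mul, abs_norm, abs_of_pos (expKer_pos a i s t x)]
          have := (expKer_pos a i s t x).le
          gcongr
          exact ih s ⟨hs.1.le, hs.2.trans ht.2⟩ _)
      have h2 : L * ((2 * C + |B| / 2 ^ J) / (2 * L + 1)) ≤ (2 * C + |B| / 2 ^ J) / 2 := by
        rw [mul_div_assoc', div_le_div_iff₀ hl0 two_pos]
        have : 0 ≤ 2 * C + |B| / 2 ^ J := by positivity
        nlinarith
      have h3 : 1 ≤ Real.exp ((2 * L + 1) * t) := Real.one_le_exp (mul_nonneg hl0.le ht.1)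
      calc |m t x i| ≤ C * Real.exp (quad x) +
            L * ∫ s in (0 : ℝ)..t, ‖m s (shift a i s t x)‖ * expKer a i s t x := hm t ht x i
        _ ≤ C * Real.exp ((2 * L + 1) * t) * Real.exp (quad x) +
            L * ((2 * C + |B| / 2 ^ J) / (2 * L + 1) * Real.exp ((2 * L + 1) * t)
              * Real.exp (quad x)) := by
            gcongr
            · exact le_mul_of_one_le_right hC h3
            · exact (le_abs_self _).trans h1
        _ = (C + L * ((2 * C + |B| / 2 ^ J) / (2 * L + 1))) * Real.exp ((2 * L + 1) * t)
              * Real.exp (quad x) := by ring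
        _ ≤ (C + (2 * C + |B| / 2 ^ J) / 2) * Real.exp ((2 * L + 1) * t)
              * Real.exp (quad x) := by gcongr
        _ = _ := by rw [pow_succ]; field_simp; ring
  intro t ht x
  have hlim : Tendsto (fun J : ℕ => (2 * C + |B| / 2 ^ J) * Real.exp ((2 * L + 1) * t) *
      Real.exp (quad x)) atTop (𝓝 ((2 * C + 0) * Real.exp ((2 * L + 1) * t) *
        Real.exp (quad x))) := by
    have : Tendsto (fun J : ℕ => |B| / 2 ^ J) atTop (𝓝 0) :=
      tendsto_const_nhds.div_atTop (tendsto_pow_atTop_atTop_of_one_lt one_lt_two)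
    exact ((tendsto_const_nhds.add this).mul_const _).mul_const _
  rw [add_zero] at hlim
  exact ge_of_tendsto' hlim fun J => key J t ht x

/-- A pointwise limit version of Gronwall's inequality along characteristics. -/
theorem tendsto_zero_of_characteristic_ineq (ha : ∀ i k, Continuous (a i k))
    {ι : Type*} {l : Filter ι} [l.IsCountablyGenerated]
    {T L C : ℝ} (hL : 0 ≤ L) (hC : 0 ≤ C) {m ε : ι → ℝ → (Fin K → Fin d → ℝ) → Fin d → ℝ}
    (hmc : ∀ n, Continuous fun p : ℝ × (Fin K → Fin d → ℝ) => m n p.1 p.2)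
    (hmB : ∀ n, ∃ B, ∀ t ∈ Icc 0 T, ∀ x, ‖m n t x‖ ≤ B * Real.exp (quad x))
    (hεC : ∀ᶠ n in l, ∀ t ∈ Icc 0 T, ∀ x i, ε n t x i ≤ C * Real.exp (quad x))
    (hε : ∀ t ∈ Icc 0 T, ∀ x i, Tendsto (fun n => ε n t x i) l (𝓝 0))
    (hm : ∀ n, ∀ t ∈ Icc 0 T, ∀ x i, |m n t x i| ≤ ε n t x i +
      L * ∫ s in (0 : ℝ)..t, ‖m n s (shift a i s t x)‖ * expKer a i s t x) :
    ∀ t ∈ Icc 0 T, ∀ x, Tendsto (fun n => m n t x) l (𝓝 0) := by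
  have hl0 : 0 < 2 * L + 1 := by positivity
  have hunif : ∀ᶠ n in l, ∀ t ∈ Icc 0 T, ∀ x, ‖m n t x‖ ≤
      2 * C * Real.exp ((2 * L + 1) * t) * Real.exp (quad x) := by
    filter_upwards [hεC] with n hn
    obtain ⟨B, hB⟩ := hmB n
    exact norm_le_of_characteristic_ineq hL hC hB fun t ht x i =>
      (hm n t ht x i).trans (by gcongr; exact hn t ht x i)
  -- The errors are small only pointwise in (t, x), so the weighted supremum need not tend to zero.
  -- Instead the pointwise asymptotic bound is halved at each step, with δ absorbing the terms that
  -- vanish in the limit.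
  have key : ∀ J : ℕ, ∀ t ∈ Icc 0 T, ∀ x, ∀ δ > 0, ∀ᶠ n in l, ‖m n t x‖ ≤
      2 * C / 2 ^ J * Real.exp ((2 * L + 1) * t) * Real.exp (quad x) + δ := by
    intro J
    induction J with
    | zero =>
      intro t ht x δ hδ
      filter_upwards [hunif] with n hn
      have := hn t ht x
      simp only [pow_zero, div_one]
      linarith
    | succ J ih =>
      intro t ht x δ hδ
      set A : ℝ := 2 * C / 2 ^ J with hA
      have hA0 : 0 ≤ A := by positivity
      have hshift : ∀ i, Continuous fun s => shift a i s t x := fun i =>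
        continuous_shift i ha continuous_id continuous_const continuous_const
      have hker : ∀ i, Continuous fun s => expKer a i s t x := fun i =>
        continuous_expKer i ha continuous_id continuous_const continuous_const
      -- The excess over the bound of the previous step. It tends to zero pointwise and is dominated
      -- through the uniform bound, so its integral along the characteristic vanishes in the limit.
      let r : Fin d → ι → ℝ → ℝ := fun i n s => max (‖m n s (shift a i s t x)‖ -
        A * Real.exp ((2 * L + 1) * s) * Real.exp (quad (shift a i s t x))) 0
      have hmcont : ∀ i n, Continuous fun s => ‖m n s (shift a i s t x)‖ := fun i n =>
        ((hmc n).comp (continuous_id.prodMk (hshift i))).norm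
      have hrc : ∀ i n, Continuous (r i n) := by
        intro i n
        have := hmcont i n
        have := hshift i
        fun_prop
      have hr : ∀ i, Tendsto (fun n => ∫ s in (0 : ℝ)..t, r i n s * expKer a i s t x) l (𝓝 0) := by
        intro i
        suffices hs : Tendsto (fun n => ∫ s in (0 : ℝ)..t, r i n s * expKer a i s t x) l
            (𝓝 (∫ s in (0 : ℝ)..t, (0 : ℝ))) by simpa using hs
        refine intervalIntegral.tendsto_integral_filter_of_dominated_convergence
          (fun s => 2 * C * Real.exp ((2 * L + 1) * s) * Real.exp (quad x))
          (Eventually.of_forall fun n => ((hrc i n).mul (hker i)).aestronglyMeasurable) ?_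
          ((by fun_prop : Continuous fun s : ℝ => 2 * C * Real.exp ((2 * L + 1) * s) *
            Real.exp (quad x)).intervalIntegrable _ _) ?_
        · filter_upwards [hunif] with n hn
          refine ae_of_all _ fun s hs => ?_
          rw [uIoc_of_le ht.1] at hs
          rw [Real.norm_eq_abs, abs_mul, abs_of_pos (expKer_pos a i s t x),
            ← exp_quad_shift_mul_expKer a i s t x, ← mul_assoc]
          have := (expKer_pos a i s t x).le
          gcongr
          rw [abs_of_nonneg (le_max_right _ _)]
          refine max_le ?_ (by positivity)
          have h1 := hn s ⟨hs.1.le, hs.2.trans ht.2⟩ (shift a i s t x)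
          have : 0 ≤ A * Real.exp ((2 * L + 1) * s) * Real.exp (quad (shift a i s t x)) := by
            positivity
          linarith
        · refine ae_of_all _ fun s hs => ?_
          rw [uIoc_of_le ht.1] at hs
          rw [← zero_mul (expKer a i s t x)]
          refine Tendsto.mul_const _ ?_
          rw [Metric.tendsto_nhds]
          intro η hη
          filter_upwards [ih s ⟨hs.1.le, hs.2.trans ht.2⟩ (shift a i s t x) (η / 2) (by positivity)]
            with n hn
          rw [Real.dist_eq, sub_zero, abs_of_nonneg (le_max_right _ _)]
          refine max_lt ?_ hη
          linarith
      have hi : ∀ i, ∀ᶠ n in l, |m n t x i| ≤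
          2 * C / 2 ^ (J + 1) * Real.exp ((2 * L + 1) * t) * Real.exp (quad x) + δ := by
        intro i
        have h1 := (hε t ht x i).add ((hr i).const_mul L)
        rw [mul_zero, add_zero] at h1
        filter_upwards [h1.eventually (gt_mem_nhds hδ)] with n hn
        have h2 : ∫ s in (0 : ℝ)..t, ‖m n s (shift a i s t x)‖ * expKer a i s t x ≤
            ∫ s in (0 : ℝ)..t, ((A * Real.exp (quad x) * Real.exp ((2 * L + 1) * s)) +
              r i n s * expKer a i s t x) := by
          -- The part within the previous bound is integrated exactly and halved by the factor
          -- 1/(2L+1); the excess is kept as an integral.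
          refine intervalIntegral.integral_mono_on ht.1
            (((hmcont i n).mul (hker i)).intervalIntegrable _ _)
            (Continuous.intervalIntegrable (by have := hrc i n; have := hker i; fun_prop) _ _)
            fun s hs => ?_
          rw [← exp_quad_shift_mul_expKer a i s t x]
          have h3 : ‖m n s (shift a i s t x)‖ ≤ A * Real.exp ((2 * L + 1) * s) *
            Real.exp (quad (shift a i s t x)) + r i n s := by
            have := le_max_left (‖m n s (shift a i s t x)‖ -
              A * Real.exp ((2 * L + 1) * s) * Real.exp (quad (shift a i s t x))) 0
            simp only [r]; linarith
          have := mul_le_mul_of_nonneg_right h3 (expKer_pos a i s t x).le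
          linarith
        have hrk : IntervalIntegrable (fun s => r i n s * expKer a i s t x) volume 0 t :=
          ((hrc i n).mul (hker i)).intervalIntegrable _ _
        rw [intervalIntegral.integral_add (Continuous.intervalIntegrable (by fun_prop) _ _) hrk,
          intervalIntegral.integral_const_mul] at h2
        have h4 := integral_exp_mul_le (t := t) hl0
        have h5 : L * (A * Real.exp (quad x) * (Real.exp ((2 * L + 1) * t) / (2 * L + 1))) ≤
            A / 2 * Real.exp ((2 * L + 1) * t) * Real.exp (quad x) := by
          have : L * (1 / (2 * L + 1)) ≤ 1 / 2 := by
            rw [mul_one_div, div_le_div_iff₀ hl0 two_pos]; linarith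
          calc _ = (L * (1 / (2 * L + 1))) * (A * Real.exp ((2 * L + 1) * t) *
                Real.exp (quad x)) := by ring
            _ ≤ 1 / 2 * (A * Real.exp ((2 * L + 1) * t) * Real.exp (quad x)) := by gcongr
            _ = _ := by ring
        have h6 : L * ∫ s in (0 : ℝ)..t, ‖m n s (shift a i s t x)‖ * expKer a i s t x ≤
            A / 2 * Real.exp ((2 * L + 1) * t) * Real.exp (quad x) +
              L * ∫ s in (0 : ℝ)..t, r i n s * expKer a i s t x := by
          calc _ ≤ L * (A * Real.exp (quad x) * (Real.exp ((2 * L + 1) * t) / (2 * L + 1)) +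
                ∫ s in (0 : ℝ)..t, r i n s * expKer a i s t x) := by
                gcongr
                refine h2.trans ?_
                gcongr
            _ ≤ _ := by rw [mul_add]; gcongr
        have h7 : 2 * C / 2 ^ (J + 1) = A / 2 := by rw [hA, pow_succ]; field_simp
        rw [h7]
        have := hm n t ht x i
        linarith
      filter_upwards [eventually_all.2 hi] with n hn
      rw [pi_norm_le_iff_of_nonneg (by positivity)]
      exact hn
  intro t ht x
  rw [tendsto_zero_iff_norm_tendsto_zero, Metric.tendsto_nhds]
  intro δ hδ
  have hlim : Tendsto (fun J : ℕ => 2 * C / 2 ^ J * Real.exp ((2 * L + 1) * t) *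
      Real.exp (quad x)) atTop (𝓝 (0 * Real.exp ((2 * L + 1) * t) * Real.exp (quad x))) := by
    have : Tendsto (fun J : ℕ => 2 * C / (2 : ℝ) ^ J) atTop (𝓝 0) :=
      tendsto_const_nhds.div_atTop (tendsto_pow_atTop_atTop_of_one_lt one_lt_two)
    exact (this.mul_const _).mul_const _
  rw [zero_mul, zero_mul] at hlim
  obtain ⟨J, hJ⟩ := (hlim.eventually (gt_mem_nhds (half_pos hδ))).exists
  filter_upwards [key J t ht x (δ / 2 / 2) (by positivity)] with n hn
  rw [dist_zero_right, norm_norm]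
  linarith

end Gronwall

end WongZakai

/-! ### Functions with continuous partial derivatives. -/

namespace WongZakai

section Partial

variable {ι : Type*} [Fintype ι]

/-- A function on `ι → ℝ` with continuous partial derivatives is differentiable. -/
theorem hasFDerivAt_of_continuous_lineDeriv [DecidableEq ι] {g : (ι → ℝ) → ℝ}
    (hg : ∀ x j, LineDifferentiableAt ℝ g x (Pi.single j (1 : ℝ)))
    (hc : ∀ j, Continuous fun x => lineDeriv ℝ g x (Pi.single j (1 : ℝ))) (x : ι → ℝ) :
    HasFDerivAt g (∑ j, lineDeriv ℝ g x (Pi.single j (1 : ℝ)) •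
      (ContinuousLinearMap.proj j : (ι → ℝ) →L[ℝ] ℝ)) x := by
  set D : ι → (ι → ℝ) → ℝ := fun j x => lineDeriv ℝ g x (Pi.single j (1 : ℝ)) with hD
  have hder : ∀ z j τ, HasDerivAt (fun τ : ℝ => g (z + τ • Pi.single j (1 : ℝ)))
      (D j (z + τ • Pi.single j (1 : ℝ))) τ := by
    intro z j τ
    have h1 : HasDerivAt (fun r : ℝ => g (z + τ • Pi.single j (1 : ℝ) + r • Pi.single j (1 : ℝ)))
        (D j (z + τ • Pi.single j (1 : ℝ))) (τ - τ) := by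
      rw [sub_self]; exact (hg (z + τ • Pi.single j (1 : ℝ)) j).hasLineDerivAt
    have h2 := h1.comp_sub_const τ τ
    refine h2.congr_of_eventuallyEq (Eventually.of_forall fun r => ?_)
    simp only [add_assoc, ← add_smul]
    congr 3; ring
  -- Induction on the set of coordinates in which h may be nonzero. A further coordinate costs one
  -- mean value estimate along its axis, where the partial derivative stays within ε of its value at
  -- x.
  have key : ∀ ε > 0, ∀ S : Finset ι, ∃ δ > 0, ∀ y, ‖y - x‖ < δ → ∀ h : ι → ℝ, ‖h‖ < δ →
      (∀ j ∉ S, h j = 0) →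
      |g (y + h) - g y - ∑ j ∈ S, D j x * h j| ≤ S.card * (ε * ‖h‖) := by
    intro ε hε S
    classical
    induction S using Finset.induction_on with
    | empty =>
      refine ⟨1, one_pos, fun y _ h _ h0 => ?_⟩
      have : h = 0 := funext fun j => h0 j (Finset.notMem_empty j)
      simp [this]
    | insert j S hj ih =>
      obtain ⟨δ, hδ, ih⟩ := ih
      obtain ⟨η, hη, hcη⟩ : ∃ η > 0, ∀ z, dist z x < η → dist (D j z) (D j x) < ε := by
        obtain ⟨η, hη, h⟩ := Metric.continuousAt_iff.1 (hc j).continuousAt ε hε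
        exact ⟨η, hη, fun z hz => h hz⟩
      -- Half of η for y - x and half for the displacement, so that the whole segment stays in the
      -- η-ball about x.
      refine ⟨min δ (η / 2), by positivity, fun y hy h hh h0 => ?_⟩
      set h' : ι → ℝ := Function.update h j 0 with hh'
      have hn' : ‖h'‖ ≤ ‖h‖ := by
        rw [pi_norm_le_iff_of_nonneg (norm_nonneg _)]
        intro k
        by_cases hk : k = j
        · subst hk; simp [hh']
        · simp only [hh', Function.update_of_ne hk]; exact norm_le_pi_norm h k
      have hsplit : h = h' + h j • Pi.single j (1 : ℝ) := by
        ext k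
        by_cases hk : k = j
        · subst hk; simp [hh']
        · simp [hh', hk]
      have h1 := ih y (hy.trans_le (min_le_left _ _)) h'
        ((hn'.trans_lt hh).trans_le (min_le_left _ _)) (by
          intro k hk
          by_cases hkj : k = j
          · subst hkj; simp [hh']
          · rw [hh', Function.update_of_ne hkj]
            exact h0 k (by simp [hkj, hk]))
      have hsum : ∑ k ∈ S, D k x * h' k = ∑ k ∈ S, D k x * h k := by
        refine Finset.sum_congr rfl fun k hk => ?_
        rw [hh', Function.update_of_ne (ne_of_mem_of_not_mem hk hj)]
      have h2 : |(g (y + h' + h j • Pi.single j (1 : ℝ)) - D j x * h j) -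
          (g (y + h' + (0 : ℝ) • Pi.single j (1 : ℝ)) - D j x * 0)| ≤ ε * |h j - 0| := by
        refine (convex_uIcc (0 : ℝ) (h j)).norm_image_sub_le_of_norm_hasDerivWithin_le
          (f := fun τ => g (y + h' + τ • Pi.single j (1 : ℝ)) - D j x * τ)
          (f' := fun τ => D j (y + h' + τ • Pi.single j (1 : ℝ)) - D j x) ?_ ?_
          left_mem_uIcc right_mem_uIcc
        · intro τ _
          have := ((hder (y + h') j τ).sub ((hasDerivAt_id τ).const_mul (D j x)))
          rw [mul_one] at this
          exact this.hasDerivWithinAt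
        · intro τ hτ
          have hτh : |τ| ≤ ‖h‖ := by
            have h3 : |τ| ≤ |h j| := by
              have := abs_sub_left_of_mem_uIcc hτ
              simpa using this
            exact h3.trans (norm_le_pi_norm h j)
          have hle : ‖h' + τ • Pi.single j (1 : ℝ)‖ ≤ ‖h‖ := by
            rw [pi_norm_le_iff_of_nonneg (norm_nonneg _)]
            intro k
            by_cases hk : k = j
            · subst hk; simpa [hh'] using hτh
            · simp only [hh', Pi.add_apply, Function.update_of_ne hk, Pi.smul_apply,
                Pi.single_eq_of_ne hk, smul_zero, add_zero]
              exact norm_le_pi_norm h k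
          rw [← dist_eq_norm]
          refine (hcη _ ?_).le
          have hy2 : ‖y - x‖ < η / 2 := lt_of_lt_of_le hy (min_le_right δ (η / 2))
          have hh2 : ‖h‖ < η / 2 := lt_of_lt_of_le hh (min_le_right δ (η / 2))
          have h5 : dist (y + h' + τ • Pi.single j (1 : ℝ)) x ≤
              ‖y - x‖ + ‖h' + τ • Pi.single j (1 : ℝ)‖ := by
            rw [dist_eq_norm, add_assoc, add_sub_right_comm]
            exact norm_add_le _ _
          linarith
      rw [Finset.sum_insert hj, Finset.card_insert_of_notMem hj, ← hsum]
      rw [zero_smul, add_zero, mul_zero, sub_zero, sub_zero, add_assoc, ← hsplit] at h2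
      have h3 : |h j| ≤ ‖h‖ := norm_le_pi_norm h j
      calc _ = |(g (y + h) - D j x * h j - g (y + h')) +
            (g (y + h') - g y - ∑ k ∈ S, D k x * h' k)| := by congr 1; ring
        _ ≤ ε * |h j| + S.card * (ε * ‖h'‖) := (abs_add_le _ _).trans (add_le_add h2 h1)
        _ ≤ ε * ‖h‖ + S.card * (ε * ‖h‖) :=
          add_le_add (mul_le_mul_of_nonneg_left h3 hε.le) (mul_le_mul_of_nonneg_left
            (mul_le_mul_of_nonneg_left hn' hε.le) (Nat.cast_nonneg _))
        _ = _ := by push_cast; ring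
  rw [hasFDerivAt_iff_isLittleO_nhds_zero, Asymptotics.isLittleO_iff]
  intro c hc0
  have hcard : (0 : ℝ) < Fintype.card ι + 1 := Nat.cast_add_one_pos _
  obtain ⟨δ, hδ, hk⟩ := key (c / (Fintype.card ι + 1)) (div_pos hc0 hcard) Finset.univ
  filter_upwards [Metric.ball_mem_nhds (0 : ι → ℝ) hδ] with h hh
  have := hk x (by rwa [sub_self, norm_zero]) h (mem_ball_zero_iff.1 hh)
    (fun j hj => absurd (Finset.mem_univ j) hj)
  simp only [Real.norm_eq_abs, sum_apply, smul_apply,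
    ContinuousLinearMap.proj_apply, smul_eq_mul]
  refine this.trans ?_
  rw [Finset.card_univ, ← mul_assoc]
  gcongr
  rw [mul_div_assoc', div_le_iff₀ hcard]
  nlinarith

/-- Bounded partial derivatives give a Lipschitz estimate. -/
lemma abs_sub_le_of_hasFDerivAt_sum {g : (ι → ℝ) → ℝ} {D : (ι → ℝ) → ι → ℝ} {M : ℝ}
    (hg : ∀ x, HasFDerivAt g (∑ j, D x j • (ContinuousLinearMap.proj j : (ι → ℝ) →L[ℝ] ℝ)) x)
    (hM : ∀ x j, |D x j| ≤ M) (x y : ι → ℝ) :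
    |g x - g y| ≤ Fintype.card ι * M * ‖x - y‖ := by
  refine convex_univ.norm_image_sub_le_of_norm_hasFDerivWithin_le (𝕜 := ℝ)
    (fun z _ => (hg z).hasFDerivWithinAt) (fun z _ => ?_) (mem_univ y) (mem_univ x)
  rcases isEmpty_or_nonempty ι with hι | ⟨⟨j₀⟩⟩
  · simp
  have hM0 : 0 ≤ M := (abs_nonneg _).trans (hM x j₀)
  refine ContinuousLinearMap.opNorm_le_bound _ (by positivity) fun v => ?_
  simp only [sum_apply, smul_apply,
    ContinuousLinearMap.proj_apply, smul_eq_mul]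
  refine (norm_sum_le _ _).trans ?_
  calc ∑ j, ‖D z j * v j‖ ≤ ∑ _j : ι, M * ‖v‖ := by
        refine Finset.sum_le_sum fun j _ => ?_
        rw [norm_mul]
        exact mul_le_mul (hM z j) (norm_le_pi_norm v j) (norm_nonneg _) hM0
    _ = _ := by simp [mul_assoc]

end Partial

end WongZakai

/-! ### Linearisation of the integral equation. -/

namespace WongZakai

section Linearization

variable {K d : ℕ} {a : Fin d → Fin K → ℝ → ℝ}

/-- The derivative of the exponent of `expKer` in the direction `h`. -/
def slope (a : Fin d → Fin K → ℝ → ℝ) (i : Fin d) (s t : ℝ) (h : Fin K → Fin d → ℝ) : ℝ :=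
  ∑ k, h k i * (a i k t - a i k s)

lemma expKer_add (i : Fin d) (s t : ℝ) (x h : Fin K → Fin d → ℝ) :
    expKer a i s t (x + h) = expKer a i s t x * Real.exp (slope a i s t h) := by
  rw [expKer, expKer, slope, ← Real.exp_add, ← Finset.sum_add_distrib]
  congr 1
  refine Finset.sum_congr rfl fun k _ => ?_
  simp only [Pi.add_apply]
  ring

/-- Used to assemble the linearised equations in the coordinate directions (k, j) into the one in
direction h. -/
lemma sum_mul_ite_eq_slope (i : Fin d) (s t : ℝ) (h : Fin K → Fin d → ℝ) :
    ∑ k, ∑ j, h k j * (if j = i then a i k t - a i k s else 0) = slope a i s t h := by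
  simp [slope]

lemma exists_increment_bound (ha : ∀ i k, Continuous (a i k)) (T : ℝ) :
    ∃ R : ℝ, 0 ≤ R ∧ ∀ s ∈ Icc 0 T, ∀ t ∈ Icc 0 T, ∀ i k, |a i k t - a i k s| ≤ R := by
  have h1 : ∀ i k, ∃ R, ∀ s ∈ Icc 0 T, |a i k s| ≤ R := fun i k =>
    isCompact_Icc.exists_bound_of_continuousOn (ha i k).continuousOn
  choose R hR using h1
  refine ⟨2 * ∑ i, ∑ k, |R i k|, by positivity, fun s hs t ht i k => ?_⟩
  have h2 : |R i k| ≤ ∑ i, ∑ k, |R i k| :=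
    (Finset.single_le_sum (f := fun k => |R i k|) (fun _ _ => abs_nonneg _)
      (Finset.mem_univ k)).trans
    (Finset.single_le_sum (f := fun i => ∑ k, |R i k|)
      (fun _ _ => Finset.sum_nonneg fun _ _ => abs_nonneg _) (Finset.mem_univ i))
  have h3 := abs_sub (a i k t) (a i k s)
  have h4 := hR i k t ht
  have h5 := hR i k s hs
  have h6 := le_abs_self (R i k)
  linarith

lemma abs_slope_le {R : ℝ} {i : Fin d} {s t : ℝ} (hR : ∀ k, |a i k t - a i k s| ≤ R)
    (h : Fin K → Fin d → ℝ) : |slope a i s t h| ≤ K * R * ‖h‖ := by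
  refine (Finset.abs_sum_le_sum_abs _ _).trans ?_
  calc ∑ k, |h k i * (a i k t - a i k s)| ≤ ∑ _k : Fin K, ‖h‖ * R := by
        refine Finset.sum_le_sum fun k _ => ?_
        rw [abs_mul]
        exact mul_le_mul ((norm_le_pi_norm (h k) i).trans (norm_le_pi_norm h k)) (hR k)
          (abs_nonneg _) (norm_nonneg _)
    _ = _ := by simp; ring

/-- The coefficients of the semilinear system, together with a solution of the integral equation
along characteristics. -/
structure IsCharacteristicSolution (a : Fin d → Fin K → ℝ → ℝ) (T : ℝ) (c : Fin d → ℝ)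
    (b : ℝ → (Fin d → ℝ) → Fin d → ℝ) (db : ℝ → (Fin d → ℝ) → Fin d → Fin d → ℝ) (M L : ℝ)
    (u : ℝ → (Fin K → Fin d → ℝ) → Fin d → ℝ) : Prop where
  a_cont : ∀ i k, Continuous (a i k)
  T_nonneg : 0 ≤ T
  M_nonneg : 0 ≤ M
  L_nonneg : 0 ≤ L
  b_cont : Continuous fun p : ℝ × (Fin d → ℝ) => b p.1 p.2
  db_cont : ∀ i j, Continuous fun p : ℝ × (Fin d → ℝ) => db p.1 p.2 i j
  b_deriv : ∀ s ∈ Icc 0 T, ∀ x i, HasFDerivAt (fun y => b s y i)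
    (∑ j, db s x i j • (ContinuousLinearMap.proj j : (Fin d → ℝ) →L[ℝ] ℝ)) x
  b_le : ∀ s ∈ Icc 0 T, ∀ x i, |b s x i| ≤ M
  db_le : ∀ s ∈ Icc 0 T, ∀ x i j, |db s x i j| ≤ L
  u_cont : Continuous fun p : ℝ × (Fin K → Fin d → ℝ) => u p.1 p.2
  eqn : ∀ t ∈ Icc 0 T, ∀ x i, u t x i = c i * expKer a i 0 t x +
    ∫ s in (0 : ℝ)..t, b s (u s (shift a i s t x)) i * expKer a i s t x

namespace IsCharacteristicSolution

variable {T M L : ℝ} {c : Fin d → ℝ} {b : ℝ → (Fin d → ℝ) → Fin d → ℝ}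
  {db : ℝ → (Fin d → ℝ) → Fin d → Fin d → ℝ} {u : ℝ → (Fin K → Fin d → ℝ) → Fin d → ℝ}

lemma lipschitz (hu : IsCharacteristicSolution a T c b db M L u) {s : ℝ} (hs : s ∈ Icc 0 T)
    (x y : Fin d → ℝ) (i : Fin d) : |b s x i - b s y i| ≤ d * L * ‖x - y‖ := by
  have := abs_sub_le_of_hasFDerivAt_sum (g := fun y => b s y i) (D := fun x j => db s x i j)
    (hu.b_deriv s hs · i) (hu.db_le s hs · i) x y
  simpa using this

lemma expKer_add_le {R : ℝ}
    (hR : ∀ s ∈ Icc 0 T, ∀ t ∈ Icc 0 T, ∀ i k, |a i k t - a i k s| ≤ R) {s t : ℝ}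
    (hs : s ∈ Icc 0 T) (ht : t ∈ Icc 0 T) (i : Fin d) (x h : Fin K → Fin d → ℝ) :
    expKer a i s t (x + h) ≤ Real.exp (K * R * ‖h‖) * Real.exp (quad x) := by
  rw [expKer_add, mul_comm]
  have h1 := abs_slope_le (hR s hs t ht i) h
  have h2 := le_abs_self (slope a i s t h)
  have h3 := expKer_le_exp_quad a i s t x
  have h4 := (expKer_pos a i s t x).le
  gcongr
  linarith

/-- A crude bound from |b| ≤ M. It supplies the a priori bound, allowed to depend on h, that
Gronwall requires of the difference quotients. -/
lemma norm_add_le (hu : IsCharacteristicSolution a T c b db M L u) {R : ℝ}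
    (hR : ∀ s ∈ Icc 0 T, ∀ t ∈ Icc 0 T, ∀ i k, |a i k t - a i k s| ≤ R)
    (h : Fin K → Fin d → ℝ) {t : ℝ} (ht : t ∈ Icc 0 T) (x : Fin K → Fin d → ℝ) :
    ‖u t (x + h)‖ ≤ (‖c‖ + M * T) * Real.exp (K * R * ‖h‖) * Real.exp (quad x) := by
  have hM := hu.M_nonneg
  have hT := hu.T_nonneg
  rw [pi_norm_le_iff_of_nonneg (by positivity)]
  intro i
  rw [hu.eqn t ht (x + h) i]
  refine (_root_.norm_add_le _ _).trans ?_
  have h1 : ‖c i * expKer a i 0 t (x + h)‖ ≤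
      ‖c‖ * (Real.exp (K * R * ‖h‖) * Real.exp (quad x)) := by
    rw [norm_mul, Real.norm_of_nonneg (expKer_pos _ _ _ _ _).le]
    have := expKer_add_le hR ⟨le_rfl, hT⟩ ht i x h
    have h2 := norm_le_pi_norm c i
    have h3 := (expKer_pos a i 0 t (x + h)).le
    gcongr
  have h2 : ‖∫ s in (0 : ℝ)..t, b s (u s (shift a i s t (x + h))) i * expKer a i s t (x + h)‖ ≤
      M * (Real.exp (K * R * ‖h‖) * Real.exp (quad x)) * |t - 0| := by
    refine intervalIntegral.norm_integral_le_of_norm_le_const fun s hs => ?_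
    rw [uIoc_of_le ht.1] at hs
    have hs' : s ∈ Icc 0 T := ⟨hs.1.le, hs.2.trans ht.2⟩
    rw [norm_mul, Real.norm_of_nonneg (expKer_pos _ _ _ _ _).le]
    exact mul_le_mul (hu.b_le s hs' _ i) (expKer_add_le hR hs' ht i x h)
      (expKer_pos _ _ _ _ _).le hM
  rw [sub_zero, abs_of_nonneg ht.1] at h2
  have h3 : M * (Real.exp (K * R * ‖h‖) * Real.exp (quad x)) * t ≤
      M * (Real.exp (K * R * ‖h‖) * Real.exp (quad x)) * T := by
    gcongr; exact ht.2
  calc _ ≤ _ := add_le_add h1 (h2.trans h3)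
    _ = _ := by ring

lemma continuous_u_shift (hu : IsCharacteristicSolution a T c b db M L u) (i : Fin d) :
    Continuous fun p : (ℝ × (Fin K → Fin d → ℝ)) × ℝ => u p.2 (shift a i p.2 p.1.1 p.1.2) :=
  hu.u_cont.comp (continuous_snd.prodMk (continuous_shift i hu.a_cont (by fun_prop)
    (by fun_prop) (by fun_prop)))

lemma continuous_b_shift (hu : IsCharacteristicSolution a T c b db M L u) (i : Fin d) :
    Continuous fun p : (ℝ × (Fin K → Fin d → ℝ)) × ℝ =>
      b p.2 (u p.2 (shift a i p.2 p.1.1 p.1.2)) i :=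
  (continuous_apply i).comp (hu.b_cont.comp (continuous_snd.prodMk (hu.continuous_u_shift i)))

/-- The linearised equation in the direction of the `(k, j)`-th coordinate is solvable. -/
lemma exists_linearised (hu : IsCharacteristicSolution a T c b db M L u) (k : Fin K) (j : Fin d) :
    ∃ w : ℝ → (Fin K → Fin d → ℝ) → Fin d → ℝ,
      (Continuous fun p : ℝ × (Fin K → Fin d → ℝ) => w p.1 p.2) ∧
      (∃ C', ∀ t ∈ Icc 0 T, ∀ x, ‖w t x‖ ≤ C' * Real.exp (quad x)) ∧
      ∀ t ∈ Icc 0 T, ∀ x i, w t x i =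
        c i * (if j = i then a i k t - a i k 0 else 0) * expKer a i 0 t x +
        ∫ s in (0 : ℝ)..t, (b s (u s (shift a i s t x)) i *
            (if j = i then a i k t - a i k s else 0) +
          ∑ l, db s (u s (shift a i s t x)) i l * w s (shift a i s t x) l) *
            expKer a i s t x := by
  obtain ⟨R, hR0, hR⟩ := exists_increment_bound hu.a_cont T
  have hM := hu.M_nonneg
  have hT := hu.T_nonneg
  have hL := hu.L_nonneg
  have hite : ∀ s ∈ Icc 0 T, ∀ t ∈ Icc 0 T, ∀ i,
      |if j = i then a i k t - a i k s else 0| ≤ R := by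
    intro s hs t ht i
    split_ifs
    · exact hR s hs t ht i k
    · simpa using hR0
  have hitec : ∀ i, Continuous fun p : (ℝ × (Fin K → Fin d → ℝ)) × ℝ =>
      if j = i then a i k p.1.1 - a i k p.2 else 0 := by
    intro i
    have := hu.a_cont i k
    split_ifs <;> fun_prop
  have hkerc : ∀ i, Continuous fun p : (ℝ × (Fin K → Fin d → ℝ)) × ℝ =>
      expKer a i p.2 p.1.1 p.1.2 := fun i =>
    continuous_expKer i hu.a_cont (by fun_prop) (by fun_prop) (by fun_prop)
  have hint : ∀ i, Continuous fun p : (ℝ × (Fin K → Fin d → ℝ)) × ℝ =>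
      b p.2 (u p.2 (shift a i p.2 p.1.1 p.1.2)) i *
        (if j = i then a i k p.1.1 - a i k p.2 else 0) * expKer a i p.2 p.1.1 p.1.2 := fun i =>
    ((hu.continuous_b_shift i).mul (hitec i)).mul (hkerc i)
  have hβ : Continuous fun p : ℝ × (Fin K → Fin d → ℝ) × (Fin d → ℝ) =>
      fun i => ∑ l, db p.1 (u p.1 p.2.1) i l * p.2.2 l := by
    refine continuous_pi fun i => continuous_finsetSum _ fun l _ => ?_
    have h1 : Continuous fun p : ℝ × (Fin K → Fin d → ℝ) × (Fin d → ℝ) => u p.1 p.2.1 :=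
      hu.u_cont.comp (by fun_prop : Continuous fun p : ℝ × (Fin K → Fin d → ℝ) × (Fin d → ℝ) =>
        (p.1, p.2.1))
    exact ((hu.db_cont i l).comp (continuous_fst.prodMk h1)).mul (by fun_prop)
  -- The nonlinearity is now linear in V, with coefficients depending on the space point through u.
  -- The derivative of the kernel forms the source term, bounded by ‖c‖R from the initial datum and
  -- by MRT from the integral.
  obtain ⟨w, hwc, hwb, hw⟩ := exists_characteristic_solution a hu.a_cont (T := T)
    (L := d * L) (C := ‖c‖ * R + M * R * T) hT (by positivity)
    (f := fun t x i => c i * (if j = i then a i k t - a i k 0 else 0) * expKer a i 0 t x +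
        ∫ s in (0 : ℝ)..t, b s (u s (shift a i s t x)) i *
            (if j = i then a i k t - a i k s else 0) * expKer a i s t x)
    (continuous_pi fun i => by
      have h1 := (hitec i).comp (by fun_prop : Continuous fun p : ℝ × (Fin K → Fin d → ℝ) =>
        (p, (0 : ℝ)))
      have h2 := (hkerc i).comp (by fun_prop : Continuous fun p : ℝ × (Fin K → Fin d → ℝ) =>
        (p, (0 : ℝ)))
      exact ((continuous_const.mul h1).mul h2).add
        (intervalIntegral.continuous_parametric_intervalIntegral_of_continuous
          (hint i) continuous_fst))
    (fun t ht x i => by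
      refine (abs_add_le _ _).trans ?_
      have h1 : |c i * (if j = i then a i k t - a i k 0 else 0) * expKer a i 0 t x| ≤
          ‖c‖ * R * Real.exp (quad x) := by
        rw [abs_mul, abs_mul, abs_of_pos (expKer_pos a i 0 t x)]
        exact mul_le_mul (mul_le_mul (norm_le_pi_norm c i) (hite 0 ⟨le_rfl, hT⟩ t ht i)
          (abs_nonneg _) (norm_nonneg _)) (expKer_le_exp_quad a i 0 t x)
          (expKer_pos _ _ _ _ _).le (by positivity)
      have h2 : ‖∫ s in (0 : ℝ)..t, b s (u s (shift a i s t x)) i *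
            (if j = i then a i k t - a i k s else 0) * expKer a i s t x‖ ≤
          M * R * Real.exp (quad x) * |t - 0| := by
        refine intervalIntegral.norm_integral_le_of_norm_le_const fun s hs => ?_
        rw [uIoc_of_le ht.1] at hs
        have hs' : s ∈ Icc 0 T := ⟨hs.1.le, hs.2.trans ht.2⟩
        rw [norm_mul, norm_mul, Real.norm_of_nonneg (expKer_pos _ _ _ _ _).le]
        exact mul_le_mul (mul_le_mul (hu.b_le s hs' _ i) (hite s hs' t ht i)
          (abs_nonneg _) hM) (expKer_le_exp_quad a i s t x)
          (expKer_pos _ _ _ _ _).le (by positivity)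
      rw [sub_zero, abs_of_nonneg ht.1, Real.norm_eq_abs] at h2
      have h3 : M * R * Real.exp (quad x) * t ≤ M * R * Real.exp (quad x) * T := by
        gcongr; exact ht.2
      calc _ ≤ _ := add_le_add h1 (h2.trans h3)
        _ = _ := by ring)
    (β := fun s y V i => ∑ l, db s (u s y) i l * V l) hβ
    (fun s hs y U V i => by
      rw [← Finset.sum_sub_distrib]
      refine (Finset.abs_sum_le_sum_abs _ _).trans ?_
      calc _ ≤ ∑ _l : Fin d, L * ‖U - V‖ := by
            refine Finset.sum_le_sum fun l _ => ?_
            rw [← mul_sub, abs_mul]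
            exact mul_le_mul (hu.db_le s hs _ i l) (norm_le_pi_norm (U - V) l) (abs_nonneg _) hL
        _ = _ := by simp [mul_assoc])
    (fun s _ y i => by simp; positivity)
  refine ⟨w, hwc, hwb, fun t ht x i => ?_⟩
  have hline : Continuous fun s : ℝ => (((t, x), s) : (ℝ × (Fin K → Fin d → ℝ)) × ℝ) := by fun_prop
  have hc2 : Continuous fun s => (∑ l, db s (u s (shift a i s t x)) i l *
      w s (shift a i s t x) l) * expKer a i s t x := by
    have h1 : Continuous fun s => shift a i s t x :=
      continuous_shift i hu.a_cont continuous_id continuous_const continuous_const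
    have h2 := hwc.comp (continuous_id.prodMk h1)
    have h3 := hβ.comp (continuous_id.prodMk (h1.prodMk h2))
    exact ((continuous_apply i).comp h3).mul ((hkerc i).comp hline)
  have hc1 : Continuous fun s => b s (u s (shift a i s t x)) i *
      (if j = i then a i k t - a i k s else 0) * expKer a i s t x := (hint i).comp hline
  rw [hw t ht x i, add_assoc, ← intervalIntegral.integral_add
    (hc1.intervalIntegrable _ _) (hc2.intervalIntegrable _ _)]
  simp only [add_mul]

end IsCharacteristicSolution

end Linearization

end WongZakai

/-! ### Continuous differentiability in space. -/

namespace WongZakai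

namespace IsCharacteristicSolution

variable {K d : ℕ} {a : Fin d → Fin K → ℝ → ℝ}
  {T M L : ℝ} {c : Fin d → ℝ} {b : ℝ → (Fin d → ℝ) → Fin d → ℝ}
  {db : ℝ → (Fin d → ℝ) → Fin d → Fin d → ℝ} {u : ℝ → (Fin K → Fin d → ℝ) → Fin d → ℝ}

/-- Solutions of the integral equation along characteristics are continuously differentiable
in space. -/
theorem exists_hasFDerivAt (hu : IsCharacteristicSolution a T c b db M L u) :
    ∃ w : Fin K → Fin d → ℝ → (Fin K → Fin d → ℝ) → Fin d → ℝ,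
      (∀ k j, Continuous fun p : ℝ × (Fin K → Fin d → ℝ) => w k j p.1 p.2) ∧
      ∀ t ∈ Icc 0 T, ∀ x i, HasFDerivAt (fun y => u t y i)
        (∑ k, ∑ j, w k j t x i • ((ContinuousLinearMap.proj j : (Fin d → ℝ) →L[ℝ] ℝ).comp
          (ContinuousLinearMap.proj k : (Fin K → Fin d → ℝ) →L[ℝ] (Fin d → ℝ)))) x := by
  obtain ⟨R, hR0, hR⟩ := exists_increment_bound hu.a_cont T
  have hM := hu.M_nonneg
  have hT := hu.T_nonneg
  have hL := hu.L_nonneg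
  choose w hwc hwb hw using hu.exists_linearised
  choose Cw hCw using hwb
  refine ⟨w, hwc, ?_⟩
  -- the candidate for the derivative and its equation
  let W : (Fin K → Fin d → ℝ) → ℝ → (Fin K → Fin d → ℝ) → Fin d → ℝ :=
    fun h t x => ∑ k, ∑ j, h k j • w k j t x
  have hWapp : ∀ h t x i, W h t x i = ∑ k, ∑ j, h k j * w k j t x i := by
    intro h t x i; simp [W, Finset.sum_apply]
  have hWc : ∀ h, Continuous fun p : ℝ × (Fin K → Fin d → ℝ) => W h p.1 p.2 := fun h =>
    continuous_finsetSum _ fun k _ => continuous_finsetSum _ fun j _ => by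
      have := hwc k j
      fun_prop
  set CW : ℝ := ∑ k, ∑ j, |Cw k j| with hCW
  have hCW0 : 0 ≤ CW := Finset.sum_nonneg fun _ _ => Finset.sum_nonneg fun _ _ => abs_nonneg _
  have hWb : ∀ h, ∀ t ∈ Icc 0 T, ∀ x, ‖W h t x‖ ≤ CW * Real.exp (quad x) * ‖h‖ := by
    intro h t ht x
    refine (norm_sum_le _ _).trans ?_
    rw [hCW, Finset.sum_mul, Finset.sum_mul]
    refine Finset.sum_le_sum fun k _ => (norm_sum_le _ _).trans ?_
    rw [Finset.sum_mul, Finset.sum_mul]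
    refine Finset.sum_le_sum fun j _ => ?_
    rw [norm_smul, mul_comm]
    have h1 := (norm_le_pi_norm (h k) j).trans (norm_le_pi_norm h k)
    have h2 := hCw k j t ht x
    have h3 := le_abs_self (Cw k j)
    have h4 : Cw k j * Real.exp (quad x) ≤ |Cw k j| * Real.exp (quad x) := by gcongr
    exact mul_le_mul (h2.trans h4) h1 (norm_nonneg _) (by positivity)
  have hshc : ∀ i t x, Continuous fun s => shift a i s t x := fun i t x =>
    continuous_shift i hu.a_cont continuous_id continuous_const continuous_const
  have hkerc : ∀ i t x, Continuous fun s => expKer a i s t x := fun i t x =>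
    continuous_expKer i hu.a_cont continuous_id continuous_const continuous_const
  have huc : ∀ i t x h, Continuous fun s => u s (shift a i s t x + h) := fun i t x h =>
    hu.u_cont.comp (continuous_id.prodMk ((hshc i t x).add continuous_const))
  have huc0 : ∀ i t x, Continuous fun s => u s (shift a i s t x) := fun i t x =>
    hu.u_cont.comp (continuous_id.prodMk (hshc i t x))
  have hbc : ∀ i (g : ℝ → Fin d → ℝ), Continuous g → Continuous fun s => b s (g s) i :=
    fun i g hg => (continuous_apply i).comp (hu.b_cont.comp (continuous_id.prodMk hg))
  have hdbc : ∀ i l (g : ℝ → Fin d → ℝ), Continuous g → Continuous fun s => db s (g s) i l :=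
    fun i l g hg => (hu.db_cont i l).comp (continuous_id.prodMk hg)
  have hWsc : ∀ i t x h, Continuous fun s => W h s (shift a i s t x) := fun i t x h =>
    (hWc h).comp (continuous_id.prodMk (hshc i t x))
  have hslc : ∀ i t h, Continuous fun s => slope a i s t h := fun i t h =>
    continuous_finsetSum _ fun k _ => by have := hu.a_cont i k; fun_prop
  have hdbW : ∀ i t x h, Continuous fun s => ∑ l, db s (u s (shift a i s t x)) i l *
      W h s (shift a i s t x) l := fun i t x h =>
    continuous_finsetSum _ fun l _ => (hdbc i l _ (huc0 i t x)).mul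
      ((continuous_apply l).comp (hWsc i t x h))
  -- By linearity the combination W h solves the linearised equation in direction h, with `slope` in
  -- place of the coordinate increment.
  have hWeq : ∀ h, ∀ t ∈ Icc 0 T, ∀ x i, W h t x i = c i * slope a i 0 t h * expKer a i 0 t x +
      ∫ s in (0 : ℝ)..t, (b s (u s (shift a i s t x)) i * slope a i s t h +
        ∑ l, db s (u s (shift a i s t x)) i l * W h s (shift a i s t x) l) *
          expKer a i s t x := by
    intro h t ht x i
    have hI : ∀ k j, Continuous fun s => (b s (u s (shift a i s t x)) i *
        (if j = i then a i k t - a i k s else 0) + ∑ l, db s (u s (shift a i s t x)) i l *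
          w k j s (shift a i s t x) l) * expKer a i s t x := by
      intro k j
      have h1 : Continuous fun s => if j = i then a i k t - a i k s else 0 := by
        have := hu.a_cont i k
        split_ifs <;> fun_prop
      have h2 : Continuous fun s => w k j s (shift a i s t x) :=
        (hwc k j).comp (continuous_id.prodMk (hshc i t x))
      exact (((hbc i _ (huc0 i t x)).mul h1).add (continuous_finsetSum _ fun l _ =>
        (hdbc i l _ (huc0 i t x)).mul ((continuous_apply l).comp h2))).mul (hkerc i t x)
    have h1 : ∀ s, (b s (u s (shift a i s t x)) i * slope a i s t h +
        ∑ l, db s (u s (shift a i s t x)) i l * W h s (shift a i s t x) l) *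
          expKer a i s t x = ∑ k, ∑ j, h k j * ((b s (u s (shift a i s t x)) i *
        (if j = i then a i k t - a i k s else 0) + ∑ l, db s (u s (shift a i s t x)) i l *
          w k j s (shift a i s t x) l) * expKer a i s t x) := by
      intro s
      have h2 : ∑ l, db s (u s (shift a i s t x)) i l * W h s (shift a i s t x) l =
          ∑ k, ∑ j, h k j * ∑ l, db s (u s (shift a i s t x)) i l *
            w k j s (shift a i s t x) l := by
        simp only [hWapp, Finset.mul_sum]
        rw [Finset.sum_comm]
        refine Finset.sum_congr rfl fun k _ => ?_
        rw [Finset.sum_comm]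
        exact Finset.sum_congr rfl fun j _ => Finset.sum_congr rfl fun l _ => by ring
      rw [h2, ← sum_mul_ite_eq_slope, Finset.mul_sum, ← Finset.sum_add_distrib, Finset.sum_mul]
      refine Finset.sum_congr rfl fun k _ => ?_
      rw [Finset.mul_sum, ← Finset.sum_add_distrib, Finset.sum_mul]
      exact Finset.sum_congr rfl fun j _ => by ring
    simp only [h1]
    rw [intervalIntegral.integral_finsetSum fun k _ => Continuous.intervalIntegrable
      (continuous_finsetSum _ fun j _ => (hI k j).const_mul _) _ _]
    rw [hWapp, ← sum_mul_ite_eq_slope, Finset.mul_sum, Finset.sum_mul, ← Finset.sum_add_distrib]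
    refine Finset.sum_congr rfl fun k _ => ?_
    rw [intervalIntegral.integral_finsetSum fun j _ => Continuous.intervalIntegrable
      ((hI k j).const_mul _) _ _, Finset.mul_sum, Finset.sum_mul, ← Finset.sum_add_distrib]
    refine Finset.sum_congr rfl fun j _ => ?_
    rw [hw k j t ht x i, intervalIntegral.integral_const_mul]
    ring
  -- remainder terms
  set R' : ℝ := K * R with hR'
  have hR'0 : 0 ≤ R' := by positivity
  have hsl : ∀ s ∈ Icc 0 T, ∀ t ∈ Icc 0 T, ∀ i h, |slope a i s t h| ≤ R' * ‖h‖ :=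
    fun s hs t ht i h => abs_slope_le (hR s hs t ht i) h
  have hsmall : ∀ᶠ h : Fin K → Fin d → ℝ in 𝓝 0, R' * ‖h‖ ≤ 1 := by
    have : Tendsto (fun h : Fin K → Fin d → ℝ => R' * ‖h‖) (𝓝 0) (𝓝 0) := by
      have h1 : Continuous fun h : Fin K → Fin d → ℝ => R' * ‖h‖ := by fun_prop
      simpa using h1.tendsto 0
    exact (this.eventually (gt_mem_nhds one_pos)).mono fun _ => le_of_lt
  have hexp : ∀ h : Fin K → Fin d → ℝ, R' * ‖h‖ ≤ 1 → ∀ s ∈ Icc 0 T, ∀ t ∈ Icc 0 T, ∀ i,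
      ‖h‖⁻¹ * |Real.exp (slope a i s t h) - 1 - slope a i s t h| ≤ R' ^ 2 * ‖h‖ := by
    intro h hh s hs t ht i
    have h1 := hsl s hs t ht i h
    refine inv_mul_le_of_le_mul₀ (norm_nonneg _) (by positivity) ?_
    refine (Real.abs_exp_sub_one_sub_id_le (h1.trans hh)).trans ?_
    rw [← sq_abs]
    calc |slope a i s t h| ^ 2 ≤ (R' * ‖h‖) ^ 2 := by gcongr
      _ = _ := by ring
  -- Lipschitz continuity gives only a bounded quotient, which is enough for domination; its
  -- convergence to zero is shown pointwise in `hG_lim`.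
  have hrem : ∀ h, ∀ s ∈ Icc 0 T, ∀ y i, ‖h‖⁻¹ * |b s (u s y + W h s y) i - b s (u s y) i -
      ∑ l, db s (u s y) i l * W h s y l| ≤ 2 * (d * L) * CW * Real.exp (quad y) := by
    intro h s hs y i
    refine inv_mul_le_of_le_mul₀ (norm_nonneg _) (by positivity) ?_
    have h1 := hu.lipschitz hs (u s y + W h s y) (u s y) i
    rw [add_sub_cancel_left] at h1
    have h2 : |∑ l, db s (u s y) i l * W h s y l| ≤ d * L * ‖W h s y‖ := by
      refine (Finset.abs_sum_le_sum_abs _ _).trans ?_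
      calc _ ≤ ∑ _l : Fin d, L * ‖W h s y‖ := by
            refine Finset.sum_le_sum fun l _ => ?_
            rw [abs_mul]
            exact mul_le_mul (hu.db_le s hs _ i l) (norm_le_pi_norm (W h s y) l) (abs_nonneg _) hL
        _ = _ := by simp [mul_assoc]
    have h3 : d * L * ‖W h s y‖ ≤ d * L * (CW * Real.exp (quad y) * ‖h‖) := by
      gcongr; exact hWb h s hs y
    calc _ ≤ d * L * ‖W h s y‖ + d * L * ‖W h s y‖ := (abs_sub _ _).trans (add_le_add h1 h2)
      _ ≤ _ := add_le_add h3 h3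
      _ = _ := by ring
  -- The sources of error not controlled by m itself: the second-order part of the exponential, the
  -- product of the increments of b and of the exponent, and the Taylor remainder of b at u along W
  -- h.
  let G : (Fin K → Fin d → ℝ) → ℝ → ℝ → (Fin K → Fin d → ℝ) → Fin d → ℝ := fun h s t x i =>
    M * (‖h‖⁻¹ * |Real.exp (slope a i s t h) - 1 - slope a i s t h|) +
    |b s (u s (shift a i s t x + h)) i - b s (u s (shift a i s t x)) i| *
      (‖h‖⁻¹ * |slope a i s t h|) +
    ‖h‖⁻¹ * |b s (u s (shift a i s t x) + W h s (shift a i s t x)) i -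
      b s (u s (shift a i s t x)) i -
      ∑ l, db s (u s (shift a i s t x)) i l * W h s (shift a i s t x) l|
  have hGc : ∀ h t x i, Continuous fun s => G h s t x i := by
    intro h t x i
    have h1 := hslc i t h
    have h2 := hbc i _ (huc i t x h)
    have h3 := hbc i _ (huc0 i t x)
    have h4 := hbc i _ ((huc0 i t x).add (hWsc i t x h))
    have h5 := hdbW i t x h
    exact ((continuous_const.mul (continuous_const.mul ((h1.rexp.sub continuous_const).sub h1).abs)).add
      ((h2.sub h3).abs.mul (continuous_const.mul h1.abs))).add
      (continuous_const.mul ((h4.sub h3).sub h5).abs)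
  have hinv : ∀ h : Fin K → Fin d → ℝ, ∀ s ∈ Icc 0 T, ∀ t ∈ Icc 0 T, ∀ i,
      ‖h‖⁻¹ * |slope a i s t h| ≤ R' := fun h s hs t ht i =>
    inv_mul_le_of_le_mul₀ (norm_nonneg _) hR'0 ((hsl s hs t ht i h).trans_eq (mul_comm _ _))
  have hG0 : ∀ h s t x i, 0 ≤ G h s t x i := fun h s t x i => by positivity
  have hGb : ∀ h : Fin K → Fin d → ℝ, R' * ‖h‖ ≤ 1 → ∀ t ∈ Icc 0 T, ∀ s ∈ Icc 0 t, ∀ x i,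
      G h s t x i * expKer a i s t x ≤
        (M * R' + 2 * M * R' + 2 * (d * L) * CW) * Real.exp (quad x) := by
    intro h hh t ht s hs x i
    have hs' : s ∈ Icc 0 T := ⟨hs.1, hs.2.trans ht.2⟩
    have h1 : ‖h‖⁻¹ * |Real.exp (slope a i s t h) - 1 - slope a i s t h| ≤ R' := by
      refine (hexp h hh s hs' t ht i).trans ?_
      nlinarith
    have h2 : |b s (u s (shift a i s t x + h)) i - b s (u s (shift a i s t x)) i| ≤ 2 * M :=
      (abs_sub _ _).trans ((add_le_add (hu.b_le s hs' _ i) (hu.b_le s hs' _ i)).trans_eq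
        (two_mul M).symm)
    have h3 := hrem h s hs' (shift a i s t x) i
    have h4 : G h s t x i ≤ M * R' + 2 * M * R' + 2 * (d * L) * CW *
        Real.exp (quad (shift a i s t x)) := by
      refine add_le_add (add_le_add (mul_le_mul_of_nonneg_left h1 hM) ?_) h3
      exact mul_le_mul h2 (hinv h s hs' t ht i) (by positivity) (by positivity)
    have h5 := mul_le_mul_of_nonneg_right h4 (expKer_pos a i s t x).le
    refine h5.trans ?_
    have h6 := expKer_le_exp_quad a i s t x
    rw [add_mul, mul_assoc (2 * (d * L) * CW), exp_quad_shift_mul_expKer, add_mul _ (2 * (d * L) * CW)]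
    gcongr
  let ε : (Fin K → Fin d → ℝ) → ℝ → (Fin K → Fin d → ℝ) → Fin d → ℝ := fun h t x i =>
    |c i| * (‖h‖⁻¹ * |Real.exp (slope a i 0 t h) - 1 - slope a i 0 t h|) * expKer a i 0 t x +
      ∫ s in (0 : ℝ)..t, G h s t x i * expKer a i s t x
  -- The normalised remainder, whose convergence to zero is Fréchet differentiability. Since 0⁻¹ =
  -- 0, the value at h = 0 is zero and the full neighbourhood filter can be used.
  let m : (Fin K → Fin d → ℝ) → ℝ → (Fin K → Fin d → ℝ) → Fin d → ℝ := fun h t x =>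
    ‖h‖⁻¹ • (u t (x + h) - u t x - W h t x)
  have hexp0 : ∀ s ∈ Icc 0 T, ∀ t ∈ Icc 0 T, ∀ i, Tendsto (fun h : Fin K → Fin d → ℝ =>
      ‖h‖⁻¹ * |Real.exp (slope a i s t h) - 1 - slope a i s t h|) (𝓝 0) (𝓝 0) := by
    intro s hs t ht i
    refine squeeze_zero' (Eventually.of_forall fun h => by positivity)
      (hsmall.mono fun h hh => hexp h hh s hs t ht i) ?_
    have h1 : Continuous fun h : Fin K → Fin d → ℝ => R' ^ 2 * ‖h‖ := by fun_prop
    simpa using h1.tendsto 0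
  have hG_lim : ∀ t ∈ Icc 0 T, ∀ s ∈ Icc 0 t, ∀ x i,
      Tendsto (fun h => G h s t x i) (𝓝 0) (𝓝 0) := by
    intro t ht s hs x i
    have hs' : s ∈ Icc 0 T := ⟨hs.1, hs.2.trans ht.2⟩
    have h1 := (hexp0 s hs' t ht i).const_mul M
    have h2 : Tendsto (fun h => |b s (u s (shift a i s t x + h)) i -
        b s (u s (shift a i s t x)) i| * (‖h‖⁻¹ * |slope a i s t h|)) (𝓝 0) (𝓝 0) := by
      have h3 : Continuous fun h => |b s (u s (shift a i s t x + h)) i -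
          b s (u s (shift a i s t x)) i| * R' := by
        have h4 : Continuous fun h => u s (shift a i s t x + h) :=
          hu.u_cont.comp (continuous_const.prodMk (continuous_const.add continuous_id))
        have h5 := (continuous_apply i).comp (hu.b_cont.comp
          ((continuous_const (y := s)).prodMk h4))
        exact (h5.sub continuous_const).abs.mul continuous_const
      refine squeeze_zero (fun h => by positivity)
        (fun h => mul_le_mul_of_nonneg_left (hinv h s hs' t ht i) (abs_nonneg _)) ?_
      simpa using h3.tendsto 0
    have h6 : Tendsto (fun h => ‖h‖⁻¹ * |b s (u s (shift a i s t x) +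
        W h s (shift a i s t x)) i - b s (u s (shift a i s t x)) i -
        ∑ l, db s (u s (shift a i s t x)) i l * W h s (shift a i s t x) l|) (𝓝 0) (𝓝 0) := by
      -- At fixed (s, y), W h is O(h), so the Fréchet differentiability of b at u s y composes to a
      -- remainder o(h).
      set y := shift a i s t x
      have h7 : (fun h => W h s y) =O[𝓝 0] fun h => h :=
        Asymptotics.IsBigO.of_bound _ (Eventually.of_forall fun h => hWb h s hs' y)
      have h8 : Tendsto (fun h => W h s y) (𝓝 0) (𝓝 0) := h7.trans_tendsto tendsto_id
      have h9 := ((hasFDerivAt_iff_isLittleO_nhds_zero.1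
        (hu.b_deriv s hs' (u s y) i)).comp_tendsto h8).trans_isBigO h7
      have h10 := h9.norm_left.norm_right.tendsto_div_nhds_zero
      refine h10.congr fun h => ?_
      rw [div_eq_inv_mul]
      simp only [Function.comp_apply, sum_apply, smul_apply, ContinuousLinearMap.proj_apply,
        smul_eq_mul, Real.norm_eq_abs]
    have := (h1.add h2).add h6
    simpa [G] using this
  have hmain := tendsto_zero_of_characteristic_ineq (a := a) hu.a_cont (l := 𝓝 0) (T := T)
    (L := d * L) (C := ‖c‖ * R' + (M * R' + 2 * M * R' + 2 * (d * L) * CW) * T)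
    (by positivity) (by positivity) (m := m) (ε := ε)
    (fun h => by
      have h1 : Continuous fun p : ℝ × (Fin K → Fin d → ℝ) => u p.1 (p.2 + h) :=
        hu.u_cont.comp (by fun_prop : Continuous fun p : ℝ × (Fin K → Fin d → ℝ) => (p.1, p.2 + h))
      have h2 := hu.u_cont
      have h3 := hWc h
      simp only [m]
      fun_prop)
    (fun h => ⟨‖h‖⁻¹ * ((‖c‖ + M * T) * Real.exp (R' * ‖h‖) +
        (‖c‖ + M * T) * Real.exp (R' * ‖(0 : Fin K → Fin d → ℝ)‖) + CW * ‖h‖), fun t ht x => by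
      simp only [m, norm_smul, norm_inv, norm_norm]
      rw [mul_assoc]
      refine mul_le_mul_of_nonneg_left ?_ (by positivity)
      have h1 := hu.norm_add_le hR h ht x
      have h2 := hu.norm_add_le hR 0 ht x
      rw [add_zero] at h2
      have h3 := hWb h t ht x
      calc _ ≤ ‖u t (x + h)‖ + ‖u t x‖ + ‖W h t x‖ :=
            (norm_sub_le _ _).trans (add_le_add_left (norm_sub_le _ _) _)
        _ ≤ _ := add_le_add (add_le_add h1 h2) h3
        _ = _ := by ring⟩)
    (hsmall.mono fun h hh t ht x i => by
      have h1 : |c i| * (‖h‖⁻¹ * |Real.exp (slope a i 0 t h) - 1 - slope a i 0 t h|) *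
          expKer a i 0 t x ≤ ‖c‖ * R' * Real.exp (quad x) := by
        have h2 : ‖h‖⁻¹ * |Real.exp (slope a i 0 t h) - 1 - slope a i 0 t h| ≤ R' := by
          refine (hexp h hh 0 ⟨le_rfl, hT⟩ t ht i).trans ?_
          nlinarith
        exact mul_le_mul (mul_le_mul (norm_le_pi_norm c i) h2 (by positivity) (norm_nonneg _))
          (expKer_le_exp_quad a i 0 t x) (expKer_pos _ _ _ _ _).le (by positivity)
      have h3 : ∫ s in (0 : ℝ)..t, G h s t x i * expKer a i s t x ≤
          (M * R' + 2 * M * R' + 2 * (d * L) * CW) * Real.exp (quad x) * |t - 0| := by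
        refine (Real.le_norm_self _).trans ?_
        refine intervalIntegral.norm_integral_le_of_norm_le_const fun s hs => ?_
        rw [uIoc_of_le ht.1] at hs
        rw [Real.norm_of_nonneg (mul_nonneg (hG0 _ _ _ _ _) (expKer_pos _ _ _ _ _).le)]
        exact hGb h hh t ht s ⟨hs.1.le, hs.2⟩ x i
      rw [sub_zero, abs_of_nonneg ht.1] at h3
      have h4 : (M * R' + 2 * M * R' + 2 * (d * L) * CW) * Real.exp (quad x) * t ≤
          (M * R' + 2 * M * R' + 2 * (d * L) * CW) * Real.exp (quad x) * T :=
        mul_le_mul_of_nonneg_left ht.2 (by positivity)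
      calc ε h t x i ≤ _ := add_le_add h1 (h3.trans h4)
        _ = _ := by ring)
    (fun t ht x i => by
      have h1 := ((hexp0 0 ⟨le_rfl, hT⟩ t ht i).const_mul |c i|).mul_const (expKer a i 0 t x)
      have h2 : Tendsto (fun h => ∫ s in (0 : ℝ)..t, G h s t x i * expKer a i s t x) (𝓝 0)
          (𝓝 (∫ s in (0 : ℝ)..t, (0 : ℝ))) := by
        refine intervalIntegral.tendsto_integral_filter_of_dominated_convergence
          (fun _ => (M * R' + 2 * M * R' + 2 * (d * L) * CW) * Real.exp (quad x))
          (Eventually.of_forall fun h =>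
            ((hGc h t x i).mul (hkerc i t x)).aestronglyMeasurable) ?_
          (continuous_const.intervalIntegrable _ _) ?_
        · filter_upwards [hsmall] with h hh
          refine ae_of_all _ fun s hs => ?_
          rw [uIoc_of_le ht.1] at hs
          rw [Real.norm_of_nonneg (mul_nonneg (hG0 _ _ _ _ _) (expKer_pos _ _ _ _ _).le)]
          exact hGb h hh t ht s ⟨hs.1.le, hs.2⟩ x i
        · refine ae_of_all _ fun s hs => ?_
          rw [uIoc_of_le ht.1] at hs
          have := (hG_lim t ht s ⟨hs.1.le, hs.2⟩ x i).mul_const (expKer a i s t x)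
          rwa [zero_mul] at this
      have h3 := h1.add h2
      simpa [ε] using h3)
    (fun h t ht x i => by
      have hk := hkerc i t x
      have h1 : u t (x + h) i - u t x i - W h t x i =
          c i * (Real.exp (slope a i 0 t h) - 1 - slope a i 0 t h) * expKer a i 0 t x +
          ∫ s in (0 : ℝ)..t, (b s (u s (shift a i s t x + h)) i * Real.exp (slope a i s t h) -
            b s (u s (shift a i s t x)) i - b s (u s (shift a i s t x)) i * slope a i s t h -
            ∑ l, db s (u s (shift a i s t x)) i l * W h s (shift a i s t x) l) *
              expKer a i s t x := by
        have e1 := hu.eqn t ht (x + h) i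
        simp only [shift_add, expKer_add] at e1
        have c1 : Continuous fun s => b s (u s (shift a i s t x + h)) i *
            (expKer a i s t x * Real.exp (slope a i s t h)) :=
          (hbc i _ (huc i t x h)).mul (hk.mul (hslc i t h).rexp)
        have c2 : Continuous fun s => b s (u s (shift a i s t x)) i * expKer a i s t x :=
          (hbc i _ (huc0 i t x)).mul hk
        have c3 : Continuous fun s => (b s (u s (shift a i s t x)) i * slope a i s t h +
            ∑ l, db s (u s (shift a i s t x)) i l * W h s (shift a i s t x) l) *
              expKer a i s t x :=
          (((hbc i _ (huc0 i t x)).mul (hslc i t h)).add (hdbW i t x h)).mul hk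
        have e2 : ∫ s in (0 : ℝ)..t, (b s (u s (shift a i s t x + h)) i *
            Real.exp (slope a i s t h) - b s (u s (shift a i s t x)) i -
            b s (u s (shift a i s t x)) i * slope a i s t h -
            ∑ l, db s (u s (shift a i s t x)) i l * W h s (shift a i s t x) l) *
              expKer a i s t x =
            (∫ s in (0 : ℝ)..t, b s (u s (shift a i s t x + h)) i *
              (expKer a i s t x * Real.exp (slope a i s t h))) -
            (∫ s in (0 : ℝ)..t, b s (u s (shift a i s t x)) i * expKer a i s t x) -
            ∫ s in (0 : ℝ)..t, (b s (u s (shift a i s t x)) i * slope a i s t h +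
              ∑ l, db s (u s (shift a i s t x)) i l * W h s (shift a i s t x) l) *
                expKer a i s t x := by
          have c12 : Continuous fun s => b s (u s (shift a i s t x + h)) i *
            (expKer a i s t x * Real.exp (slope a i s t h)) -
            b s (u s (shift a i s t x)) i * expKer a i s t x := c1.sub c2
          rw [← intervalIntegral.integral_sub (c1.intervalIntegrable _ _)
            (c2.intervalIntegrable _ _), ← intervalIntegral.integral_sub
            (c12.intervalIntegrable _ _) (c3.intervalIntegrable _ _)]
          congr 1
          ext s
          ring
        rw [e1, hu.eqn t ht x i, hWeq h t ht x i, e2]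
        ring
      have hmi : m h t x i = ‖h‖⁻¹ * (u t (x + h) i - u t x i - W h t x i) := rfl
      have hmc : Continuous fun s => ‖m h s (shift a i s t x)‖ :=
        (continuous_const (y := ‖h‖⁻¹)).smul
          (((huc i t x h).sub (huc0 i t x)).sub (hWsc i t x h)) |>.norm
      have hsum : ∫ s in (0 : ℝ)..t, (G h s t x i + d * L * ‖m h s (shift a i s t x)‖) *
          expKer a i s t x = (∫ s in (0 : ℝ)..t, G h s t x i * expKer a i s t x) +
          d * L * ∫ s in (0 : ℝ)..t, ‖m h s (shift a i s t x)‖ * expKer a i s t x := by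
        have c1 : Continuous fun s => G h s t x i * expKer a i s t x := (hGc h t x i).mul hk
        have c2 : Continuous fun s => d * L * (‖m h s (shift a i s t x)‖ * expKer a i s t x) :=
          continuous_const.mul (hmc.mul hk)
        rw [← intervalIntegral.integral_const_mul, ← intervalIntegral.integral_add
          (c1.intervalIntegrable _ _) (c2.intervalIntegrable _ _)]
        congr 1
        ext s
        ring
      rw [hmi, h1, mul_add, ← intervalIntegral.integral_const_mul, add_assoc, ← hsum]
      refine (abs_add_le _ _).trans (add_le_add (le_of_eq ?_) ?_)
      · rw [abs_mul, abs_mul, abs_mul, abs_of_pos (expKer_pos a i 0 t x), abs_inv, abs_norm]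
        ring
      · have c4 : Continuous fun s => (G h s t x i + d * L * ‖m h s (shift a i s t x)‖) *
            expKer a i s t x := ((hGc h t x i).add (continuous_const.mul hmc)).mul hk
        rw [← Real.norm_eq_abs]
        refine intervalIntegral.norm_integral_le_of_norm_le ht.1 (ae_of_all _ fun s hs => ?_)
          (c4.intervalIntegrable _ _)
        have hs' : s ∈ Icc 0 T := ⟨hs.1.le, hs.2.trans ht.2⟩
        rw [Real.norm_eq_abs, abs_mul, abs_mul, abs_inv, abs_norm, ← mul_assoc,
          abs_of_pos (expKer_pos a i s t x)]
        refine mul_le_mul_of_nonneg_right ?_ (expKer_pos a i s t x).le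
        set y := shift a i s t x
        have e3 : |b s (u s (y + h)) i * Real.exp (slope a i s t h) -
            b s (u s y) i - b s (u s y) i * slope a i s t h -
            ∑ l, db s (u s y) i l * W h s y l| ≤
            M * |Real.exp (slope a i s t h) - 1 - slope a i s t h| +
            |b s (u s (y + h)) i - b s (u s y) i| * |slope a i s t h| +
            |b s (u s y + W h s y) i - b s (u s y) i - ∑ l, db s (u s y) i l * W h s y l| +
            d * L * ‖u s (y + h) - u s y - W h s y‖ := by
          have e4 := hu.lipschitz hs' (u s (y + h)) (u s y + W h s y) i
          rw [← sub_sub] at e4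
          -- The value b(u(y) + W) is inserted so that the last difference is a Lipschitz multiple
          -- of the unnormalised remainder; the first three groups are the three terms of G.
          have e5 : b s (u s (y + h)) i * Real.exp (slope a i s t h) -
            b s (u s y) i - b s (u s y) i * slope a i s t h -
            ∑ l, db s (u s y) i l * W h s y l =
            b s (u s (y + h)) i * (Real.exp (slope a i s t h) - 1 - slope a i s t h) +
            (b s (u s (y + h)) i - b s (u s y) i) * slope a i s t h +
            (b s (u s y + W h s y) i - b s (u s y) i - ∑ l, db s (u s y) i l * W h s y l) +
            (b s (u s (y + h)) i - b s (u s y + W h s y) i) := by ring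
          rw [e5]
          refine (abs_add_le _ _).trans (add_le_add ((abs_add_le _ _).trans
            (add_le_add ((abs_add_le _ _).trans (add_le_add ?_ ?_)) le_rfl)) e4)
          · rw [abs_mul]
            exact mul_le_mul_of_nonneg_right (hu.b_le s hs' _ i) (abs_nonneg _)
          · rw [abs_mul]
        refine (mul_le_mul_of_nonneg_left e3 (by positivity)).trans (le_of_eq ?_)
        simp only [G, m, norm_smul, norm_inv, norm_norm]
        ring)
  intro t ht x i
  rw [hasFDerivAt_iff_isLittleO_nhds_zero]
  have h1 := (continuous_apply i).continuousAt.tendsto.comp (hmain t ht x)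
  rw [Asymptotics.isLittleO_iff]
  intro η hη
  have h2 := (Metric.tendsto_nhds.1 h1) η hη
  filter_upwards [h2] with h hh
  simp only [Function.comp_apply, m, Pi.smul_apply, Pi.sub_apply, smul_eq_mul, Pi.zero_apply,
    dist_zero_right, norm_mul, norm_inv, norm_norm, hWapp] at hh
  have h3 : (∑ k, ∑ j, w k j t x i • ((ContinuousLinearMap.proj j : (Fin d → ℝ) →L[ℝ] ℝ).comp
      (ContinuousLinearMap.proj k : (Fin K → Fin d → ℝ) →L[ℝ] (Fin d → ℝ)))) h =
      ∑ k, ∑ j, h k j * w k j t x i := by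
    simp [sum_apply, mul_comm]
  rw [h3]
  rcases eq_or_ne h 0 with rfl | hne
  · simp
  · rw [inv_mul_lt_iff₀ (norm_pos_iff.2 hne)] at hh
    rw [mul_comm η]
    exact hh.le

end IsCharacteristicSolution

end WongZakai

/-! ### Cocycle property and the time derivative. -/

namespace WongZakai

section Cocycle

variable {K d : ℕ} (a : Fin d → Fin K → ℝ → ℝ) (i : Fin d)

lemma shift_shift (r s t : ℝ) (x : Fin K → Fin d → ℝ) :
    shift a i r s (shift a i s t x) = shift a i r t x := by
  ext k j
  simp only [shift]
  split_ifs <;> ring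

lemma shift_self (t : ℝ) (x : Fin K → Fin d → ℝ) : shift a i t t x = x := by
  ext k j; simp [shift]

lemma expKer_self (t : ℝ) (x : Fin K → Fin d → ℝ) : expKer a i t t x = 1 := by
  simp [expKer]

/-- The kernel is the ratio of exp(quad) at the two ends of a characteristic, so the cocycle rule
follows from three instances of `exp_quad_shift_mul_expKer`. -/
lemma expKer_shift (r s t : ℝ) (x : Fin K → Fin d → ℝ) :
    expKer a i r s (shift a i s t x) = (expKer a i s t x)⁻¹ * expKer a i r t x := by
  have h1 := exp_quad_shift_mul_expKer a i r s (shift a i s t x)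
  have h2 := exp_quad_shift_mul_expKer a i s t x
  have h3 := exp_quad_shift_mul_expKer a i r t x
  rw [shift_shift] at h1
  have h4 := (expKer_pos a i s t x).ne'
  have h5 := (Real.exp_pos (quad (shift a i r t x))).ne'
  rw [eq_inv_mul_iff_mul_eq₀ h4]
  refine mul_left_cancel₀ h5 ?_
  rw [h3, ← h2, ← h1]
  ring

end Cocycle

namespace IsCharacteristicSolution

variable {K d : ℕ} {a : Fin d → Fin K → ℝ → ℝ}
  {T M L : ℝ} {c : Fin d → ℝ} {b : ℝ → (Fin d → ℝ) → Fin d → ℝ}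
  {db : ℝ → (Fin d → ℝ) → Fin d → Fin d → ℝ} {u : ℝ → (Fin K → Fin d → ℝ) → Fin d → ℝ}

/-- The time derivative along a characteristic. -/
lemma hasDerivWithinAt_characteristic (hu : IsCharacteristicSolution a T c b db M L u) {i : Fin d}
    {A : Fin K → ℝ} {t : ℝ} (ht : t ∈ Icc 0 T)
    (hA : ∀ k, HasDerivWithinAt (a i k) (A k) (Icc 0 T) t) (x : Fin K → Fin d → ℝ) :
    HasDerivWithinAt (fun s => u s (shift a i s t x) i)
      (b t (u t x) i + (∑ k, A k * x k i) * u t x i) (Icc 0 T) t := by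
  have hbc : Continuous fun s => b s (u s (shift a i s t x)) i * expKer a i s t x :=
    ((hu.continuous_b_shift i).comp (by fun_prop : Continuous fun s : ℝ =>
      (((t, x), s) : (ℝ × (Fin K → Fin d → ℝ)) × ℝ))).mul
      (continuous_expKer i hu.a_cont continuous_id continuous_const continuous_const)
  -- By the cocycle rule, u along the i-th characteristic through (t, x) is this inverse kernel
  -- times a constant plus a primitive whose integrand does not involve s. At s = t the square
  -- contributes nothing to the derivative.
  have h1 : HasDerivWithinAt (fun s => (expKer a i s t x)⁻¹) (∑ k, A k * x k i) (Icc 0 T) t := by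
    have h2 : ∀ s, (expKer a i s t x)⁻¹ = Real.exp (-∑ k, (x k i * (a i k t - a i k s) -
        (1 / 2) * (a i k t - a i k s) ^ 2)) := fun s => by rw [expKer, Real.exp_neg]
    simp only [h2]
    have h3 : HasDerivWithinAt (fun s => -∑ k, (x k i * (a i k t - a i k s) -
        (1 / 2) * (a i k t - a i k s) ^ 2)) (-∑ k, (x k i * (-A k) -
        (1 / 2) * (2 * (a i k t - a i k t) * (-A k)))) (Icc 0 T) t := by
      refine (HasDerivWithinAt.fun_sum fun k _ => ?_).fun_neg
      have h4 := (hA k).const_sub (a i k t)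
      have h5 := (h4.fun_pow 2).const_mul (1 / 2)
      refine ((h4.const_mul (x k i)).fun_sub h5).congr_deriv ?_
      norm_num
    refine h3.exp.congr_deriv ?_
    simp [mul_comm]
  have h6 : HasDerivWithinAt (fun s => c i * expKer a i 0 t x +
      ∫ r in (0 : ℝ)..s, b r (u r (shift a i r t x)) i * expKer a i r t x)
      (b t (u t x) i) (Icc 0 T) t := by
    have h7 := (hbc.integral_hasStrictDerivAt 0 t).hasDerivAt.hasDerivWithinAt (s := Icc 0 T)
    rw [shift_self, expKer_self, mul_one] at h7
    exact h7.const_add _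
  refine ((h1.mul h6).congr_deriv ?_).congr (fun s hs => ?_) ?_
  · rw [expKer_self, ← hu.eqn t ht x i]; ring
  · rw [hu.eqn s hs, Pi.mul_apply, expKer_shift, mul_add, ← intervalIntegral.integral_const_mul]
    congr 1
    · ring
    · congr 1
      ext r
      rw [shift_shift, expKer_shift]
      ring
  · rw [Pi.mul_apply, ← hu.eqn t ht x i, expKer_self, shift_self, inv_one, one_mul]

/-- The time derivative of a solution of the integral equation along characteristics. -/
theorem hasDerivWithinAt (hu : IsCharacteristicSolution a T c b db M L u)
    {w : Fin K → Fin d → ℝ → (Fin K → Fin d → ℝ) → Fin d → ℝ}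
    (hwc : ∀ k j, Continuous fun p : ℝ × (Fin K → Fin d → ℝ) => w k j p.1 p.2)
    (hw : ∀ t ∈ Icc 0 T, ∀ x i, HasFDerivAt (fun y => u t y i)
        (∑ k, ∑ j, w k j t x i • ((ContinuousLinearMap.proj j : (Fin d → ℝ) →L[ℝ] ℝ).comp
          (ContinuousLinearMap.proj k : (Fin K → Fin d → ℝ) →L[ℝ] (Fin d → ℝ)))) x)
    {i : Fin d} {A : Fin K → ℝ} {t : ℝ} (ht : t ∈ Icc 0 T)
    (hA : ∀ k, HasDerivWithinAt (a i k) (A k) (Icc 0 T) t) (x : Fin K → Fin d → ℝ) :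
    HasDerivWithinAt (fun s => u s x i)
      (b t (u t x) i + ∑ k, A k * (x k i * u t x i - w k i t x i)) (Icc 0 T) t := by
  set D : ℝ → (Fin K → Fin d → ℝ) → ((Fin K → Fin d → ℝ) →L[ℝ] ℝ) := fun t x =>
    ∑ k, ∑ j, w k j t x i • ((ContinuousLinearMap.proj j : (Fin d → ℝ) →L[ℝ] ℝ).comp
      (ContinuousLinearMap.proj k : (Fin K → Fin d → ℝ) →L[ℝ] (Fin d → ℝ))) with hD
  have hDc : Continuous fun p : ℝ × (Fin K → Fin d → ℝ) => D p.1 p.2 :=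
    continuous_finsetSum _ fun k _ => continuous_finsetSum _ fun j _ =>
      ((continuous_apply i).comp (hwc k j)).smul continuous_const
  have hγc : Continuous fun s => shift a i s t x :=
    continuous_shift i hu.a_cont continuous_id continuous_const continuous_const
  have hγ : HasDerivWithinAt (fun s => shift a i s t x)
      (fun k j => if j = i then A k else 0) (Icc 0 T) t := by
    refine hasDerivWithinAt_pi.2 fun k => hasDerivWithinAt_pi.2 fun j => ?_
    simp only [shift]
    split_ifs
    · have := ((hA k).const_sub (a i k t)).const_sub (x k j)
      rwa [neg_neg] at this
    · exact hasDerivWithinAt_const _ _ _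
  have hDγ : D t x (fun k j => if j = i then A k else 0) = ∑ k, A k * w k i t x i := by
    simp [hD, sum_apply, mul_comm]
  -- Purely spatial at each fixed s: the mean value inequality applies at time s, and joint
  -- continuity of the derivative replaces D(s, y) by D(t, x). Differentiability of u in time is not
  -- needed here.
  have hspace : HasDerivWithinAt (fun s => u s (shift a i s t x) i - u s x i)
      (∑ k, A k * w k i t x i) (Icc 0 T) t := by
    have h1 : (fun s => u s (shift a i s t x) i - u s x i - D t x (shift a i s t x - x))
        =o[𝓝[Icc 0 T] t] fun s => shift a i s t x - x := by
      rw [Asymptotics.isLittleO_iff]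
      intro η hη
      have h2 : ∀ᶠ p in 𝓝 (t, x), ‖D p.1 p.2 - D t x‖ < η := by
        have := Metric.tendsto_nhds.1 (hDc.tendsto (t, x)) η hη
        simpa only [dist_eq_norm] using this
      obtain ⟨δ, hδ, h3⟩ := Metric.eventually_nhds_iff.1 h2
      have h4 : ∀ᶠ s in 𝓝[Icc 0 T] t, dist (shift a i s t x) x < δ := by
        have h5 := hγc.tendsto t
        rw [shift_self] at h5
        exact (Metric.tendsto_nhds.1 h5 δ hδ).filter_mono nhdsWithin_le_nhds
      have h5 : ∀ᶠ s in 𝓝[Icc 0 T] t, dist s t < δ :=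
        mem_nhdsWithin_of_mem_nhds (Metric.ball_mem_nhds t hδ)
      filter_upwards [h4, h5, self_mem_nhdsWithin] with s hs1 hs2 hs3
      refine (convex_ball x δ).norm_image_sub_le_of_norm_hasFDerivWithin_le'
        (f := fun y => u s y i) (f' := fun y => D s y) (φ := D t x)
        (fun y _ => (hw s hs3 y i).hasFDerivWithinAt) (fun y hy => ?_)
        (Metric.mem_ball_self hδ) hs1
      exact (h3 (y := (s, y)) (by
        rw [Prod.dist_eq]
        exact max_lt hs2 hy)).le
    have h6 : (fun s => shift a i s t x - x) =O[𝓝[Icc 0 T] t] fun s => s - t := by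
      have := hγ.hasFDerivWithinAt.isBigO_sub
      simpa only [shift_self] using this
    have h7 := h1.trans_isBigO h6
    have h8 : HasDerivWithinAt (fun s => D t x (shift a i s t x))
        (∑ k, A k * w k i t x i) (Icc 0 T) t := by
      rw [← hDγ]
      exact (D t x).hasFDerivAt.comp_hasDerivWithinAt t hγ
    rw [hasDerivWithinAt_iff_isLittleO] at h8 ⊢
    refine (h7.add h8).congr_left fun s => ?_
    simp only [shift_self, map_sub, sub_self, sub_zero]
    ring
  -- The derivative along the characteristic minus that of the spatial increment leaves the
  -- derivative at fixed x.
  refine ((hu.hasDerivWithinAt_characteristic ht hA x).fun_sub hspace).congr_deriv ?_ |>.congr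
    (fun s _ => by ring) (by ring)
  simp only [mul_sub, Finset.sum_sub_distrib, Finset.sum_mul]
  rw [add_sub_assoc]
  congr 2
  exact Finset.sum_congr rfl fun k _ => by ring

end IsCharacteristicSolution

end WongZakai

/-! ### Solution of the hyperbolic system. -/

namespace WongZakai

section Hyperbolic

variable {H T : ℝ} {K d : ℕ}

/-- The primitives `Σ_{i,k}(0, ·)`, extended to the real line by constants. -/
noncomputable def sigPrimitive (H T : ℝ) (e : ℕ → ℝ → ℝ) (σ : ℝ → Fin d → ℝ) (i : Fin d)
    (k : Fin K) (t : ℝ) : ℝ :=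
  Sig H T e σ i k 0 (clip T t)

lemma intervalIntegrable_mul_Phi (hH : 1 / 2 < H) (hT : 0 < T) {f g : ℝ → ℝ}
    (hf : IntervalIntegrable f volume 0 T) (hg : ContinuousOn g (Icc 0 T)) :
    IntervalIntegrable (fun s => g s * Phi H T f s) volume 0 T :=
  (intervalIntegrable_Phi hH hT.le hf).continuousOn_mul (by rwa [uIcc_of_le hT.le])

variable {e : ℕ → ℝ → ℝ} {σ : ℝ → Fin d → ℝ}

lemma continuous_sigPrimitive (hT : 0 < T) {i : Fin d} {k : Fin K}
    (h : IntervalIntegrable (fun s => σ s i * Phi H T (e k) s) volume 0 T) :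
    Continuous (sigPrimitive H T e σ i k) := by
  have h1 := intervalIntegral.continuousOn_primitive_interval' h left_mem_uIcc
  rw [uIcc_of_le hT.le] at h1
  exact h1.comp_continuous (continuous_clip T) (clip_mem hT.le)

lemma sigPrimitive_sub {i : Fin d} {k : Fin K}
    (h : IntervalIntegrable (fun s => σ s i * Phi H T (e k) s) volume 0 T) {s t : ℝ}
    (hs : s ∈ Icc 0 T) (ht : t ∈ Icc 0 T) :
    sigPrimitive H T e σ i k t - sigPrimitive H T e σ i k s = Sig H T e σ i k s t := by
  rw [sigPrimitive, sigPrimitive, clip_of_mem hs, clip_of_mem ht]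
  have h0 : (0 : ℝ) ∈ Icc 0 T := ⟨le_rfl, hs.1.trans hs.2⟩
  have h1 : ∀ r ∈ Icc 0 T, IntervalIntegrable (fun s => σ s i * Phi H T (e k) s) volume 0 r :=
    fun r hr => h.mono_set (by
      rw [uIcc_of_le hr.1, uIcc_of_le h0.2]
      exact Icc_subset_Icc_right hr.2)
  exact intervalIntegral.integral_interval_sub_left (h1 t ht) (h1 s hs)

/-- Existence for the hyperbolic system, with joint continuity on the whole space-time and an
exponential growth bound. -/
theorem exists_hyperbolic_solution (hH : 1 / 2 < H) (hT : 0 < T)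
    (he : ∀ k, IntervalIntegrable (e k) volume 0 T)
    {b : ℝ → (Fin d → ℝ) → Fin d → ℝ} (c : Fin d → ℝ) (hbσ : CoeffAssumption T b σ) :
    ∃ u : ℝ → (Fin K → Fin d → ℝ) → Fin d → ℝ,
      (Continuous fun p : ℝ × (Fin K → Fin d → ℝ) => u p.1 p.2) ∧
      (∃ C R : ℝ, ∀ t ∈ Icc 0 T, ∀ x, ‖u t x‖ ≤ C * Real.exp (R * ∑ k, ∑ j, |x k j|)) ∧
      IsMildPDESolution H T e K b σ c u ∧
      ((∀ k < K, ContinuousOn (Phi H T (e k)) (Icc 0 T)) →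
        IsClassicalSolution H T e K b σ c u) := by
  have hσi : ∀ i, ContinuousOn (fun s => σ s i) (Icc 0 T) := fun i =>
    (continuous_apply i).comp_continuousOn hbσ.σ_cont
  have hint : ∀ i (k : Fin K), IntervalIntegrable (fun s => σ s i * Phi H T (e k) s) volume 0 T :=
    fun i k => intervalIntegrable_mul_Phi hH hT (he k) (hσi i)
  set a : Fin d → Fin K → ℝ → ℝ := fun i k => sigPrimitive H T e σ i k with ha_def
  have ha : ∀ i k, Continuous (a i k) := fun i k => continuous_sigPrimitive hT (hint i k)
  have hsub : ∀ s ∈ Icc 0 T, ∀ t ∈ Icc 0 T, ∀ i k, a i k t - a i k s = Sig H T e σ i k s t :=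
    fun s hs t ht i k => sigPrimitive_sub (hint i k) hs ht
  have h0T : (0 : ℝ) ∈ Icc 0 T := ⟨le_rfl, hT.le⟩
  obtain ⟨M, hM⟩ := hbσ.b_bdd
  obtain ⟨L, hL⟩ := hbσ.db_bdd
  -- Freezing time outside [0,T] makes the coefficients continuous on the whole line without
  -- changing the equation on [0,T].
  set b' : ℝ → (Fin d → ℝ) → Fin d → ℝ := fun s x => b (clip T s) x with hb'
  set db : ℝ → (Fin d → ℝ) → Fin d → Fin d → ℝ := fun s x i j =>
    lineDeriv ℝ (fun y => b (clip T s) y i) x (Pi.single j (1 : ℝ)) with hdb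
  have hclip2 : Continuous fun p : ℝ × (Fin d → ℝ) => (clip T p.1, p.2) := by fun_prop
  have hclipmem : ∀ p : ℝ × (Fin d → ℝ), (clip T p.1, p.2) ∈ Icc 0 T ×ˢ univ := fun p =>
    ⟨clip_mem hT.le _, mem_univ _⟩
  have hb'c : Continuous fun p : ℝ × (Fin d → ℝ) => b' p.1 p.2 :=
    hbσ.b_cont.comp_continuous hclip2 hclipmem
  have hdbc : ∀ i j, Continuous fun p : ℝ × (Fin d → ℝ) => db p.1 p.2 i j := fun i j =>
    (hbσ.db_cont i j).comp_continuous hclip2 hclipmem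
  have hbd : ∀ s, ∀ x i, HasFDerivAt (fun y => b' s y i)
      (∑ j, db s x i j • (ContinuousLinearMap.proj j : (Fin d → ℝ) →L[ℝ] ℝ)) x := fun s x i =>
    hasFDerivAt_of_continuous_lineDeriv (g := fun y => b' s y i)
      (fun x j => hbσ.db_exists _ (clip_mem hT.le s) x i j)
      (fun j => (hdbc i j).comp (by fun_prop : Continuous fun x : Fin d → ℝ => (s, x))) x
  have hbM : ∀ s x i, |b' s x i| ≤ |M| := fun s x i =>
    (hM _ (clip_mem hT.le s) x i).trans (le_abs_self M)
  have hdbL : ∀ s x i j, |db s x i j| ≤ |L| := fun s x i j =>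
    (hL _ (clip_mem hT.le s) x i j).trans (le_abs_self L)
  obtain ⟨u, huc, -, hu⟩ := exists_characteristic_solution a ha (T := T) (L := d * |L|)
    (C := ‖c‖ + |M|) hT.le (by positivity) (f := fun t x i => c i * expKer a i 0 t x)
    (continuous_pi fun i => continuous_const.mul (continuous_expKer i ha continuous_const
      continuous_fst continuous_snd))
    (fun t _ x i => by
      rw [abs_mul, abs_of_pos (expKer_pos a i 0 t x)]
      have h1 := norm_le_pi_norm c i
      rw [Real.norm_eq_abs] at h1
      exact mul_le_mul (h1.trans (le_add_of_nonneg_right (abs_nonneg _)))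
        (expKer_le_exp_quad a i 0 t x) (expKer_pos _ _ _ _ _).le (by positivity))
    (β := fun s _ V => b' s V)
    (hb'c.comp (by fun_prop : Continuous fun p : ℝ × (Fin K → Fin d → ℝ) × (Fin d → ℝ) =>
      (p.1, p.2.2)))
    (fun s _ y U V i => by
      simpa using abs_sub_le_of_hasFDerivAt_sum (hbd s · i) (hdbL s · i) U V)
    (fun s _ y i => by
      refine (hbM s 0 i).trans ?_
      have h1 := one_le_exp_quad y
      have h2 := norm_nonneg c
      have h3 := abs_nonneg M
      nlinarith)
  have hchar : IsCharacteristicSolution a T c b' db |M| |L| u :=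
    ⟨ha, hT.le, abs_nonneg _, abs_nonneg _, hb'c, hdbc, fun s _ => hbd s, fun s _ => hbM s,
      fun s _ => hdbL s, huc, hu⟩
  have hshift : ∀ s ∈ Icc 0 T, ∀ t ∈ Icc 0 T, ∀ i (x : Fin K → Fin d → ℝ),
      shift a i s t x = (fun k j => x k j - SigMat H T e K σ i s t k j) := by
    intro s hs t ht i x
    ext k j
    simp [shift, SigMat, hsub s hs t ht]
  have hker : ∀ s ∈ Icc 0 T, ∀ t ∈ Icc 0 T, ∀ i (x : Fin K → Fin d → ℝ),
      expKer a i s t x = Real.exp (∑ k : Fin K,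
        (x k i * Sig H T e σ i k s t - (1 / 2) * Sig H T e σ i k s t ^ 2)) := by
    intro s hs t ht i x
    simp [expKer, hsub s hs t ht]
  have hmild : ∀ t ∈ Icc 0 T, ∀ (x : Fin K → Fin d → ℝ) i, u t x i =
      c i * Real.exp (∑ k : Fin K,
        (x k i * Sig H T e σ i k 0 t - (1 / 2) * Sig H T e σ i k 0 t ^ 2)) +
      ∫ s in (0 : ℝ)..t, b s (u s (fun k j => x k j - SigMat H T e K σ i s t k j)) i *
        Real.exp (∑ k : Fin K,
          (x k i * Sig H T e σ i k s t - (1 / 2) * Sig H T e σ i k s t ^ 2)) := by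
    intro t ht x i
    rw [hu t ht x i, hker 0 h0T t ht]
    congr 1
    refine intervalIntegral.integral_congr fun s hs => ?_
    rw [uIcc_of_le ht.1] at hs
    have hs' : s ∈ Icc 0 T := ⟨hs.1, hs.2.trans ht.2⟩
    simp only [hb', clip_of_mem hs']
    rw [hker s hs' t ht, hshift s hs' t ht]
  have hinit : ∀ (x : Fin K → Fin d → ℝ), u 0 x = c := by
    intro x
    ext i
    rw [hu 0 h0T x i, expKer_self]
    simp
  refine ⟨u, huc, ?_, ⟨huc.continuousOn, fun t ht x i => hmild t ht x i⟩, fun hξ => ?_⟩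
  -- Dropping the negative square from the exponent leaves growth exponential in |x|. This sharper
  -- bound is what gives finite moments after substituting Gaussian coordinates; exp(|x|²/2) is not
  -- integrable against the standard Gaussian density.
  · obtain ⟨R, hR0, hR⟩ := exists_increment_bound ha T
    have hE : ∀ s ∈ Icc 0 T, ∀ t ∈ Icc 0 T, ∀ i (x : Fin K → Fin d → ℝ),
        expKer a i s t x ≤ Real.exp (R * ∑ k, ∑ j, |x k j|) := by
      intro s hs t ht i x
      refine Real.exp_le_exp.2 ?_
      rw [Finset.mul_sum]
      refine Finset.sum_le_sum fun k _ => ?_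
      have h1 : x k i * (a i k t - a i k s) ≤ |x k i| * R := by
        refine (le_abs_self _).trans ?_
        rw [abs_mul]
        exact mul_le_mul_of_nonneg_left (hR s hs t ht i k) (abs_nonneg _)
      have h2 : |x k i| ≤ ∑ j, |x k j| :=
        Finset.single_le_sum (f := fun j => |x k j|) (fun _ _ => abs_nonneg _) (Finset.mem_univ i)
      have h3 : |x k i| * R ≤ R * ∑ j, |x k j| := by
        rw [mul_comm]; exact mul_le_mul_of_nonneg_left h2 hR0
      have h4 := sq_nonneg (a i k t - a i k s)
      linarith
    refine ⟨‖c‖ + |M| * T, R, fun t ht x => ?_⟩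
    rw [pi_norm_le_iff_of_nonneg (by positivity)]
    intro i
    rw [hu t ht x i]
    refine (norm_add_le _ _).trans ?_
    rw [add_mul]
    refine add_le_add ?_ ?_
    · rw [norm_mul, Real.norm_of_nonneg (expKer_pos _ _ _ _ _).le]
      exact mul_le_mul (norm_le_pi_norm c i) (hE 0 h0T t ht i x) (expKer_pos _ _ _ _ _).le
        (norm_nonneg _)
    · have h1 : ‖∫ s in (0 : ℝ)..t, b' s (u s (shift a i s t x)) i * expKer a i s t x‖ ≤
          |M| * Real.exp (R * ∑ k, ∑ j, |x k j|) * |t - 0| := by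
        refine intervalIntegral.norm_integral_le_of_norm_le_const fun s hs => ?_
        rw [uIoc_of_le ht.1] at hs
        rw [norm_mul, Real.norm_of_nonneg (expKer_pos _ _ _ _ _).le]
        exact mul_le_mul (hbM s _ i) (hE s ⟨hs.1.le, hs.2.trans ht.2⟩ t ht i x)
          (expKer_pos _ _ _ _ _).le (abs_nonneg _)
      rw [sub_zero, abs_of_nonneg ht.1] at h1
      have h2 := mul_le_mul_of_nonneg_left ht.2
        (by positivity : 0 ≤ |M| * Real.exp (R * ∑ k, ∑ j, |x k j|))
      linarith
  · obtain ⟨w, hwc, hw⟩ := hchar.exists_hasFDerivAt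
    have hline : ∀ t ∈ Icc 0 T, ∀ (x : Matrix (Fin K) (Fin d) ℝ) i k j,
        HasLineDerivAt ℝ (fun y : Matrix (Fin K) (Fin d) ℝ => u t y i) (w k j t x i) x
          (Matrix.single k j (1 : ℝ)) := by
      intro t ht x i k j
      -- The direction is the unfolded form of `Matrix.single k j 1`; it selects the single
      -- coefficient `w k j` from the Fréchet derivative.
      have h1 : ∀ x : Fin K → Fin d → ℝ, HasLineDerivAt ℝ (fun y : Fin K → Fin d → ℝ => u t y i)
          (w k j t x i) x (fun k' j' => if k = k' ∧ j = j' then (1 : ℝ) else 0) := by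
        intro x
        refine ((hw t ht x i).hasLineDerivAt _).congr_deriv ?_
        simp [sum_apply, ite_and]
      exact h1 x
    refine ⟨huc.continuousOn, fun t ht x i k j => (hline t ht x i k j).lineDifferentiableAt,
      fun i k j => ?_, fun x => hinit x, fun t ht x i => ?_⟩
    · have h1 : Continuous fun p : ℝ × Matrix (Fin K) (Fin d) ℝ => w k j p.1 p.2 i :=
        (continuous_apply i).comp (hwc k j)
      exact h1.continuousOn.congr fun p hp => (hline p.1 hp.1 p.2 i k j).lineDeriv
    · have ht' : t ∈ Icc 0 T := ⟨ht.1.le, ht.2⟩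
      have hA : ∀ k, HasDerivWithinAt (a i k) (σ t i * Phi H T (e k) t) (Icc 0 T) t := by
        intro k
        have hc : ContinuousOn (fun s => σ s i * Phi H T (e k) s) (Icc 0 T) :=
          (hσi i).mul (hξ k k.2)
        -- Continuity of the `Phi H T (e k)` enters only here: it makes the characteristics
        -- differentiable, one-sidedly at the ends of [0,T].
        have h1 : HasDerivWithinAt (fun r => ∫ s in (0 : ℝ)..r, σ s i * Phi H T (e k) s)
            (σ t i * Phi H T (e k) t) (Icc 0 T) t := by
          have : Fact (t ∈ Icc 0 T) := ⟨ht'⟩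
          refine intervalIntegral.integral_hasDerivWithinAt_right
            ((hint i k).mono_set ?_) ?_ (hc t ht')
          · rw [uIcc_of_le ht'.1, uIcc_of_le hT.le]
            exact Icc_subset_Icc_right ht'.2
          · exact hc.stronglyMeasurableAtFilter_nhdsWithin measurableSet_Icc t
        refine h1.congr (fun s hs => ?_) ?_
        · simp only [ha_def, sigPrimitive, clip_of_mem hs, Sig]
        · simp only [ha_def, sigPrimitive, clip_of_mem ht', Sig]
      have h2 := hchar.hasDerivWithinAt hwc hw ht' hA x
      refine h2.congr_deriv ?_
      simp only [hb', clip_of_mem ht', Finset.mul_sum]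
      congr 1
      refine Finset.sum_congr rfl fun k _ => ?_
      rw [(hline t ht' x i k i).lineDeriv]
      ring

end Hyperbolic

end WongZakai

/-! ### The covariance density as a Gram kernel of Riesz type. -/

namespace WongZakai

section RieszKernel

/-- The Riesz composition integral at distance one. -/
noncomputable def rieszConst (α : ℝ) : ENNReal :=
  ∫⁻ v : ℝ, ENNReal.ofReal (|v| ^ α * |v - 1| ^ α)

lemma lintegral_even {f : ℝ → ENNReal} (hf : ∀ x, f (-x) = f x) :
    ∫⁻ x, f x ≤ 2 * ∫⁻ x in Ioi 0, f x := by
  have h1 : ∫⁻ x in Iio 0, f x = ∫⁻ x in Ioi 0, f x := by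
    have h2 := (Measure.measurePreserving_neg (volume : Measure ℝ)).setLIntegral_comp_emb
      (MeasurableEquiv.neg ℝ).measurableEmbedding f (Iio 0)
    simp only [hf, image_neg_eq_neg, neg_Iio, neg_zero] at h2
    exact h2
  rw [← lintegral_add_compl f (measurableSet_Iio (a := (0 : ℝ))), h1, compl_Iio,
    setLIntegral_congr (Ioi_ae_eq_Ici (a := (0 : ℝ))).symm, two_mul]

/-- The condition α > -1 makes the singularities at 0 and 1 integrable, and α < -1/2 the decay
|v|^(2α) at infinity. Within 1/2 of one singularity the other factor is bounded; away from both, the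
product is at most the sum of the squares. Both cases are majorised by g(v) + g(v - 1). -/
lemma rieszConst_ne_top {α : ℝ} (h1 : -1 < α) (h2 : α < -1 / 2) : rieszConst α ≠ ⊤ := by
  let g : ℝ → ℝ := fun v => if |v| ≤ 1 / 2 then (1 / 2 : ℝ) ^ α * |v| ^ α else |v| ^ (2 * α)
  have hgm : Measurable g := Measurable.ite (measurableSet_le (by fun_prop) (by fun_prop))
    (by fun_prop) (by fun_prop)
  have hg0 : ∀ v, 0 ≤ g v := by
    intro v; simp only [g]; split_ifs <;> positivity
  have hgi : IntegrableOn g (Ioi 0) := by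
    rw [← Ioc_union_Ioi_eq_Ioi (by norm_num : (0 : ℝ) ≤ 1 / 2)]
    refine IntegrableOn.union ?_ ?_
    · have h3 := (intervalIntegral.intervalIntegrable_rpow' (a := 0) (b := 1 / 2) h1).const_mul
        ((1 / 2 : ℝ) ^ α)
      rw [intervalIntegrable_iff_integrableOn_Ioc_of_le (by norm_num)] at h3
      refine h3.congr_fun (fun v hv => ?_) measurableSet_Ioc
      simp only [g, abs_of_pos hv.1, if_pos hv.2]
    · have h3 := integrableOn_Ioi_rpow_of_lt (a := 2 * α) (c := 1 / 2) (by linarith) (by norm_num)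
      refine h3.congr_fun (fun v hv => ?_) measurableSet_Ioi
      have hv' : (1 / 2 : ℝ) < v := hv
      have : 0 < v := by linarith
      simp only [g, abs_of_pos this, if_neg (not_le.2 hv')]
  have hgl : ∫⁻ v, ENNReal.ofReal (g v) < ⊤ := by
    refine (lintegral_even (fun x => by simp [g])).trans_lt (ENNReal.mul_lt_top (by simp) ?_)
    exact (hasFiniteIntegral_iff_ofReal (ae_of_all _ hg0)).1 hgi.2
  have hle : ∀ v, v ≠ 0 → v ≠ 1 → |v| ^ α * |v - 1| ^ α ≤ g v + g (v - 1) := by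
    intro v hv0 hv1
    have hα : α ≤ 0 := by linarith
    have hp0 : 0 < |v| := abs_pos.2 hv0
    have hp1 : 0 < |v - 1| := abs_pos.2 (sub_ne_zero.2 hv1)
    by_cases ha : |v| ≤ 1 / 2
    · have hb : 1 / 2 ≤ |v - 1| := by
        have := abs_sub_abs_le_abs_sub 1 v
        rw [abs_one, abs_sub_comm] at this
        linarith
      have h3 : |v - 1| ^ α ≤ (1 / 2 : ℝ) ^ α :=
        Real.rpow_le_rpow_of_nonpos (by norm_num) hb hα
      have h4 : |v| ^ α * |v - 1| ^ α ≤ g v := by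
        simp only [g, if_pos ha]
        rw [mul_comm]
        gcongr
      linarith [hg0 (v - 1)]
    · by_cases hb : |v - 1| ≤ 1 / 2
      · have h3 : |v| ^ α ≤ (1 / 2 : ℝ) ^ α :=
          Real.rpow_le_rpow_of_nonpos (by norm_num) (not_le.1 ha).le hα
        have h4 : |v| ^ α * |v - 1| ^ α ≤ g (v - 1) := by
          simp only [g, if_pos hb]
          gcongr
        linarith [hg0 v]
      · simp only [g, if_neg ha, if_neg hb]
        rw [two_mul, Real.rpow_add hp0, Real.rpow_add hp1]
        nlinarith [sq_nonneg (|v| ^ α - |v - 1| ^ α), sq_nonneg (|v| ^ α), sq_nonneg (|v - 1| ^ α)]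
  refine ne_of_lt ?_
  calc rieszConst α ≤ ∫⁻ v, (ENNReal.ofReal (g v) + ENNReal.ofReal (g (v - 1))) := by
        refine lintegral_mono_ae ?_
        have e0 : ∀ᵐ v : ℝ, v ≠ 0 := by simp [ae_iff]
        have e1 : ∀ᵐ v : ℝ, v ≠ 1 := by simp [ae_iff]
        filter_upwards [e0, e1] with v hv0 hv1
        rw [← ENNReal.ofReal_add (hg0 _) (hg0 _)]
        exact ENNReal.ofReal_le_ofReal (hle v hv0 hv1)
    _ = (∫⁻ v, ENNReal.ofReal (g v)) + ∫⁻ v, ENNReal.ofReal (g v) := by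
        rw [lintegral_add_left hgm.ennreal_ofReal,
          lintegral_sub_right_eq_self (fun v => ENNReal.ofReal (g v)) 1]
    _ < ⊤ := ENNReal.add_lt_top.2 ⟨hgl, hgl⟩

/-- Needed because `phiRoot` divides by this constant. -/
lemma rieszConst_ne_zero (α : ℝ) : rieszConst α ≠ 0 := by
  rw [rieszConst, ← pos_iff_ne_zero, lintegral_pos_iff_support (by fun_prop)]
  have h : Ioo (0 : ℝ) 1 ⊆ Function.support fun v : ℝ =>
      ENNReal.ofReal (|v| ^ α * |v - 1| ^ α) := by
    intro v hv
    have h0 : 0 < |v| := abs_pos.2 hv.1.ne'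
    have h1 : 0 < |v - 1| := abs_pos.2 (sub_ne_zero.2 hv.2.ne)
    simp only [Function.mem_support, ne_eq, ENNReal.ofReal_eq_zero, not_le]
    positivity
  refine lt_of_lt_of_le ?_ (measure_mono h)
  simp

/-- Translation by s and scaling by s - t reduce to distance one. For α = H - 3/2 the exponent 2α +
1 is 2H - 2, that of `phi`, and 1/2 < H < 1 is exactly -1 < α < -1/2. -/
lemma lintegral_riesz (α : ℝ) {s t : ℝ} (hst : s ≠ t) :
    ∫⁻ u : ℝ, ENNReal.ofReal (|s - u| ^ α * |t - u| ^ α) =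
      ENNReal.ofReal (|s - t| ^ (2 * α + 1)) * rieszConst α := by
  have hr : s - t ≠ 0 := sub_ne_zero.2 hst
  have hr' : 0 < |s - t| := abs_pos.2 hr
  have h1 : ∫⁻ u : ℝ, ENNReal.ofReal (|s - u| ^ α * |t - u| ^ α) =
      ∫⁻ v : ℝ, ENNReal.ofReal (|v| ^ α * |v - (s - t)| ^ α) := by
    rw [← lintegral_sub_left_eq_self (fun v : ℝ => ENNReal.ofReal (|v| ^ α * |v - (s - t)| ^ α)) s]
    congr 1
    ext u
    congr 4
    ring_nf
  have h2 := lintegral_map (μ := volume)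
    (f := fun v : ℝ => ENNReal.ofReal (|v| ^ α * |v - (s - t)| ^ α))
    (g := fun w : ℝ => (s - t) * w) (by fun_prop) (by fun_prop)
  rw [Real.map_volume_mul_left hr, lintegral_smul_measure] at h2
  have h3 : ∀ w : ℝ, ENNReal.ofReal (|(s - t) * w| ^ α * |(s - t) * w - (s - t)| ^ α) =
      ENNReal.ofReal (|s - t| ^ (2 * α)) * ENNReal.ofReal (|w| ^ α * |w - 1| ^ α) := by
    intro w
    rw [← ENNReal.ofReal_mul (by positivity)]
    congr 1
    have : (s - t) * w - (s - t) = (s - t) * (w - 1) := by ring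
    rw [this, abs_mul, abs_mul, Real.mul_rpow (abs_nonneg _) (abs_nonneg _),
      Real.mul_rpow (abs_nonneg _) (abs_nonneg _), two_mul, Real.rpow_add hr']
    ring
  simp only [h3] at h2
  rw [lintegral_const_mul _ (by fun_prop)] at h2
  rw [h1, rieszConst, Real.rpow_add hr', Real.rpow_one, mul_comm (|s - t| ^ (2 * α)),
    ENNReal.ofReal_mul (abs_nonneg _), mul_assoc, ← h2, abs_inv, smul_eq_mul, ← mul_assoc,
    ← ENNReal.ofReal_mul (abs_nonneg _), mul_inv_cancel₀ hr'.ne', ENNReal.ofReal_one, one_mul]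

/-- The square root of the covariance density. -/
noncomputable def phiRoot (H s u : ℝ) : ℝ :=
  Real.sqrt (H * (2 * H - 1) / (rieszConst (H - 3 / 2)).toReal) * |s - u| ^ (H - 3 / 2)

lemma phiRoot_nonneg (H s u : ℝ) : 0 ≤ phiRoot H s u := by unfold phiRoot; positivity

lemma measurable_phiRoot (H : ℝ) : Measurable fun p : ℝ × ℝ => phiRoot H p.1 p.2 := by
  unfold phiRoot; fun_prop

lemma measurable_phi (H : ℝ) : Measurable fun p : ℝ × ℝ => phi H p.1 p.2 := by
  unfold phi; fun_prop

lemma phi_nonneg {H : ℝ} (hH : 1 / 2 < H) (s t : ℝ) : 0 ≤ phi H s t := by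
  have h1 : 0 ≤ H := by linarith
  have h2 : 0 ≤ 2 * H - 1 := by linarith
  unfold phi
  positivity

lemma phi_comm (H s t : ℝ) : phi H s t = phi H t s := by rw [phi, phi, abs_sub_comm]

/-- The covariance density is a Gram kernel. -/
lemma lintegral_phiRoot_mul {H : ℝ} (hH : 1 / 2 < H) (hH1 : H < 1) {s t : ℝ} (hst : s ≠ t) :
    ∫⁻ u, ENNReal.ofReal (phiRoot H s u * phiRoot H t u) = ENNReal.ofReal (phi H s t) := by
  set C := rieszConst (H - 3 / 2) with hC
  have hCt : C ≠ ⊤ := rieszConst_ne_top (by linarith) (by linarith)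
  have hC0 : 0 < C.toReal := ENNReal.toReal_pos (rieszConst_ne_zero _) hCt
  have hc : 0 ≤ H * (2 * H - 1) := mul_nonneg (by linarith) (by linarith)
  have h1 : ∀ u, ENNReal.ofReal (phiRoot H s u * phiRoot H t u) =
      ENNReal.ofReal (H * (2 * H - 1) / C.toReal) *
        ENNReal.ofReal (|s - u| ^ (H - 3 / 2) * |t - u| ^ (H - 3 / 2)) := by
    intro u
    rw [← ENNReal.ofReal_mul (by positivity)]
    congr 1
    rw [phiRoot, phiRoot, mul_mul_mul_comm, Real.mul_self_sqrt (by positivity)]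
  simp only [h1]
  rw [lintegral_const_mul _ (by fun_prop), lintegral_riesz _ hst, ← hC, ← ENNReal.ofReal_toReal hCt,
    ← ENNReal.ofReal_mul (by positivity), ← ENNReal.ofReal_mul (by positivity), phi]
  congr 1
  have h2 : 2 * (H - 3 / 2) + 1 = 2 * H - 2 := by ring
  rw [h2, ENNReal.toReal_ofReal hC0.le]
  field_simp

end RieszKernel

end WongZakai

/-! ### The inner product of 𝓗_φ. -/

namespace WongZakai

section InnerProduct

variable {H T : ℝ} {f g h : ℝ → ℝ}

/-- Lebesgue measure on `[0,T]`. -/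
noncomputable abbrev volT (T : ℝ) : Measure ℝ := volume.restrict (Icc 0 T)

lemma intervalIntegral_eq_volT (hT : 0 ≤ T) (f : ℝ → ℝ) :
    ∫ s in (0 : ℝ)..T, f s = ∫ s, f s ∂(volT T) := by
  rw [intervalIntegral.integral_of_le hT, integral_Icc_eq_integral_Ioc]

/-- The Gram identity fails on the diagonal, where the integral of the squared root is infinite
while `phi` is zero by the convention for powers of 0. The diagonal has to be a null set. -/
lemma ae_prod_ne (T : ℝ) : ∀ᵐ p : ℝ × ℝ ∂((volT T).prod (volT T)), p.1 ≠ p.2 := by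
  have hm : MeasurableSet {p : ℝ × ℝ | p.1 = p.2} := measurableSet_eq_fun measurable_fst measurable_snd
  rw [ae_iff]
  simp only [ne_eq, not_not]
  rw [Measure.measure_prod_null hm]
  refine ae_of_all _ fun x => ?_
  have : Prod.mk x ⁻¹' {p : ℝ × ℝ | p.1 = p.2} = {x} := by ext y; simp [eq_comm]
  simp only [this]
  simp

/-- The image of `f` under the square root of the covariance operator. -/
noncomputable def rootMap (H T : ℝ) (f : ℝ → ℝ) (u : ℝ) : ℝ := ∫ s, f s * phiRoot H s u ∂(volT T)

/-- Write the square as a double integral and apply Tonelli: the inner integral over u is φ by the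
Gram identity, so the total is the absolutely convergent integral defining 𝓗_φ. -/
lemma lintegral_rootMap_sq_lt_top (hH : 1 / 2 < H) (hH1 : H < 1) (hf : f ∈ Hphi H T) :
    ∫⁻ u, (∫⁻ s, ‖f s * phiRoot H s u‖ₑ ∂(volT T)) ^ 2 < ⊤ := by
  obtain ⟨hm, hi⟩ := hf
  have hr := measurable_phiRoot H
  have h0 : ∀ u, AEMeasurable (fun s => ‖f s * phiRoot H s u‖ₑ) (volT T) := fun u =>
    (hm.aemeasurable.mul (hr.comp (by fun_prop : Measurable fun s : ℝ => (s, u))).aemeasurable).enorm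
  have h1 : ∀ u, (∫⁻ s, ‖f s * phiRoot H s u‖ₑ ∂(volT T)) ^ 2 =
      ∫⁻ p : ℝ × ℝ, ‖f p.1 * phiRoot H p.1 u‖ₑ * ‖f p.2 * phiRoot H p.2 u‖ₑ
        ∂((volT T).prod (volT T)) := fun u => by
    rw [lintegral_prod_mul (h0 u) (h0 u), sq]
  simp only [h1]
  rw [lintegral_lintegral_swap]
  · have h2 : ∀ᵐ p : ℝ × ℝ ∂((volT T).prod (volT T)),
        ∫⁻ u, ‖f p.1 * phiRoot H p.1 u‖ₑ * ‖f p.2 * phiRoot H p.2 u‖ₑ =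
          ‖f p.1 * f p.2 * phi H p.1 p.2‖ₑ := by
      filter_upwards [ae_prod_ne T] with p hp
      have h3 : ∀ u, ‖f p.1 * phiRoot H p.1 u‖ₑ * ‖f p.2 * phiRoot H p.2 u‖ₑ =
          ‖f p.1 * f p.2‖ₑ * ENNReal.ofReal (phiRoot H p.1 u * phiRoot H p.2 u) := fun u => by
        rw [← Real.enorm_eq_ofReal (mul_nonneg (phiRoot_nonneg _ _ _) (phiRoot_nonneg _ _ _)),
          ← enorm_mul, ← enorm_mul]
        congr 1; ring
      simp only [h3]
      rw [lintegral_const_mul, lintegral_phiRoot_mul hH hH1 hp, enorm_mul (f p.1 * f p.2),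
        Real.enorm_eq_ofReal (phi_nonneg hH _ _)]
      exact ((hr.comp (by fun_prop : Measurable fun u : ℝ => (p.1, u))).mul
        (hr.comp (by fun_prop : Measurable fun u : ℝ => (p.2, u)))).ennreal_ofReal
    rw [lintegral_congr_ae h2]
    exact hi.2
  · have hm1 : AEMeasurable (fun q : ℝ × ℝ × ℝ => f q.2.1)
        (volume.prod ((volT T).prod (volT T))) :=
      (hm.aemeasurable.comp_quasiMeasurePreserving Measure.quasiMeasurePreserving_fst
        ).comp_quasiMeasurePreserving Measure.quasiMeasurePreserving_snd
    have hm2 : AEMeasurable (fun q : ℝ × ℝ × ℝ => f q.2.2)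
        (volume.prod ((volT T).prod (volT T))) :=
      (hm.aemeasurable.comp_quasiMeasurePreserving Measure.quasiMeasurePreserving_snd
        ).comp_quasiMeasurePreserving Measure.quasiMeasurePreserving_snd
    exact (hm1.mul (hr.comp (by fun_prop : Measurable fun q : ℝ × ℝ × ℝ =>
      (q.2.1, q.1))).aemeasurable).enorm.mul (hm2.mul (hr.comp (by fun_prop :
      Measurable fun q : ℝ × ℝ × ℝ => (q.2.2, q.1))).aemeasurable).enorm

/-- At fixed u the absolute integral factors into a product AB ≤ A² + B², and both squares are
integrable in u. This provides absolute convergence of mixed terms, which membership of f and g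
separately does not state. -/
lemma integrable_triple (hH : 1 / 2 < H) (hH1 : H < 1) (hf : f ∈ Hphi H T) (hg : g ∈ Hphi H T) :
    Integrable (fun q : (ℝ × ℝ) × ℝ => (f q.1.1 * phiRoot H q.1.1 q.2) *
      (g q.1.2 * phiRoot H q.1.2 q.2)) (((volT T).prod (volT T)).prod volume) := by
  have hr := measurable_phiRoot H
  have hm1 : AEStronglyMeasurable (fun q : (ℝ × ℝ) × ℝ => f q.1.1)
      (((volT T).prod (volT T)).prod volume) :=
    (hf.1.comp_quasiMeasurePreserving Measure.quasiMeasurePreserving_fst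
      ).comp_quasiMeasurePreserving Measure.quasiMeasurePreserving_fst
  have hm2 : AEStronglyMeasurable (fun q : (ℝ × ℝ) × ℝ => g q.1.2)
      (((volT T).prod (volT T)).prod volume) :=
    (hg.1.comp_quasiMeasurePreserving Measure.quasiMeasurePreserving_snd
      ).comp_quasiMeasurePreserving Measure.quasiMeasurePreserving_fst
  have hm : AEStronglyMeasurable (fun q : (ℝ × ℝ) × ℝ => (f q.1.1 * phiRoot H q.1.1 q.2) *
      (g q.1.2 * phiRoot H q.1.2 q.2)) (((volT T).prod (volT T)).prod volume) :=
    (hm1.mul (hr.comp (by fun_prop : Measurable fun q : (ℝ × ℝ) × ℝ =>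
      (q.1.1, q.2))).aestronglyMeasurable).mul (hm2.mul (hr.comp (by fun_prop :
      Measurable fun q : (ℝ × ℝ) × ℝ => (q.1.2, q.2))).aestronglyMeasurable)
  refine ⟨hm, ?_⟩
  rw [hasFiniteIntegral_iff_enorm, lintegral_prod_symm _ hm.enorm]
  have h1 : ∀ (k : ℝ → ℝ), AEStronglyMeasurable k (volT T) → ∀ u,
      AEMeasurable (fun s => ‖k s * phiRoot H s u‖ₑ) (volT T) := fun k hk u =>
    (hk.mul (hr.comp (by fun_prop : Measurable fun s : ℝ =>
      (s, u))).aestronglyMeasurable).enorm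
  have h2 : ∀ u, ∫⁻ p : ℝ × ℝ, ‖(f p.1 * phiRoot H p.1 u) * (g p.2 * phiRoot H p.2 u)‖ₑ
      ∂((volT T).prod (volT T)) ≤
      (∫⁻ s, ‖f s * phiRoot H s u‖ₑ ∂(volT T)) ^ 2 +
        (∫⁻ s, ‖g s * phiRoot H s u‖ₑ ∂(volT T)) ^ 2 := by
    intro u
    simp only [enorm_mul (f _ * _)]
    rw [lintegral_prod_mul (h1 f hf.1 u) (h1 g hg.1 u)]
    rcases le_total (∫⁻ s, ‖f s * phiRoot H s u‖ₑ ∂(volT T))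
      (∫⁻ s, ‖g s * phiRoot H s u‖ₑ ∂(volT T)) with h | h
    · rw [sq, sq]
      exact (mul_le_mul_left h _).trans le_add_self
    · rw [sq, sq]
      exact (mul_le_mul_right h _).trans le_self_add
  have hmeas : AEMeasurable (fun u => (∫⁻ s, ‖f s * phiRoot H s u‖ₑ ∂(volT T)) ^ 2) volume := by
    have h3 : AEMeasurable (fun q : ℝ × ℝ => ‖f q.2 * phiRoot H q.2 q.1‖ₑ)
        (volume.prod (volT T)) :=
      ((hf.1.comp_quasiMeasurePreserving Measure.quasiMeasurePreserving_snd).mul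
        (hr.comp (by fun_prop : Measurable fun q : ℝ × ℝ =>
          (q.2, q.1))).aestronglyMeasurable).enorm
    exact h3.lintegral_prod_right'.pow_const 2
  refine (lintegral_mono h2).trans_lt ?_
  rw [lintegral_add_left' hmeas]
  exact ENNReal.add_lt_top.2 ⟨lintegral_rootMap_sq_lt_top hH hH1 hf,
    lintegral_rootMap_sq_lt_top hH hH1 hg⟩

lemma integral_triple_ae (hH : 1 / 2 < H) (hH1 : H < 1) (f g : ℝ → ℝ) :
    ∀ᵐ p : ℝ × ℝ ∂((volT T).prod (volT T)),
      ∫ u, (f p.1 * phiRoot H p.1 u) * (g p.2 * phiRoot H p.2 u) =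
        f p.1 * g p.2 * phi H p.1 p.2 := by
  have hr := measurable_phiRoot H
  filter_upwards [ae_prod_ne T] with p hp
  have h1 : ∫ u, phiRoot H p.1 u * phiRoot H p.2 u = phi H p.1 p.2 := by
    rw [integral_eq_lintegral_of_nonneg_ae (ae_of_all _ fun u =>
      mul_nonneg (phiRoot_nonneg _ _ _) (phiRoot_nonneg _ _ _))
      ((hr.comp (by fun_prop : Measurable fun u : ℝ => (p.1, u))).mul
        (hr.comp (by fun_prop : Measurable fun u : ℝ => (p.2, u)))).aestronglyMeasurable,
      lintegral_phiRoot_mul hH hH1 hp, ENNReal.toReal_ofReal (phi_nonneg hH _ _)]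
  rw [← h1, ← integral_const_mul]
  congr 1
  ext u
  ring

/-- Cross terms of elements of `𝓗_φ` are integrable. -/
lemma integrable_mul_phi (hH : 1 / 2 < H) (hH1 : H < 1) (hf : f ∈ Hphi H T) (hg : g ∈ Hphi H T) :
    Integrable (fun p : ℝ × ℝ => f p.1 * g p.2 * phi H p.1 p.2) ((volT T).prod (volT T)) :=
  (integrable_triple hH hH1 hf hg).integral_prod_left.congr (integral_triple_ae hH hH1 f g)

lemma phiInner_eq_integral_prod (hH : 1 / 2 < H) (hH1 : H < 1) (hT : 0 ≤ T) (hf : f ∈ Hphi H T)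
    (hg : g ∈ Hphi H T) :
    phiInner H T f g = ∫ p : ℝ × ℝ, f p.1 * g p.2 * phi H p.1 p.2 ∂((volT T).prod (volT T)) := by
  rw [integral_prod _ (integrable_mul_phi hH hH1 hf hg), phiInner, intervalIntegral_eq_volT hT]
  simp only [intervalIntegral_eq_volT hT]

/-- Represents the form as an L²(ℝ) product of root maps; positivity and symmetry are read off from
it. -/
lemma phiInner_eq_integral_rootMap (hH : 1 / 2 < H) (hH1 : H < 1) (hT : 0 ≤ T)
    (hf : f ∈ Hphi H T) (hg : g ∈ Hphi H T) :
    phiInner H T f g = ∫ u, rootMap H T f u * rootMap H T g u := by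
  rw [phiInner_eq_integral_prod hH hH1 hT hf hg,
    ← integral_congr_ae (integral_triple_ae hH hH1 f g),
    integral_integral_swap (integrable_triple hH hH1 hf hg)]
  congr 1
  ext u
  exact integral_prod_mul (fun s => f s * phiRoot H s u) fun s => g s * phiRoot H s u

lemma phiInner_self_nonneg (hH : 1 / 2 < H) (hH1 : H < 1) (hT : 0 ≤ T) (hf : f ∈ Hphi H T) :
    0 ≤ phiInner H T f f := by
  rw [phiInner_eq_integral_rootMap hH hH1 hT hf hf]
  exact integral_nonneg fun u => mul_self_nonneg _

lemma add_mem_Hphi (hH : 1 / 2 < H) (hH1 : H < 1) (hf : f ∈ Hphi H T) (hg : g ∈ Hphi H T) :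
    f + g ∈ Hphi H T := by
  refine ⟨hf.1.add hg.1, ?_⟩
  have h1 := ((integrable_mul_phi hH hH1 hf hf).add (integrable_mul_phi hH hH1 hf hg)).add
    ((integrable_mul_phi hH hH1 hg hf).add (integrable_mul_phi hH hH1 hg hg))
  refine h1.congr (ae_of_all _ fun p => ?_)
  simp only [Pi.add_apply]
  ring

lemma smul_mem_Hphi (r : ℝ) (hf : f ∈ Hphi H T) : r • f ∈ Hphi H T := by
  refine ⟨hf.1.const_smul r, (hf.2.const_mul (r * r)).congr (ae_of_all _ fun p => ?_)⟩
  simp only [Pi.smul_apply, smul_eq_mul]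
  ring

lemma zero_mem_Hphi : (0 : ℝ → ℝ) ∈ Hphi H T :=
  ⟨aestronglyMeasurable_zero, by simp⟩

lemma sub_mem_Hphi (hH : 1 / 2 < H) (hH1 : H < 1) (hf : f ∈ Hphi H T) (hg : g ∈ Hphi H T) :
    f - g ∈ Hphi H T := by
  have := add_mem_Hphi hH hH1 hf (smul_mem_Hphi (-1) hg)
  rwa [neg_one_smul, ← sub_eq_add_neg] at this

lemma sum_mem_Hphi (hH : 1 / 2 < H) (hH1 : H < 1) {ι : Type*} (S : Finset ι) {F : ι → ℝ → ℝ}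
    (hF : ∀ k ∈ S, F k ∈ Hphi H T) : ∑ k ∈ S, F k ∈ Hphi H T := by
  classical
  induction S using Finset.induction_on with
  | empty => simpa using zero_mem_Hphi
  | insert k S hk ih =>
    rw [Finset.sum_insert hk]
    exact add_mem_Hphi hH hH1 (hF k (by simp)) (ih fun j hj => hF j (by simp [hj]))

lemma phiInner_add_left (hH : 1 / 2 < H) (hH1 : H < 1) (hT : 0 ≤ T) (hf : f ∈ Hphi H T)
    (hg : g ∈ Hphi H T) (hh : h ∈ Hphi H T) :
    phiInner H T (f + g) h = phiInner H T f h + phiInner H T g h := by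
  rw [phiInner_eq_integral_prod hH hH1 hT (add_mem_Hphi hH hH1 hf hg) hh,
    phiInner_eq_integral_prod hH hH1 hT hf hh, phiInner_eq_integral_prod hH hH1 hT hg hh,
    ← integral_add (integrable_mul_phi hH hH1 hf hh) (integrable_mul_phi hH hH1 hg hh)]
  congr 1
  ext p
  simp only [Pi.add_apply]
  ring

lemma phiInner_smul_left (r : ℝ) (f g : ℝ → ℝ) :
    phiInner H T (r • f) g = r * phiInner H T f g := by
  simp only [phiInner, Pi.smul_apply, smul_eq_mul, mul_assoc, intervalIntegral.integral_const_mul]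

lemma phiInner_zero_left (g : ℝ → ℝ) : phiInner H T 0 g = 0 := by
  have := phiInner_smul_left (H := H) (T := T) 0 0 g
  rwa [zero_smul, zero_mul] at this

lemma phiInner_comm (hH : 1 / 2 < H) (hH1 : H < 1) (hT : 0 ≤ T) (hf : f ∈ Hphi H T)
    (hg : g ∈ Hphi H T) : phiInner H T f g = phiInner H T g f := by
  rw [phiInner_eq_integral_rootMap hH hH1 hT hf hg, phiInner_eq_integral_rootMap hH hH1 hT hg hf]
  simp only [mul_comm]

lemma phiInner_sub_left (hH : 1 / 2 < H) (hH1 : H < 1) (hT : 0 ≤ T) (hf : f ∈ Hphi H T)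
    (hg : g ∈ Hphi H T) (hh : h ∈ Hphi H T) :
    phiInner H T (f - g) h = phiInner H T f h - phiInner H T g h := by
  have h1 := phiInner_add_left hH hH1 hT hf (smul_mem_Hphi (-1) hg) hh
  rw [phiInner_smul_left, neg_one_smul, ← sub_eq_add_neg] at h1
  rw [h1]; ring

lemma phiInner_add_right (hH : 1 / 2 < H) (hH1 : H < 1) (hT : 0 ≤ T) (hf : f ∈ Hphi H T)
    (hg : g ∈ Hphi H T) (hh : h ∈ Hphi H T) :
    phiInner H T f (g + h) = phiInner H T f g + phiInner H T f h := by
  rw [phiInner_comm hH hH1 hT hf (add_mem_Hphi hH hH1 hg hh),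
    phiInner_add_left hH hH1 hT hg hh hf, phiInner_comm hH hH1 hT hg hf,
    phiInner_comm hH hH1 hT hh hf]

lemma phiInner_smul_right (r : ℝ) (f g : ℝ → ℝ) :
    phiInner H T f (r • g) = r * phiInner H T f g := by
  simp only [phiInner, Pi.smul_apply, smul_eq_mul, ← intervalIntegral.integral_const_mul]
  congr 1; ext s; congr 1; ext t; ring

lemma phiInner_sum_left (hH : 1 / 2 < H) (hH1 : H < 1) (hT : 0 ≤ T) {ι : Type*} (S : Finset ι)
    {F : ι → ℝ → ℝ} (hF : ∀ k ∈ S, F k ∈ Hphi H T) (hg : g ∈ Hphi H T) :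
    phiInner H T (∑ k ∈ S, F k) g = ∑ k ∈ S, phiInner H T (F k) g := by
  classical
  induction S using Finset.induction_on with
  | empty => simp [phiInner_zero_left]
  | insert k S hk ih =>
    have hS : ∀ j ∈ S, F j ∈ Hphi H T := fun j hj => hF j (by simp [hj])
    rw [Finset.sum_insert hk, Finset.sum_insert hk, phiInner_add_left hH hH1 hT (hF k (by simp))
      (sum_mem_Hphi hH hH1 S hS) hg, ih hS]

lemma phiInner_sum_right (hH : 1 / 2 < H) (hH1 : H < 1) (hT : 0 ≤ T) {ι : Type*} (S : Finset ι)
    {F : ι → ℝ → ℝ} (hF : ∀ k ∈ S, F k ∈ Hphi H T) (hg : g ∈ Hphi H T) :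
    phiInner H T g (∑ k ∈ S, F k) = ∑ k ∈ S, phiInner H T g (F k) := by
  rw [phiInner_comm hH hH1 hT hg (sum_mem_Hphi hH hH1 S hF), phiInner_sum_left hH hH1 hT S hF hg]
  exact Finset.sum_congr rfl fun k hk => phiInner_comm hH hH1 hT (hF k hk) hg

lemma phiInner_add_self (hH : 1 / 2 < H) (hH1 : H < 1) (hT : 0 ≤ T) (hf : f ∈ Hphi H T)
    (hg : g ∈ Hphi H T) :
    phiInner H T (f + g) (f + g) =
      phiInner H T f f + 2 * phiInner H T f g + phiInner H T g g := by
  have hfg := add_mem_Hphi hH hH1 hf hg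
  rw [phiInner_add_left hH hH1 hT hf hg hfg, phiInner_add_right hH hH1 hT hf hf hg,
    phiInner_add_right hH hH1 hT hg hf hg, phiInner_comm hH hH1 hT hg hf]
  ring

lemma phiNorm_nonneg (H T : ℝ) (f : ℝ → ℝ) : 0 ≤ phiNorm H T f := Real.sqrt_nonneg _

lemma phiNorm_sq (hH : 1 / 2 < H) (hH1 : H < 1) (hT : 0 ≤ T) (hf : f ∈ Hphi H T) :
    phiNorm H T f ^ 2 = phiInner H T f f :=
  Real.sq_sqrt (phiInner_self_nonneg hH hH1 hT hf)

/-- The Cauchy–Schwarz inequality in `𝓗_φ`. -/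
lemma abs_phiInner_le (hH : 1 / 2 < H) (hH1 : H < 1) (hT : 0 ≤ T) (hf : f ∈ Hphi H T)
    (hg : g ∈ Hphi H T) : |phiInner H T f g| ≤ phiNorm H T f * phiNorm H T g := by
  have h1 : ∀ r : ℝ, 0 ≤ phiInner H T f f * (r * r) + (2 * phiInner H T f g) * r +
      phiInner H T g g := by
    intro r
    have h2 := phiInner_self_nonneg hH hH1 hT (add_mem_Hphi hH hH1 (smul_mem_Hphi r hf) hg)
    rw [phiInner_add_self hH hH1 hT (smul_mem_Hphi r hf) hg, phiInner_smul_left,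
      phiInner_smul_left, phiInner_smul_right] at h2
    linarith
  have h3 := discrim_le_zero h1
  rw [discrim] at h3
  refine abs_le_of_sq_le_sq ?_ (mul_nonneg (phiNorm_nonneg _ _ _) (phiNorm_nonneg _ _ _))
  rw [mul_pow, phiNorm_sq hH hH1 hT hf, phiNorm_sq hH hH1 hT hg]
  linarith

lemma phiNorm_add_le (hH : 1 / 2 < H) (hH1 : H < 1) (hT : 0 ≤ T) (hf : f ∈ Hphi H T)
    (hg : g ∈ Hphi H T) : phiNorm H T (f + g) ≤ phiNorm H T f + phiNorm H T g := by
  have h1 := le_of_abs_le (abs_phiInner_le hH hH1 hT hf hg)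
  refine Real.sqrt_le_iff.2 ⟨add_nonneg (phiNorm_nonneg _ _ _) (phiNorm_nonneg _ _ _), ?_⟩
  rw [phiInner_add_self hH hH1 hT hf hg, ← phiNorm_sq hH hH1 hT hf, ← phiNorm_sq hH hH1 hT hg]
  linarith

lemma phiNorm_smul (r : ℝ) (f : ℝ → ℝ) : phiNorm H T (r • f) = |r| * phiNorm H T f := by
  rw [phiNorm, phiNorm, phiInner_smul_left, phiInner_smul_right, ← mul_assoc,
    Real.sqrt_mul (mul_self_nonneg r), Real.sqrt_mul_self_eq_abs]

end InnerProduct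

end WongZakai

/-! ### Step functions and the fractional Brownian covariance. -/

namespace WongZakai

section StepFunctions

variable {H T : ℝ} {f g : ℝ → ℝ}

lemma integrable_phi_left (hH : 1 / 2 < H) (hT : 0 ≤ T) (s : ℝ) :
    Integrable (fun t => phi H s t) (volT T) := by
  have : Integrable (fun t => phi H t s) (volT T) :=
    (intervalIntegrable_iff_integrableOn_Icc_of_le hT).1 (intervalIntegrable_phi hH s 0 T)
  simpa only [phi_comm H s] using this

/-- Schur's bound for the covariance density. -/
lemma exists_integral_phi_le (hH : 1 / 2 < H) (hT : 0 ≤ T) :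
    ∃ C : ℝ, 0 ≤ C ∧ ∀ s ∈ Icc 0 T, ∫ t, phi H s t ∂(volT T) ≤ C := by
  refine ⟨∫ t in (-T)..T, phi H t 0, intervalIntegral.integral_nonneg (by linarith)
    fun t _ => phi_nonneg hH _ _, fun s hs => ?_⟩
  rw [← intervalIntegral_eq_volT hT]
  have : ∀ t, phi H s t = phi H (t - s) 0 := fun t => by
    rw [phi_comm]; simp [phi]
  simp_rw [this]
  rw [intervalIntegral.integral_comp_sub_right (fun t => phi H t 0)]
  exact intervalIntegral.integral_mono_interval (by linarith [hs.2]) (by linarith)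
    (by linarith [hs.1]) (Eventually.of_forall fun _ => phi_nonneg hH _ _)
    (intervalIntegrable_phi hH 0 _ _)

lemma integrable_sq_mul_phi (hH : 1 / 2 < H) (hT : 0 ≤ T) (hf : MemLp f 2 (volT T)) :
    Integrable (fun p : ℝ × ℝ => f p.1 ^ 2 * phi H p.1 p.2) ((volT T).prod (volT T)) := by
  obtain ⟨C, hC0, hC⟩ := exists_integral_phi_le hH hT
  have hm : AEStronglyMeasurable (fun p : ℝ × ℝ => f p.1 ^ 2 * phi H p.1 p.2)
      ((volT T).prod (volT T)) :=
    (hf.1.comp_fst.pow 2).mul (measurable_phi H).aestronglyMeasurable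
  rw [integrable_prod_iff hm]
  refine ⟨ae_of_all _ fun s => (integrable_phi_left hH hT s).const_mul (f s ^ 2), ?_⟩
  refine (hf.integrable_sq.const_mul C).mono' hm.norm.integral_prod_right' ?_
  filter_upwards [ae_restrict_mem measurableSet_Icc] with s hs
  rw [Real.norm_of_nonneg (integral_nonneg fun _ => norm_nonneg _)]
  simp only [norm_mul, Real.norm_of_nonneg (sq_nonneg _), Real.norm_of_nonneg (phi_nonneg hH _ _)]
  rw [integral_const_mul, mul_comm]
  exact mul_le_mul_of_nonneg_right (hC s hs) (sq_nonneg _)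

lemma abs_mul_mul_phi_le (hH : 1 / 2 < H) (x y s t : ℝ) :
    |x * y * phi H s t| ≤ (1 / 2) * (x ^ 2 * phi H s t + y ^ 2 * phi H s t) := by
  rw [abs_mul, abs_of_nonneg (phi_nonneg hH s t), ← add_mul, ← mul_assoc]
  refine mul_le_mul_of_nonneg_right ?_ (phi_nonneg hH s t)
  rw [abs_mul, ← sq_abs x, ← sq_abs y]
  nlinarith [sq_nonneg (|x| - |y|)]

lemma integrable_sq_mul_phi_swap (hH : 1 / 2 < H) (hT : 0 ≤ T) (hf : MemLp f 2 (volT T)) :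
    Integrable (fun p : ℝ × ℝ => f p.2 ^ 2 * phi H p.1 p.2) ((volT T).prod (volT T)) := by
  refine (integrable_sq_mul_phi hH hT hf).swap.congr (ae_of_all _ fun p => ?_)
  simp [phi_comm H p.2]

/-- Schur's test: |f(s) f(t)| ≤ (f(s)² + f(t)²)/2, and φ has uniformly bounded marginals on [0,T].
-/
lemma memLp_two_mem_Hphi (hH : 1 / 2 < H) (hT : 0 ≤ T) (hf : MemLp f 2 (volT T)) :
    f ∈ Hphi H T := by
  refine ⟨hf.1, (((integrable_sq_mul_phi hH hT hf).add
    (integrable_sq_mul_phi_swap hH hT hf)).const_mul (1 / 2)).mono'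
    ((hf.1.comp_fst.mul hf.1.comp_snd).mul (measurable_phi H).aestronglyMeasurable)
    (ae_of_all _ fun p => abs_mul_mul_phi_le hH _ _ _ _)⟩

/-- The `𝓗_φ`-norm is dominated by the `L²`-norm. -/
lemma exists_phiInner_self_le (hH : 1 / 2 < H) (hH1 : H < 1) (hT : 0 ≤ T) :
    ∃ C : ℝ, 0 ≤ C ∧ ∀ f, MemLp f 2 (volT T) →
      phiInner H T f f ≤ C * ∫ s, f s ^ 2 ∂(volT T) := by
  obtain ⟨C, hC0, hC⟩ := exists_integral_phi_le hH hT
  refine ⟨C, hC0, fun f hf => ?_⟩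
  have hmem := memLp_two_mem_Hphi hH hT hf
  have h1 := integrable_sq_mul_phi hH hT hf
  have h2 := integrable_sq_mul_phi_swap hH hT hf
  have hswap : ∫ p : ℝ × ℝ, f p.2 ^ 2 * phi H p.1 p.2 ∂((volT T).prod (volT T)) =
      ∫ p : ℝ × ℝ, f p.1 ^ 2 * phi H p.1 p.2 ∂((volT T).prod (volT T)) := by
    rw [← integral_prod_swap]
    simp [phi_comm H]
  have h3 : ∫ p : ℝ × ℝ, f p.1 ^ 2 * phi H p.1 p.2 ∂((volT T).prod (volT T)) ≤
      C * ∫ s, f s ^ 2 ∂(volT T) := by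
    rw [integral_prod _ h1]
    simp only [integral_const_mul]
    rw [← integral_const_mul]
    refine integral_mono_ae ?_ (hf.integrable_sq.const_mul C) ?_
    · simpa only [integral_const_mul] using h1.integral_prod_left
    filter_upwards [ae_restrict_mem measurableSet_Icc] with s hs
    rw [mul_comm]
    exact mul_le_mul_of_nonneg_right (hC s hs) (sq_nonneg _)
  rw [phiInner_eq_integral_prod hH hH1 hT hmem hmem]
  calc ∫ p : ℝ × ℝ, f p.1 * f p.2 * phi H p.1 p.2 ∂((volT T).prod (volT T))
      ≤ ∫ p : ℝ × ℝ, (1 / 2) * (f p.1 ^ 2 * phi H p.1 p.2 + f p.2 ^ 2 * phi H p.1 p.2)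
          ∂((volT T).prod (volT T)) :=
        integral_mono hmem.2 ((h1.add h2).const_mul _)
          fun p => (le_abs_self _).trans (abs_mul_mul_phi_le hH _ _ _ _)
    _ = ∫ p : ℝ × ℝ, f p.1 ^ 2 * phi H p.1 p.2 ∂((volT T).prod (volT T)) := by
        rw [integral_const_mul, integral_add h1 h2, hswap]; ring
    _ ≤ _ := h3

lemma memLp_indicator_Icc (T t : ℝ) :
    MemLp ((Icc (0 : ℝ) t).indicator fun _ => (1 : ℝ)) 2 (volT T) :=
  memLp_indicator_const 2 measurableSet_Icc 1 (Or.inr (by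
    exact (measure_lt_top _ _).ne))

lemma indicator_mem_Hphi (hH : 1 / 2 < H) (hT : 0 ≤ T) (t : ℝ) :
    ((Icc (0 : ℝ) t).indicator fun _ => (1 : ℝ)) ∈ Hphi H T :=
  memLp_two_mem_Hphi hH hT (memLp_indicator_Icc T t)

lemma intervalIntegral_indicator_mul {r t : ℝ} (hr : 0 ≤ r) (hrt : r ≤ t) (ht : t ≤ T)
    (σ g : ℝ → ℝ) :
    ∫ s in (0 : ℝ)..T, (Icc r t).indicator σ s * g s = ∫ s in r..t, σ s * g s := by
  rw [intervalIntegral_eq_volT (hr.trans (hrt.trans ht)), intervalIntegral.integral_of_le hrt,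
    ← integral_Icc_eq_integral_Ioc]
  have h1 : (fun s => (Icc r t).indicator σ s * g s) = (Icc r t).indicator fun s => σ s * g s := by
    ext s; by_cases hs : s ∈ Icc r t <;> simp [hs]
  rw [h1, integral_indicator measurableSet_Icc, Measure.restrict_restrict measurableSet_Icc,
    inter_eq_left.2 (Icc_subset_Icc hr ht)]

lemma phiInner_eq_integral_mul_Phi (f g : ℝ → ℝ) :
    phiInner H T f g = ∫ s in (0 : ℝ)..T, f s * Phi H T g s := by
  simp only [phiInner, Phi, mul_assoc, intervalIntegral.integral_const_mul]

/-- The inner product with a restricted function as an integral of `Φ`. -/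
lemma phiInner_indicator {r t : ℝ} (hr : 0 ≤ r) (hrt : r ≤ t) (ht : t ≤ T) (σ g : ℝ → ℝ) :
    phiInner H T ((Icc r t).indicator σ) g = ∫ s in r..t, σ s * Phi H T g s := by
  rw [phiInner_eq_integral_mul_Phi, intervalIntegral_indicator_mul hr hrt ht]

/-- Split at the singularity v = u and integrate the power on each side; the boundary terms at the
singularity vanish because 2H - 1 > 0. -/
lemma integral_phi_of_mem (hH : 1 / 2 < H) {u t : ℝ} (hu : 0 ≤ u) (hut : u ≤ t) :
    ∫ v in (0 : ℝ)..t, phi H u v = H * (u ^ (2 * H - 1) + (t - u) ^ (2 * H - 1)) := by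
  have hint : ∀ a b, IntervalIntegrable (fun v => phi H u v) volume a b := fun a b => by
    simpa only [phi_comm H u] using intervalIntegrable_phi hH u a b
  have h2 : (2 * H - 2 + 1) = 2 * H - 1 := by ring
  have h3 : 2 * H - 1 ≠ 0 := by linarith
  rw [← intervalIntegral.integral_add_adjacent_intervals (hint 0 u) (hint u t)]
  have e1 : ∫ v in (0 : ℝ)..u, phi H u v = H * u ^ (2 * H - 1) := by
    have : ∫ v in (0 : ℝ)..u, phi H u v =
        ∫ v in (0 : ℝ)..u, H * (2 * H - 1) * (u - v) ^ (2 * H - 2) := by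
      refine intervalIntegral.integral_congr fun v hv => ?_
      rw [uIcc_of_le hu] at hv
      simp only [phi, abs_of_nonneg (sub_nonneg.2 hv.2)]
    rw [this, intervalIntegral.integral_const_mul,
      intervalIntegral.integral_comp_sub_left (fun x => x ^ (2 * H - 2)), sub_self, sub_zero,
      integral_rpow (Or.inl (by linarith)), h2, Real.zero_rpow h3]
    rw [sub_zero, mul_assoc, mul_comm (2 * H - 1), div_mul_cancel₀ _ h3]
  have e2 : ∫ v in u..t, phi H u v = H * (t - u) ^ (2 * H - 1) := by
    have : ∫ v in u..t, phi H u v =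
        ∫ v in u..t, H * (2 * H - 1) * (v - u) ^ (2 * H - 2) := by
      refine intervalIntegral.integral_congr fun v hv => ?_
      rw [uIcc_of_le hut] at hv
      simp only [phi, abs_of_nonpos (sub_nonpos.2 hv.1), neg_sub]
    rw [this, intervalIntegral.integral_const_mul,
      intervalIntegral.integral_comp_sub_right (fun x => x ^ (2 * H - 2)), sub_self,
      integral_rpow (Or.inl (by linarith)), h2, Real.zero_rpow h3]
    rw [sub_zero, mul_assoc, mul_comm (2 * H - 1), div_mul_cancel₀ _ h3]
  rw [e1, e2]; ring

lemma phiInner_indicator_indicator_of_le (hH : 1 / 2 < H) {s t : ℝ}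
    (hs : 0 ≤ s) (hst : s ≤ t) (ht : t ≤ T) :
    phiInner H T ((Icc 0 s).indicator fun _ => (1 : ℝ)) ((Icc 0 t).indicator fun _ => (1 : ℝ)) =
      (1 / 2) * (t ^ (2 * H) + s ^ (2 * H) - |t - s| ^ (2 * H)) := by
  rw [phiInner_indicator le_rfl hs (hst.trans ht)]
  have h1 : ∀ u ∈ uIcc 0 s, (1 : ℝ) * Phi H T ((Icc 0 t).indicator fun _ => (1 : ℝ)) u =
      H * u ^ (2 * H - 1) + H * (t - u) ^ (2 * H - 1) := by
    intro u hu
    rw [uIcc_of_le hs] at hu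
    rw [one_mul, Phi, intervalIntegral_indicator_mul le_rfl (hs.trans hst) ht]
    simp only [one_mul]
    rw [integral_phi_of_mem hH hu.1 (hu.2.trans hst)]
    ring
  have i1 : ∀ a b : ℝ, IntervalIntegrable (fun u : ℝ => u ^ (2 * H - 1)) volume a b := fun a b =>
    intervalIntegral.intervalIntegrable_rpow' (by linarith)
  have i2 : IntervalIntegrable (fun u : ℝ => (t - u) ^ (2 * H - 1)) volume 0 s := by
    have := (i1 t (t - s)).comp_sub_left t
    simpa using this
  have h2 : (2 * H - 1 + 1) = 2 * H := by ring
  have h3 : 2 * H ≠ 0 := by linarith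
  have h4 : H ≠ 0 := by linarith
  rw [intervalIntegral.integral_congr h1, intervalIntegral.integral_add ((i1 0 s).const_mul _)
    (i2.const_mul _), intervalIntegral.integral_const_mul, intervalIntegral.integral_const_mul,
    intervalIntegral.integral_comp_sub_left (fun x => x ^ (2 * H - 1)),
    integral_rpow (Or.inl (by linarith)), integral_rpow (Or.inl (by linarith)), h2,
    Real.zero_rpow h3, abs_of_nonneg (sub_nonneg.2 hst)]
  field_simp
  ring_nf

/-- The inner products of the functions `χ_{[0,t]}` are the covariances of fractional Brownian
motion. -/
lemma phiInner_indicator_indicator (hH : 1 / 2 < H) (hH1 : H < 1) {s t : ℝ}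
    (hs : s ∈ Icc 0 T) (ht : t ∈ Icc 0 T) :
    phiInner H T ((Icc 0 s).indicator fun _ => (1 : ℝ)) ((Icc 0 t).indicator fun _ => (1 : ℝ)) =
      (1 / 2) * (t ^ (2 * H) + s ^ (2 * H) - |t - s| ^ (2 * H)) := by
  have hT : 0 ≤ T := hs.1.trans hs.2
  rcases le_total s t with h | h
  · exact phiInner_indicator_indicator_of_le hH hs.1 h ht.2
  · rw [phiInner_comm hH hH1 hT (indicator_mem_Hphi hH hT s) (indicator_mem_Hphi hH hT t),
      phiInner_indicator_indicator_of_le hH ht.1 h hs.2, abs_sub_comm, add_comm (s ^ (2 * H))]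

lemma stepFun_eq_sum (g : Icc (0 : ℝ) T →₀ ℝ) :
    stepFun g = ∑ t ∈ g.support, g t • (Icc (0 : ℝ) (t : ℝ)).indicator fun _ => (1 : ℝ) := by
  ext s
  simp [stepFun, Finsupp.sum, Finset.sum_apply]

lemma memLp_stepFun (g : Icc (0 : ℝ) T →₀ ℝ) : MemLp (stepFun g) 2 (volT T) := by
  rw [stepFun_eq_sum]
  exact memLp_finsetSum' _ fun t _ => (memLp_indicator_Icc T t).const_smul _

lemma stepFun_mem_Hphi (hH : 1 / 2 < H) (hT : 0 ≤ T) (g : Icc (0 : ℝ) T →₀ ℝ) :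
    stepFun g ∈ Hphi H T :=
  memLp_two_mem_Hphi hH hT (memLp_stepFun g)

lemma stepFun_add (g g' : Icc (0 : ℝ) T →₀ ℝ) : stepFun (g + g') = stepFun g + stepFun g' := by
  ext s
  simp only [stepFun, Pi.add_apply]
  exact Finsupp.sum_add_index' (by simp) (by intros; ring)

lemma stepFun_smul (r : ℝ) (g : Icc (0 : ℝ) T →₀ ℝ) : stepFun (r • g) = r • stepFun g := by
  ext s
  simp only [stepFun, Pi.smul_apply]
  rw [Finsupp.sum_smul_index (by simp), Finsupp.sum, Finsupp.sum, smul_eq_mul, Finset.mul_sum]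
  exact Finset.sum_congr rfl fun _ _ => by ring

lemma stepFun_sub (g g' : Icc (0 : ℝ) T →₀ ℝ) : stepFun (g - g') = stepFun g - stepFun g' := by
  rw [sub_eq_add_neg, ← neg_one_smul ℝ g', stepFun_add, stepFun_smul, neg_one_smul,
    ← sub_eq_add_neg]

lemma stepInt_add {d : ℕ} (i : Fin d) (g g' : Icc (0 : ℝ) T →₀ ℝ) :
    stepInt i (g + g') = stepInt i g + stepInt i g' := by
  ext s
  simp only [stepInt, Pi.add_apply]
  exact Finsupp.sum_add_index' (by simp) (by intros; ring)

lemma stepInt_smul {d : ℕ} (i : Fin d) (r : ℝ) (g : Icc (0 : ℝ) T →₀ ℝ) :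
    stepInt i (r • g) = r • stepInt i g := by
  ext s
  simp only [stepInt, Pi.smul_apply]
  rw [Finsupp.sum_smul_index (by simp), Finsupp.sum, Finsupp.sum, smul_eq_mul, Finset.mul_sum]
  exact Finset.sum_congr rfl fun _ _ => by ring

lemma stepInt_sub {d : ℕ} (i : Fin d) (g g' : Icc (0 : ℝ) T →₀ ℝ) :
    stepInt i (g - g') = stepInt i g - stepInt i g' := by
  rw [sub_eq_add_neg, ← neg_one_smul ℝ g', stepInt_add, stepInt_smul, neg_one_smul,
    ← sub_eq_add_neg]

end StepFunctions

end WongZakai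

/-! ### Density of step functions. -/

namespace WongZakai

section Density

variable {H T : ℝ} {f : ℝ → ℝ}

/-- By Lebesgue differentiation h is almost everywhere the derivative of its primitive, which
vanishes on [0,T]. -/
lemma ae_eq_zero_of_forall_integral_Icc {h : ℝ → ℝ} (hT : 0 ≤ T) (hh : Integrable h (volT T))
    (h0 : ∀ t ∈ Icc 0 T, ∫ s in (0 : ℝ)..t, h s = 0) : h =ᵐ[volT T] 0 := by
  have hi : IntervalIntegrable h volume 0 T :=
    (intervalIntegrable_iff_integrableOn_Icc_of_le hT).2 hh
  have h1 := hi.ae_hasDerivAt_integral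
  rw [uIcc_of_le hT] at h1
  have e0 : ∀ᵐ v : ℝ, v ≠ 0 := by simp [ae_iff]
  have eT : ∀ᵐ v : ℝ, v ≠ T := by simp [ae_iff]
  refine (ae_restrict_iff' measurableSet_Icc).2 ?_
  filter_upwards [h1, e0, eT] with x hx hx0 hxT hxm
  have h2 := hx hxm 0 ⟨le_rfl, hT⟩
  have hmem : Icc 0 T ∈ 𝓝 x :=
    Icc_mem_nhds (lt_of_le_of_ne hxm.1 (Ne.symm hx0)) (lt_of_le_of_ne hxm.2 hxT)
  have h3 : HasDerivAt (fun x => ∫ t in (0 : ℝ)..x, h t) 0 x :=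
    (hasDerivAt_const x (0 : ℝ)).congr_of_eventuallyEq (by
      filter_upwards [hmem] with y hy using h0 y hy)
  exact h2.unique h3

/-- Step functions are dense in `L²([0,T])`. -/
lemma exists_stepFun_integral_sq_lt (hT : 0 ≤ T) (hf : MemLp f 2 (volT T)) {ε : ℝ} (hε : 0 < ε) :
    ∃ g : Icc (0 : ℝ) T →₀ ℝ, ∫ s, (f s - stepFun g s) ^ 2 ∂(volT T) < ε := by
  let S : Submodule ℝ (Lp ℝ 2 (volT T)) :=
    { carrier := {x | ∃ g : Icc (0 : ℝ) T →₀ ℝ, x = (memLp_stepFun g).toLp _}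
      add_mem' := by
        rintro _ _ ⟨g, rfl⟩ ⟨g', rfl⟩
        refine ⟨g + g', ?_⟩
        rw [← MemLp.toLp_add, MemLp.toLp_eq_toLp_iff, stepFun_add]
      zero_mem' := ⟨0, by
        rw [← MemLp.toLp_zero (MemLp.zero' (ε := ℝ)), MemLp.toLp_eq_toLp_iff]
        exact ae_of_all _ fun s => by simp [stepFun]⟩
      smul_mem' := by
        rintro r _ ⟨g, rfl⟩
        refine ⟨r • g, ?_⟩
        rw [← MemLp.toLp_const_smul, MemLp.toLp_eq_toLp_iff, stepFun_smul] }
  -- Orthogonality to the indicators of all [0,t] says that every primitive vanishes, so the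
  -- orthogonal complement is trivial.
  have hS : S.topologicalClosure = ⊤ := by
    rw [Submodule.topologicalClosure_eq_top_iff, Submodule.eq_bot_iff]
    intro h hh
    rw [Submodule.mem_orthogonal] at hh
    have hhi : Integrable h (volT T) := (Lp.memLp h).integrable (by norm_num)
    have h1 := ae_eq_zero_of_forall_integral_Icc hT hhi fun t ht => by
      have h2 := hh _ ⟨Finsupp.single ⟨t, ht⟩ 1, rfl⟩
      rw [L2.inner_def] at h2
      have h3 : ∫ s, inner ℝ ((memLp_stepFun (Finsupp.single (⟨t, ht⟩ : Icc (0 : ℝ) T)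
          (1 : ℝ))).toLp _ s) (h s) ∂(volT T) =
          ∫ s, (Icc (0 : ℝ) t).indicator (fun _ => (1 : ℝ)) s * h s ∂(volT T) := by
        refine integral_congr_ae ?_
        filter_upwards [MemLp.coeFn_toLp (memLp_stepFun (Finsupp.single (⟨t, ht⟩ : Icc (0 : ℝ) T)
          (1 : ℝ)))] with s hs
        rw [hs]
        simp [stepFun, mul_comm]
      rw [h3, ← intervalIntegral_eq_volT hT, intervalIntegral_indicator_mul le_rfl ht.1 ht.2] at h2
      simpa using h2
    exact Lp.eq_zero_iff_ae_eq_zero.2 h1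
  have hmem : hf.toLp f ∈ closure (S : Set (Lp ℝ 2 (volT T))) := by
    rw [← Submodule.topologicalClosure_coe, hS]
    trivial
  obtain ⟨_, ⟨g, rfl⟩, hg⟩ := Metric.mem_closure_iff.1 hmem (Real.sqrt ε) (Real.sqrt_pos.2 hε)
  refine ⟨g, ?_⟩
  rw [dist_eq_norm, ← MemLp.toLp_sub] at hg
  have h2 : MemLp (f - stepFun g) 2 (volT T) := hf.sub (memLp_stepFun g)
  have h3 : ‖h2.toLp (f - stepFun g)‖ ^ 2 = ∫ s, (f s - stepFun g s) ^ 2 ∂(volT T) := by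
    rw [← real_inner_self_eq_norm_sq, L2.inner_def]
    refine integral_congr_ae ?_
    filter_upwards [h2.coeFn_toLp] with s hs
    rw [hs]
    simp [sq]
  rw [← h3, ← Real.sq_sqrt hε.le]
  exact pow_lt_pow_left₀ hg (norm_nonneg _) two_ne_zero

/-- The part of `f` where `|f| ≤ n`. -/
noncomputable def truncAt (n : ℕ) (f : ℝ → ℝ) (s : ℝ) : ℝ := if |f s| ≤ n then f s else 0

lemma memLp_truncAt (hf : AEStronglyMeasurable f (volT T)) (n : ℕ) :
    MemLp (truncAt n f) 2 (volT T) := by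
  have hm : Measurable fun x : ℝ => if |x| ≤ (n : ℝ) then x else 0 :=
    Measurable.ite (measurableSet_le (by fun_prop) (by fun_prop)) measurable_id measurable_const
  refine MemLp.of_bound (hm.comp_aemeasurable hf.aemeasurable).aestronglyMeasurable n
    (ae_of_all _ fun s => ?_)
  simp only [truncAt]
  split_ifs with h
  · exact h
  · simp

/-- Dominated convergence with majorant |f(s) f(t) φ(s,t)|; at each point the remainder is zero from
some n on. This reduces density in 𝓗_φ to density in L². -/
lemma tendsto_phiInner_sub_truncAt (hH : 1 / 2 < H) (hH1 : H < 1) (hT : 0 ≤ T)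
    (hf : f ∈ Hphi H T) :
    Tendsto (fun n => phiInner H T (f - truncAt n f) (f - truncAt n f)) atTop (𝓝 0) := by
  have hm : ∀ n, f - truncAt n f ∈ Hphi H T := fun n =>
    sub_mem_Hphi hH hH1 hf (memLp_two_mem_Hphi hH hT (memLp_truncAt hf.1 n))
  simp only [fun n => phiInner_eq_integral_prod hH hH1 hT (hm n) (hm n)]
  have hle : ∀ n s, |(f - truncAt n f) s| ≤ |f s| := by
    intro n s
    simp only [Pi.sub_apply, truncAt]
    split_ifs <;> simp
  have hz : Tendsto (fun n => ∫ p : ℝ × ℝ, (f - truncAt n f) p.1 * (f - truncAt n f) p.2 *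
      phi H p.1 p.2 ∂((volT T).prod (volT T))) atTop
      (𝓝 (∫ _ : ℝ × ℝ, (0 : ℝ) ∂((volT T).prod (volT T)))) := by
    refine tendsto_integral_of_dominated_convergence
      (fun p : ℝ × ℝ => ‖f p.1 * f p.2 * phi H p.1 p.2‖) (fun n => (hm n).2.1) hf.2.norm
      (fun n => ae_of_all _ fun p => ?_) (ae_of_all _ fun p => ?_)
    · simp only [norm_mul, Real.norm_eq_abs]
      have h1 := hle n p.1
      have h2 := hle n p.2
      gcongr
    · refine tendsto_const_nhds.congr' ?_
      obtain ⟨N, hN⟩ := exists_nat_ge |f p.1|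
      filter_upwards [eventually_ge_atTop N] with n hn
      have : |f p.1| ≤ n := hN.trans (by exact_mod_cast hn)
      simp [truncAt, this]
  simpa using hz

/-- Step functions are dense in `𝓗_φ`. -/
theorem exists_stepFun_phiNorm_lt (hH : 1 / 2 < H) (hH1 : H < 1) (hT : 0 ≤ T)
    (hf : f ∈ Hphi H T) {ε : ℝ} (hε : 0 < ε) :
    ∃ g : Icc (0 : ℝ) T →₀ ℝ, phiNorm H T (f - stepFun g) < ε := by
  have hm : ∀ n, truncAt n f ∈ Hphi H T := fun n =>
    memLp_two_mem_Hphi hH hT (memLp_truncAt hf.1 n)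
  obtain ⟨n, hn⟩ := ((tendsto_phiInner_sub_truncAt hH hH1 hT hf).eventually
    (gt_mem_nhds (by positivity : 0 < (ε / 2) ^ 2))).exists
  obtain ⟨C, hC0, hC⟩ := exists_phiInner_self_le (T := T) hH hH1 hT
  -- The norm is a square root, hence the squared tolerance; C + 1 avoids division by zero.
  obtain ⟨g, hg⟩ := exists_stepFun_integral_sq_lt hT (memLp_truncAt hf.1 n)
    (by positivity : 0 < (ε / 2) ^ 2 / (C + 1))
  refine ⟨g, ?_⟩
  have h1 : phiNorm H T (f - truncAt n f) < ε / 2 := by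
    rw [phiNorm, Real.sqrt_lt' (by positivity)]; exact hn
  have h2 : phiNorm H T (truncAt n f - stepFun g) < ε / 2 := by
    rw [phiNorm, Real.sqrt_lt' (by positivity)]
    refine (hC _ ((memLp_truncAt hf.1 n).sub (memLp_stepFun g))).trans_lt ?_
    rw [lt_div_iff₀ (by positivity)] at hg
    have h3 : 0 ≤ ∫ s, (truncAt n f s - stepFun g s) ^ 2 ∂(volT T) :=
      integral_nonneg fun _ => sq_nonneg _
    simp only [Pi.sub_apply]
    nlinarith
  have h3 := phiNorm_add_le hH hH1 hT (sub_mem_Hphi hH hH1 hf (hm n))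
    (sub_mem_Hphi hH hH1 (hm n) (stepFun_mem_Hphi hH hT g))
  rw [sub_add_sub_cancel] at h3
  linarith

end Density

end WongZakai

/-! ### Mean square limits of Gaussian variables. -/

namespace WongZakai

section L2

variable {Ω : Type*} [MeasurableSpace Ω] {P : Measure Ω}

lemma integral_mul_eq_inner_toLp {X Y : Ω → ℝ} (hX : MemLp X 2 P) (hY : MemLp Y 2 P) :
    ∫ ω, X ω * Y ω ∂P = inner ℝ (hX.toLp X) (hY.toLp Y) := by
  rw [L2.inner_def]
  refine integral_congr_ae ?_
  filter_upwards [hX.coeFn_toLp, hY.coeFn_toLp] with ω h1 h2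
  rw [h1, h2]
  simp [mul_comm]

lemma tendsto_integral_mul_of_tendsto_eLpNorm {ι : Type*} {l : Filter ι} {X Y : ι → Ω → ℝ}
    {X' Y' : Ω → ℝ}
    (hX : ∀ n, MemLp (X n) 2 P) (hY : ∀ n, MemLp (Y n) 2 P) (hX' : MemLp X' 2 P)
    (hY' : MemLp Y' 2 P) (h1 : Tendsto (fun n => eLpNorm (X n - X') 2 P) l (𝓝 0))
    (h2 : Tendsto (fun n => eLpNorm (Y n - Y') 2 P) l (𝓝 0)) :
    Tendsto (fun n => ∫ ω, X n ω * Y n ω ∂P) l (𝓝 (∫ ω, X' ω * Y' ω ∂P)) := by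
  rw [integral_mul_eq_inner_toLp hX' hY']
  simp_rw [fun n => integral_mul_eq_inner_toLp (hX n) (hY n)]
  exact ((Lp.tendsto_Lp_iff_tendsto_eLpNorm'' X hX X' hX').2 h1).inner
    ((Lp.tendsto_Lp_iff_tendsto_eLpNorm'' Y hY Y' hY').2 h2)

lemma eLpNorm_two_eq_sqrt {X : Ω → ℝ} (hX : MemLp X 2 P) :
    eLpNorm X 2 P = ENNReal.ofReal (Real.sqrt (∫ ω, X ω * X ω ∂P)) := by
  rw [integral_mul_eq_inner_toLp hX hX, real_inner_self_eq_norm_sq,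
    Real.sqrt_sq (norm_nonneg _), Lp.norm_toLp, ENNReal.ofReal_toReal hX.2.ne]

/-- A mean square limit of centred Gaussian variables is centred Gaussian. -/
lemma map_eq_gaussianReal_of_tendsto [IsProbabilityMeasure P] {X : ℕ → Ω → ℝ} {Y : Ω → ℝ}
    (hX : ∀ n, MemLp (X n) 2 P) (hY : MemLp Y 2 P)
    (hg : ∀ n, P.map (X n) = gaussianReal 0 (∫ ω, X n ω * X n ω ∂P).toNNReal)
    (h : Tendsto (fun n => eLpNorm (X n - Y) 2 P) atTop (𝓝 0)) :
    P.map Y = gaussianReal 0 (∫ ω, Y ω * Y ω ∂P).toNNReal := by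
  -- Along an almost surely convergent subsequence the characteristic functions converge by
  -- dominated convergence. The variances converge by mean square convergence, and the Gaussian
  -- formula is continuous in the variance.
  obtain ⟨ns, hns, hae⟩ := (tendstoInMeasure_of_tendsto_eLpNorm two_ne_zero
    (fun n => (hX n).1) hY.1 h).exists_seq_tendsto_ae
  have hv := ((tendsto_integral_mul_of_tendsto_eLpNorm hX hX hY hY h h).comp hns.tendsto_atTop)
  have : IsProbabilityMeasure (P.map Y) := Measure.isProbabilityMeasure_map hY.1.aemeasurable
  refine Measure.ext_of_charFun (funext fun t => ?_)
  have e1 : ∀ Z : Ω → ℝ, AEStronglyMeasurable Z P →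
      charFun (P.map Z) t = ∫ ω, Complex.exp (t * Z ω * Complex.I) ∂P := by
    intro Z hZ
    rw [charFun_apply_real, integral_map hZ.aemeasurable (by fun_prop)]
  have hl : Tendsto (fun i => charFun (P.map (X (ns i))) t) atTop (𝓝 (charFun (P.map Y) t)) := by
    rw [e1 Y hY.1]
    simp_rw [fun i => e1 (X (ns i)) (hX _).1]
    refine tendsto_integral_of_dominated_convergence (fun _ => (1 : ℝ)) (fun n => ?_)
      (integrable_const _) (fun n => ae_of_all _ fun ω => ?_) ?_
    · have hm : Continuous fun x : ℝ => Complex.exp (t * x * Complex.I) := by fun_prop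
      exact hm.comp_aestronglyMeasurable (hX _).1
    · rw [← Complex.ofReal_mul, Complex.norm_exp_ofReal_mul_I]
    · filter_upwards [hae] with ω hω
      have hm : Continuous fun x : ℝ => Complex.exp (t * x * Complex.I) := by fun_prop
      exact (hm.tendsto _).comp hω
  refine tendsto_nhds_unique hl ?_
  simp_rw [hg, charFun_gaussianReal]
  have hc : Continuous fun v : ℝ => Complex.exp (t * ((0 : ℝ) : ℂ) * Complex.I
      - ((v.toNNReal : ℝ) : ℂ) * t ^ 2 / 2) := by fun_prop
  exact (hc.tendsto _).comp hv

end L2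

variable {H T : ℝ} {d : ℕ} {P : Measure (PathSpace T d)}

lemma continuous_coord (t : Icc (0 : ℝ) T) (i : Fin d) :
    Continuous (coord t i : PathSpace T d → ℝ) := by
  unfold coord
  fun_prop

lemma measurable_coord (t : Icc (0 : ℝ) T) (i : Fin d) :
    Measurable (coord t i : PathSpace T d → ℝ) := (continuous_coord t i).measurable

/-- The finite linear combination `∑ a_{t,i} B_i(t)` of coordinates. -/
noncomputable def coordComb (a : Icc (0 : ℝ) T × Fin d →₀ ℝ) (ω : PathSpace T d) : ℝ :=
  a.sum fun q r => r * coord q.1 q.2 ω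

lemma measurable_coordComb (a : Icc (0 : ℝ) T × Fin d →₀ ℝ) : Measurable (coordComb a) :=
  Finset.measurable_sum _ fun q _ => (measurable_coord q.1 q.2).const_mul _

lemma coordComb_add (a a' : Icc (0 : ℝ) T × Fin d →₀ ℝ) :
    coordComb (a + a') = coordComb a + coordComb a' := by
  classical
  ext ω
  exact Finsupp.sum_add_index (by simp) (by intros; ring)

lemma coordComb_smul (r : ℝ) (a : Icc (0 : ℝ) T × Fin d →₀ ℝ) :
    coordComb (r • a) = r • coordComb a := by
  ext ω
  simp only [coordComb, Pi.smul_apply, smul_eq_mul]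
  rw [Finsupp.sum_smul_index (by simp), Finsupp.mul_sum]
  simp only [mul_assoc]

lemma coordComb_single (t : Icc (0 : ℝ) T) (i : Fin d) :
    coordComb (Finsupp.single (t, i) 1) = coord t i := by
  ext ω
  simp [coordComb]

lemma stepInt_eq_coordComb (i : Fin d) (g : Icc (0 : ℝ) T →₀ ℝ) :
    stepInt i g = coordComb (g.mapDomain fun t => (t, i)) := by
  ext ω
  simp only [stepInt, coordComb]
  rw [Finsupp.sum_mapDomain_index (fun _ => zero_mul _) (fun _ _ _ => add_mul _ _ _)]

lemma coordComb_sub_path (a : Icc (0 : ℝ) T × Fin d →₀ ℝ) (ω η : PathSpace T d) :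
    coordComb a (ω - η) = coordComb a ω - coordComb a η := by
  simp only [coordComb, Finsupp.sum, ← Finset.sum_sub_distrib]
  refine Finset.sum_congr rfl fun q _ => ?_
  rw [← mul_sub]
  rfl

namespace IsFBM

lemma isProbabilityMeasure (hP : IsFBM H T d P) : IsProbabilityMeasure P :=
  hP.gaussian.isProbabilityMeasure

lemma hasGaussianLaw_coordComb (hP : IsFBM H T d P) (a : Icc (0 : ℝ) T × Fin d →₀ ℝ) :
    HasGaussianLaw (coordComb a) P :=
  (hP.gaussian.smul (fun q => a q)).hasGaussianLaw_fun_sum (I := a.support)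

lemma memLp_coordComb (hP : IsFBM H T d P) (a : Icc (0 : ℝ) T × Fin d →₀ ℝ) :
    MemLp (coordComb a) 2 P := (hP.hasGaussianLaw_coordComb a).memLp_two

lemma integral_coordComb (hP : IsFBM H T d P) (a : Icc (0 : ℝ) T × Fin d →₀ ℝ) :
    ∫ ω, coordComb a ω ∂P = 0 := by
  simp only [coordComb, Finsupp.sum]
  rw [integral_finsetSum]
  · simp [integral_const_mul, hP.mean]
  · exact fun q _ => (hP.gaussian.hasGaussianLaw_eval q).integrable.const_mul _

lemma map_coordComb (hP : IsFBM H T d P) (a : Icc (0 : ℝ) T × Fin d →₀ ℝ) :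
    P.map (coordComb a) = gaussianReal 0 (∫ ω, coordComb a ω * coordComb a ω ∂P).toNNReal := by
  have := hP.isProbabilityMeasure
  rw [(hP.hasGaussianLaw_coordComb a).map_eq_gaussianReal, hP.integral_coordComb,
    variance_of_integral_eq_zero (measurable_coordComb a).aemeasurable (hP.integral_coordComb a)]
  simp only [sq]

end IsFBM

/-- `Y` is a mean square limit of finite linear combinations of coordinates. -/
def IsCoordLimit (P : Measure (PathSpace T d)) (Y : PathSpace T d → ℝ) : Prop :=
  MemLp Y 2 P ∧ ∃ a : ℕ → (Icc (0 : ℝ) T × Fin d →₀ ℝ),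
    Tendsto (fun n => eLpNorm (coordComb (a n) - Y) 2 P) atTop (𝓝 0)

namespace IsFBM

lemma isCoordLimit_coordComb (hP : IsFBM H T d P) (a : Icc (0 : ℝ) T × Fin d →₀ ℝ) :
    IsCoordLimit P (coordComb a) :=
  ⟨hP.memLp_coordComb a, fun _ => a, by simp⟩

end IsFBM

namespace IsCoordLimit

variable {Y Z : PathSpace T d → ℝ}

/-- Joint Gaussianity enters through this closure property: a coordinate combination plus a Wiener
integral is again such a limit, hence Gaussian. The proof of Cameron–Martin depends on it. -/
lemma add (hP : IsFBM H T d P) (hY : IsCoordLimit P Y) (hZ : IsCoordLimit P Z) :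
    IsCoordLimit P (Y + Z) := by
  obtain ⟨hY, a, ha⟩ := hY
  obtain ⟨hZ, a', ha'⟩ := hZ
  refine ⟨hY.add hZ, fun n => a n + a' n, ?_⟩
  refine tendsto_of_tendsto_of_tendsto_of_le_of_le tendsto_const_nhds
    (by simpa using ha.add ha') (fun _ => zero_le) fun n => ?_
  have h : coordComb (a n + a' n) - (Y + Z) = (coordComb (a n) - Y) + (coordComb (a' n) - Z) := by
    rw [coordComb_add]; abel
  simp only [h]
  exact eLpNorm_add_le ((hP.memLp_coordComb _).sub hY).1 ((hP.memLp_coordComb _).sub hZ).1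
    (by norm_num)

lemma smul (r : ℝ) (hY : IsCoordLimit P Y) : IsCoordLimit P (r • Y) := by
  obtain ⟨hY, a, ha⟩ := hY
  refine ⟨hY.const_smul r, fun n => r • a n, ?_⟩
  have h : ∀ n, eLpNorm (coordComb (r • a n) - r • Y) 2 P
      = ‖r‖ₑ * eLpNorm (coordComb (a n) - Y) 2 P := by
    intro n
    rw [coordComb_smul, ← smul_sub, eLpNorm_const_smul]
  simp_rw [h]
  simpa using ENNReal.Tendsto.const_mul ha (Or.inr enorm_ne_top)

lemma map_eq (hP : IsFBM H T d P) (hY : IsCoordLimit P Y) :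
    P.map Y = gaussianReal 0 (∫ ω, Y ω * Y ω ∂P).toNNReal := by
  have := hP.isProbabilityMeasure
  obtain ⟨hY, a, ha⟩ := hY
  exact map_eq_gaussianReal_of_tendsto (fun n => hP.memLp_coordComb (a n)) hY
    (fun n => hP.map_coordComb (a n)) ha

lemma integrable_exp_mul (hP : IsFBM H T d P) (hY : IsCoordLimit P Y) (r : ℝ) :
    Integrable (fun ω => Real.exp (r * Y ω)) P := by
  have h := integrable_exp_mul_gaussianReal (μ := 0) (v := (∫ ω, Y ω * Y ω ∂P).toNNReal) r
  rw [← hY.map_eq hP] at h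
  exact h.comp_aemeasurable hY.1.1.aemeasurable

lemma mgf_eq (hP : IsFBM H T d P) (hY : IsCoordLimit P Y) (r : ℝ) :
    ∫ ω, Real.exp (r * Y ω) ∂P = Real.exp ((∫ ω, Y ω * Y ω ∂P) * r ^ 2 / 2) := by
  have h := mgf_gaussianReal (hY.map_eq hP) r
  rw [mgf] at h
  rw [h, Real.coe_toNNReal _ (integral_nonneg fun ω => mul_self_nonneg _)]
  simp

lemma integral_exp (hP : IsFBM H T d P) (hY : IsCoordLimit P Y) :
    ∫ ω, Real.exp (Y ω) ∂P = Real.exp ((∫ ω, Y ω * Y ω ∂P) / 2) := by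
  simpa using hY.mgf_eq hP 1

end IsCoordLimit

end WongZakai

/-! ### The fractional Wiener integral. -/

namespace WongZakai

variable {H T : ℝ} {d : ℕ} {P : Measure (PathSpace T d)} {f f' : ℝ → ℝ}

/-- Expand the difference bilinearly and apply Cauchy–Schwarz to each term. -/
lemma phiInner_continuous (hH : 1 / 2 < H) (hH1 : H < 1) (hT : 0 ≤ T) {g g' : ℕ → ℝ → ℝ}
    (hf : f ∈ Hphi H T) (hf' : f' ∈ Hphi H T) (hg : ∀ n, g n ∈ Hphi H T)
    (hg' : ∀ n, g' n ∈ Hphi H T) (h : Tendsto (fun n => phiNorm H T (f - g n)) atTop (𝓝 0))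
    (h' : Tendsto (fun n => phiNorm H T (f' - g' n)) atTop (𝓝 0)) :
    Tendsto (fun n => phiInner H T (g n) (g' n)) atTop (𝓝 (phiInner H T f f')) := by
  have hs := fun n => sub_mem_Hphi hH hH1 hf (hg n)
  have hs' := fun n => sub_mem_Hphi hH hH1 hf' (hg' n)
  have key : ∀ n, phiInner H T (g n) (g' n) - phiInner H T f f' =
      phiInner H T (f - g n) (f' - g' n) - phiInner H T f (f' - g' n)
        - phiInner H T (f - g n) f' := by
    intro n
    have e1 := phiInner_add_right hH hH1 hT (hg n) (hg' n) (hs' n)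
    have e2 := phiInner_sub_left hH hH1 hT hf (hg n) (hs' n)
    have e3 := phiInner_sub_left hH hH1 hT hf (hg n) hf'
    rw [add_sub_cancel] at e1
    linarith
  rw [tendsto_iff_dist_tendsto_zero]
  have hb : Tendsto (fun n => phiNorm H T (f - g n) * phiNorm H T (f' - g' n)
      + phiNorm H T f * phiNorm H T (f' - g' n) + phiNorm H T (f - g n) * phiNorm H T f')
      atTop (𝓝 0) := by
    have := ((h.mul h').add (h'.const_mul (phiNorm H T f))).add (h.mul_const (phiNorm H T f'))
    simpa using this
  refine squeeze_zero (fun _ => dist_nonneg) (fun n => ?_) hb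
  rw [Real.dist_eq, key]
  have a1 := abs_phiInner_le hH hH1 hT (hs n) (hs' n)
  have a2 := abs_phiInner_le hH hH1 hT hf (hs' n)
  have a3 := abs_phiInner_le hH hH1 hT (hs n) hf'
  refine (abs_sub _ _).trans ((add_le_add (abs_sub _ _) le_rfl).trans ?_)
  linarith

namespace IsFBM

lemma memLp_coord (hP : IsFBM H T d P) (t : Icc (0 : ℝ) T) (i : Fin d) :
    MemLp (coord t i) 2 P := (hP.gaussian.hasGaussianLaw_eval (t, i)).memLp_two

lemma memLp_stepInt (hP : IsFBM H T d P) (i : Fin d) (g : Icc (0 : ℝ) T →₀ ℝ) :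
    MemLp (stepInt i g) 2 P := by
  rw [stepInt_eq_coordComb]
  exact hP.memLp_coordComb _

/-- The isometry property of the elementary integral. -/
lemma integral_stepInt_mul_stepInt (hP : IsFBM H T d P) (hH : 1 / 2 < H) (hH1 : H < 1)
    (hT : 0 ≤ T) (i j : Fin d) (g g' : Icc (0 : ℝ) T →₀ ℝ) :
    ∫ ω, stepInt i g ω * stepInt j g' ω ∂P =
      if i = j then phiInner H T (stepFun g) (stepFun g') else 0 := by
  have h1 : ∀ ω, stepInt i g ω * stepInt j g' ω = ∑ s ∈ g.support, ∑ t ∈ g'.support,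
      (g s * g' t) * (coord s i ω * coord t j ω) := by
    intro ω
    simp only [stepInt, Finsupp.sum]
    rw [Finset.sum_mul_sum]
    exact Finset.sum_congr rfl fun _ _ => Finset.sum_congr rfl fun _ _ => by ring
  have hi : ∀ s t, Integrable (fun ω => (g s * g' t) * (coord s i ω * coord t j ω)) P :=
    fun s t => ((hP.memLp_coord s i).integrable_mul (hP.memLp_coord t j)).const_mul _
  simp_rw [h1]
  rw [integral_finsetSum _ fun s _ => integrable_finsetSum _ fun t _ => hi s t]
  simp_rw [fun s => integral_finsetSum g'.support (fun t _ => hi s t), integral_const_mul, hP.cov]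
  split_ifs with hij
  · have hs : ∀ (r : ℝ) (t : Icc (0 : ℝ) T),
        (r • (Icc 0 (t : ℝ)).indicator fun _ => (1 : ℝ)) ∈ Hphi H T :=
      fun r t => smul_mem_Hphi r (indicator_mem_Hphi hH hT t)
    rw [stepFun_eq_sum g, stepFun_eq_sum g', phiInner_sum_left hH hH1 hT _
      (fun k _ => hs (g k) k) (sum_mem_Hphi hH hH1 _ fun k _ => hs (g' k) k)]
    refine Finset.sum_congr rfl fun s _ => ?_
    rw [phiInner_sum_right hH hH1 hT _ (fun k _ => hs (g' k) k) (hs _ s)]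
    refine Finset.sum_congr rfl fun t _ => ?_
    rw [phiInner_smul_left, phiInner_smul_right, phiInner_indicator_indicator hH hH1 s.2 t.2,
      mul_assoc]
  · simp

end IsFBM

namespace IsWienerIntegral

variable {i j : Fin d} {I I' : PathSpace T d → ℝ}

lemma mem_Hphi (hH : 1 / 2 < H) (hH1 : H < 1) (hT : 0 ≤ T) (h : IsWienerIntegral H P i f I) :
    f ∈ Hphi H T := by
  obtain ⟨-, -, g, hg, -⟩ := h
  simpa using add_mem_Hphi hH hH1 (hg 0) (stepFun_mem_Hphi hH hT (g 0))

lemma isCoordLimit (h : IsWienerIntegral H P i f I) : IsCoordLimit P I := by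
  obtain ⟨-, hI, g, -, -, hg⟩ := h
  exact ⟨hI, fun n => (g n).mapDomain fun t => (t, i), by simpa only [← stepInt_eq_coordComb]⟩

/-- The isometry for step functions passes to the limit on both sides. It gives the variances of
Wiener integrals and their covariances with the coordinates. -/
lemma integral_mul (hP : IsFBM H T d P) (hH : 1 / 2 < H) (hH1 : H < 1) (hT : 0 ≤ T)
    (h : IsWienerIntegral H P i f I) (h' : IsWienerIntegral H P j f' I') :
    ∫ ω, I ω * I' ω ∂P = if i = j then phiInner H T f f' else 0 := by
  have hf := h.mem_Hphi hH hH1 hT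
  have hf' := h'.mem_Hphi hH hH1 hT
  obtain ⟨-, hI, g, -, hg, hgI⟩ := h
  obtain ⟨-, hI', g', -, hg', hgI'⟩ := h'
  have h1 := tendsto_integral_mul_of_tendsto_eLpNorm (fun n => hP.memLp_stepInt i (g n))
    (fun n => hP.memLp_stepInt j (g' n)) hI hI' hgI hgI'
  simp_rw [hP.integral_stepInt_mul_stepInt hH hH1 hT] at h1
  refine tendsto_nhds_unique h1 ?_
  split_ifs
  · exact phiInner_continuous hH hH1 hT hf hf' (fun n => stepFun_mem_Hphi hH hT _)
      (fun n => stepFun_mem_Hphi hH hT _) hg hg'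
  · exact tendsto_const_nhds

lemma of_stepFun (hP : IsFBM H T d P) (g : Icc (0 : ℝ) T →₀ ℝ) :
    IsWienerIntegral H P i (stepFun g) (stepInt i g) := by
  refine ⟨?_, hP.memLp_stepInt i g, fun _ => g, fun n => ?_, ?_, ?_⟩
  · rw [stepInt_eq_coordComb]; exact measurable_coordComb _
  · rw [sub_self]; exact zero_mem_Hphi
  · simp only [sub_self, phiNorm, phiInner_zero_left, Real.sqrt_zero]; exact tendsto_const_nhds
  · simp

lemma add (hP : IsFBM H T d P) (hH : 1 / 2 < H) (hH1 : H < 1) (hT : 0 ≤ T)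
    (h : IsWienerIntegral H P i f I) (h' : IsWienerIntegral H P i f' I') :
    IsWienerIntegral H P i (f + f') (I + I') := by
  obtain ⟨hm, hI, g, hgm, hg, hgI⟩ := h
  obtain ⟨hm', hI', g', hgm', hg', hgI'⟩ := h'
  have e1 : ∀ n, f + f' - stepFun (g n + g' n) = (f - stepFun (g n)) + (f' - stepFun (g' n)) := by
    intro n; rw [stepFun_add]; abel
  have e2 : ∀ n, stepInt i (g n + g' n) - (I + I') = (stepInt i (g n) - I)
      + (stepInt i (g' n) - I') := by
    intro n; rw [stepInt_add]; abel
  refine ⟨hm.add hm', hI.add hI', fun n => g n + g' n, fun n => ?_, ?_, ?_⟩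
  · rw [e1]; exact add_mem_Hphi hH hH1 (hgm n) (hgm' n)
  · simp_rw [e1]
    exact squeeze_zero (fun n => phiNorm_nonneg _ _ _)
      (fun n => phiNorm_add_le hH hH1 hT (hgm n) (hgm' n)) (by simpa using hg.add hg')
  · simp_rw [e2]
    refine tendsto_of_tendsto_of_tendsto_of_le_of_le tendsto_const_nhds
      (by simpa using hgI.add hgI') (fun _ => zero_le) fun n => ?_
    exact eLpNorm_add_le ((hP.memLp_stepInt _ _).sub hI).1 ((hP.memLp_stepInt _ _).sub hI').1
      (by norm_num)

lemma smul (r : ℝ) (h : IsWienerIntegral H P i f I) :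
    IsWienerIntegral H P i (r • f) (r • I) := by
  obtain ⟨hm, hI, g, hgm, hg, hgI⟩ := h
  have e1 : ∀ n, r • f - stepFun (r • g n) = r • (f - stepFun (g n)) := by
    intro n; rw [stepFun_smul, smul_sub]
  have e2 : ∀ n, stepInt i (r • g n) - r • I = r • (stepInt i (g n) - I) := by
    intro n; rw [stepInt_smul, smul_sub]
  refine ⟨hm.const_smul r, hI.const_smul r, fun n => r • g n, fun n => ?_, ?_, ?_⟩
  · rw [e1]; exact smul_mem_Hphi r (hgm n)
  · simp_rw [e1, phiNorm_smul]
    simpa using hg.const_mul |r|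
  · simp_rw [e2, eLpNorm_const_smul]
    simpa using ENNReal.Tendsto.const_mul hgI (Or.inr enorm_ne_top)

lemma sum (hP : IsFBM H T d P) (hH : 1 / 2 < H) (hH1 : H < 1) (hT : 0 ≤ T) {ι : Type*}
    (S : Finset ι) {F : ι → ℝ → ℝ} {J : ι → PathSpace T d → ℝ}
    (h : ∀ k, IsWienerIntegral H P i (F k) (J k)) :
    IsWienerIntegral H P i (∑ k ∈ S, F k) (∑ k ∈ S, J k) := by
  classical
  induction S using Finset.induction_on with
  | empty =>
    have h0 := of_stepFun (i := i) hP (0 : Icc (0 : ℝ) T →₀ ℝ)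
    have e1 : stepFun (0 : Icc (0 : ℝ) T →₀ ℝ) = 0 := by ext; simp [stepFun]
    have e2 : stepInt i (0 : Icc (0 : ℝ) T →₀ ℝ) = 0 := by ext; simp [stepInt]
    simpa [e1, e2] using h0
  | insert k S hk ih =>
    rw [Finset.sum_insert hk, Finset.sum_insert hk]
    exact (h k).add hP hH hH1 hT ih

/-- The difference is a Wiener integral of the zero function, so the isometry gives it second moment
zero. Hence the choice made in `wienerInt` matters only up to a null set. -/
lemma ae_eq (hP : IsFBM H T d P) (hH : 1 / 2 < H) (hH1 : H < 1) (hT : 0 ≤ T)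
    (h : IsWienerIntegral H P i f I) (h' : IsWienerIntegral H P i f I') : I =ᵐ[P] I' := by
  have h1 : ∫ ω, (I ω - I' ω) * (I ω - I' ω) ∂P = 0 := by
    have hd := h.add hP hH hH1 hT (h'.smul (-1))
    have e := hd.integral_mul hP hH hH1 hT hd
    have ez : f + (-1 : ℝ) • f = 0 := by simp
    rw [if_pos rfl, ez, phiInner_zero_left] at e
    rw [← e]
    congr 1; ext ω
    simp only [Pi.add_apply, Pi.smul_apply, smul_eq_mul]
    ring
  have hi : Integrable (fun ω => (I ω - I' ω) * (I ω - I' ω)) P :=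
    (h.2.1.sub h'.2.1).integrable_mul (h.2.1.sub h'.2.1)
  filter_upwards [(integral_eq_zero_iff_of_nonneg (fun ω => mul_self_nonneg _) hi).1 h1] with ω hω
  exact sub_eq_zero.1 (mul_self_eq_zero.1 hω)

end IsWienerIntegral

/-- By the isometry, elementary integrals of approximating step functions are Cauchy in L²(P), which
is complete. -/
theorem exists_isWienerIntegral (hP : IsFBM H T d P) (hH : 1 / 2 < H) (hH1 : H < 1) (hT : 0 ≤ T)
    (i : Fin d) (hf : f ∈ Hphi H T) : ∃ I, IsWienerIntegral H P i f I := by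
  choose g hg using fun n : ℕ => exists_stepFun_phiNorm_lt hH hH1 hT hf
    (ε := 1 / ((n : ℝ) + 1)) (by positivity)
  have hgm := fun n => sub_mem_Hphi hH hH1 hf (stepFun_mem_Hphi hH hT (g n))
  have hz : Tendsto (fun n => phiNorm H T (f - stepFun (g n))) atTop (𝓝 0) :=
    squeeze_zero (fun n => phiNorm_nonneg _ _ _) (fun n => (hg n).le)
      tendsto_one_div_add_atTop_nhds_zero_nat
  have hM := fun n => hP.memLp_stepInt i (g n)
  have hdist : ∀ m n, dist ((hM m).toLp) ((hM n).toLp) ≤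
      1 / ((m : ℝ) + 1) + 1 / ((n : ℝ) + 1) := by
    intro m n
    rw [dist_eq_norm, ← MemLp.toLp_sub, Lp.norm_toLp, eLpNorm_two_eq_sqrt ((hM m).sub (hM n)),
      ENNReal.toReal_ofReal (Real.sqrt_nonneg _), ← stepInt_sub,
      hP.integral_stepInt_mul_stepInt hH hH1 hT, if_pos rfl]
    have e : stepFun (g m - g n) = (f - stepFun (g n)) + (-1 : ℝ) • (f - stepFun (g m)) := by
      rw [stepFun_sub, neg_one_smul]; abel
    have h1 := phiNorm_add_le hH hH1 hT (hgm n) (smul_mem_Hphi (-1) (hgm m))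
    rw [← e, phiNorm_smul, abs_neg, abs_one, one_mul] at h1
    have h2 := hg m
    have h3 := hg n
    change phiNorm H T _ ≤ _
    linarith
  have hc : CauchySeq fun n => (hM n).toLp := by
    refine cauchySeq_of_le_tendsto_0' (fun n : ℕ => 2 * (1 / ((n : ℝ) + 1))) (fun m n hmn => ?_) ?_
    · refine (hdist m n).trans ?_
      have : 1 / ((n : ℝ) + 1) ≤ 1 / ((m : ℝ) + 1) := Nat.one_div_le_one_div hmn
      linarith
    · simpa using tendsto_one_div_add_atTop_nhds_zero_nat.const_mul (2 : ℝ)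
  obtain ⟨Y, hY⟩ := cauchySeq_tendsto_of_complete hc
  -- The definition asks for a measurable function, not merely an almost everywhere class, so a
  -- measurable representative is taken.
  have hYm : AEMeasurable Y P := (Lp.memLp Y).1.aemeasurable
  have hY2 : MemLp (hYm.mk Y) 2 P := (memLp_congr_ae hYm.ae_eq_mk).1 (Lp.memLp Y)
  have hYe : hY2.toLp = Y := by
    exact Lp.ext (hY2.coeFn_toLp.trans hYm.ae_eq_mk.symm)
  refine ⟨hYm.mk Y, hYm.measurable_mk, hY2, g, hgm, hz, ?_⟩
  rw [← Lp.tendsto_Lp_iff_tendsto_eLpNorm'' _ hM _ hY2, hYe]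
  exact hY

lemma isWienerIntegral_wienerInt (hP : IsFBM H T d P) (hH : 1 / 2 < H) (hH1 : H < 1)
    (hT : 0 ≤ T) (i : Fin d) (hf : f ∈ Hphi H T) :
    IsWienerIntegral H P i f (wienerInt H P i f) := by
  have h := exists_isWienerIntegral hP hH hH1 hT i hf
  rw [wienerInt, dif_pos h]
  exact h.choose_spec

/-- The fractional Wiener integral is linear. -/
lemma wienerInt_sum_smul (hP : IsFBM H T d P) (hH : 1 / 2 < H) (hH1 : H < 1) (hT : 0 ≤ T)
    (i : Fin d) {ι : Type*} (S : Finset ι) (α : ι → ℝ) {F : ι → ℝ → ℝ}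
    (hF : ∀ k, F k ∈ Hphi H T) :
    wienerInt H P i (∑ k ∈ S, α k • F k) =ᵐ[P] fun ω => ∑ k ∈ S, α k * wienerInt H P i (F k) ω := by
  have h1 := isWienerIntegral_wienerInt hP hH hH1 hT i
    (sum_mem_Hphi hH hH1 S fun k _ => smul_mem_Hphi (α k) (hF k))
  have h2 := IsWienerIntegral.sum hP hH hH1 hT S fun k =>
    (isWienerIntegral_wienerInt hP hH hH1 hT i (hF k)).smul (α k)
  filter_upwards [h1.ae_eq hP hH hH1 hT h2] with ω hω
  rw [hω]
  simp [Finset.sum_apply]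

end WongZakai

/-! ### Measures on path space are determined by coordinate combinations. -/

namespace WongZakai

variable {H T : ℝ} {d : ℕ} {P : Measure (PathSpace T d)} {f : ℝ → ℝ}

lemma coordComb_sum {ι : Type*} (S : Finset ι) (a : ι → (Icc (0 : ℝ) T × Fin d →₀ ℝ)) :
    coordComb (∑ k ∈ S, a k) = ∑ k ∈ S, coordComb (a k) := by
  classical
  induction S using Finset.induction_on with
  | empty => ext ω; simp [coordComb]
  | insert k S hk ih => rw [Finset.sum_insert hk, Finset.sum_insert hk, coordComb_add, ih]

/-- Starting at the origin is a closed condition on continuous paths. The Polish property is used to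
make a continuous injection of path space a measurable embedding. -/
instance instPolishSpacePathSpace (T : ℝ) (d : ℕ) : PolishSpace (PathSpace T d) := by
  refine IsClosed.polishSpace ?_
  have h : ∀ t : Icc (0 : ℝ) T, IsClosed
      {ω : C(Icc (0 : ℝ) T, Fin d → ℝ) | (t : ℝ) = 0 → ω t = 0} := by
    intro t
    by_cases ht : (t : ℝ) = 0
    · simp only [ht, true_imp_iff]
      exact isClosed_eq (by fun_prop) continuous_const
    · simp [ht]
  have := isClosed_iInter h
  convert this using 1
  ext ω
  simp only [mem_iInter, mem_ofPred_eq]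
  exact Iff.rfl

/-- Finite measures on the path space are determined by the laws of the finite linear
combinations of coordinates. -/
theorem measure_pathSpace_ext {μ ν : Measure (PathSpace T d)} [IsFiniteMeasure μ]
    [IsFiniteMeasure ν] (h : ∀ a, μ.map (coordComb a) = ν.map (coordComb a)) : μ = ν := by
  classical
  obtain ⟨D, hDc, hDd⟩ := TopologicalSpace.exists_countable_dense (Icc (0 : ℝ) T)
  have : Countable D := hDc.to_subtype
  -- Evaluation on a countable dense set of times is injective by continuity of paths, hence a
  -- measurable embedding. It then suffices to compare finite-dimensional laws.
  let F : PathSpace T d → (D × Fin d → ℝ) := fun ω q => coord q.1.1 q.2 ω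
  have hFc : Continuous F := continuous_pi fun q => continuous_coord _ _
  have hFi : Function.Injective F := by
    intro ω η hωη
    apply Subtype.ext
    apply ContinuousMap.coe_injective
    refine Continuous.ext_on hDd (ContinuousMap.continuous _) (ContinuousMap.continuous _) ?_
    intro t ht
    ext i
    exact congrFun hωη (⟨t, ht⟩, i)
  have hF : MeasurableEmbedding F := hFc.measurableEmbedding hFi
  have hfin : ∀ I : Finset (D × Fin d),
      (μ.map F).map I.restrict = (ν.map F).map I.restrict := by
    intro I
    have hG : Measurable (I.restrict ∘ F) := (Finset.measurable_restrict I).comp hF.measurable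
    rw [Measure.map_map (Finset.measurable_restrict I) hF.measurable,
      Measure.map_map (Finset.measurable_restrict I) hF.measurable]
    -- Cramér–Wold: the law of a random vector is determined by its linear functionals, each of
    -- which is a coordinate combination.
    refine Measure.ext_of_charFunDual (funext fun L => ?_)
    rw [charFunDual_eq_charFun_map_one, charFunDual_eq_charFun_map_one,
      Measure.map_map L.continuous.measurable hG, Measure.map_map L.continuous.measurable hG]
    have hL : L ∘ (I.restrict ∘ F) = coordComb (∑ q : I, L (Pi.single q 1) •
        Finsupp.single (q.1.1.1, q.1.2) (1 : ℝ)) := by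
      rw [coordComb_sum]
      simp_rw [coordComb_smul, coordComb_single]
      ext ω
      simp only [Function.comp_apply, Finset.sum_apply, Pi.smul_apply, smul_eq_mul]
      rw [← ContinuousLinearMap.coe_coe, LinearMap.pi_apply_eq_sum_univ]
      refine Finset.sum_congr rfl fun q _ => ?_
      rw [smul_eq_mul, mul_comm]
      congr 2
      ext q'
      simp [Pi.single_apply, eq_comm]
    rw [hL, h]
  have hmap : μ.map F = ν.map F :=
    IsProjectiveLimit.unique (P := fun I => (ν.map F).map I.restrict) hfin fun I => rfl
  rw [← hF.comap_map μ, hmap, hF.comap_map]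

end WongZakai

/-! ### Cameron–Martin translations. -/

namespace WongZakai

variable {H T : ℝ} {d : ℕ} {P : Measure (PathSpace T d)} {f : ℝ → ℝ}

lemma coord_cmPath (hH : 1 / 2 < H) (hH1 : H < 1) (hT : 0 < T) (hf : f ∈ Hphi H T) (i j : Fin d)
    (t : Icc (0 : ℝ) T) : coord t j (cmPath H T i f) =
      if j = i then phiInner H T ((Icc 0 (t : ℝ)).indicator fun _ => (1 : ℝ)) f else 0 := by
  have h := intervalIntegrable_Phi hH hT.le (intervalIntegrable_of_mem_Hphi hH hH1 hT hf)
  rw [cmPath, dif_pos h, phiInner_indicator le_rfl t.2.1 t.2.2]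
  simp only [coord, one_mul, ContinuousMap.coe_mk, Pi.single_apply]

lemma stepInt_cmPath (hH : 1 / 2 < H) (hH1 : H < 1) (hT : 0 < T) (hf : f ∈ Hphi H T)
    (i j : Fin d) (g : Icc (0 : ℝ) T →₀ ℝ) : stepInt j g (cmPath H T i f) =
      if j = i then phiInner H T (stepFun g) f else 0 := by
  simp only [stepInt, coord_cmPath hH hH1 hT hf, Finsupp.sum]
  have hs : ∀ (r : ℝ) (t : Icc (0 : ℝ) T),
      (r • (Icc 0 (t : ℝ)).indicator fun _ => (1 : ℝ)) ∈ Hphi H T :=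
    fun r t => smul_mem_Hphi r (indicator_mem_Hphi hH hT.le t)
  split_ifs
  · rw [stepFun_eq_sum, phiInner_sum_left hH hH1 hT.le _ (fun k _ => hs _ k) hf]
    simp only [phiInner_smul_left]
  · simp

lemma stepInt_sub_path (j : Fin d) (g : Icc (0 : ℝ) T →₀ ℝ) (ω η : PathSpace T d) :
    stepInt j g (ω - η) = stepInt j g ω - stepInt j g η := by
  rw [stepInt_eq_coordComb, coordComb_sub_path]

lemma measurable_sub_path (η : PathSpace T d) : Measurable fun ω : PathSpace T d => ω - η :=
  (continuous_id.sub continuous_const).measurable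

/-- The Cameron–Martin path is the covariance with the Wiener integral. -/
lemma integral_coordComb_mul_wienerInt (hP : IsFBM H T d P) (hH : 1 / 2 < H) (hH1 : H < 1)
    (hT : 0 < T) (i : Fin d) (hf : f ∈ Hphi H T) (a : Icc (0 : ℝ) T × Fin d →₀ ℝ) :
    ∫ ω, coordComb a ω * wienerInt H P i f ω ∂P = coordComb a (cmPath H T i f) := by
  have hI := isWienerIntegral_wienerInt hP hH hH1 hT.le i hf
  simp only [coordComb, Finsupp.sum, Finset.sum_mul, mul_assoc]
  have hi : ∀ q ∈ a.support,
      Integrable (fun ω => a q * (coord q.1 q.2 ω * wienerInt H P i f ω)) P := fun q _ =>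
    ((hP.memLp_coord q.1 q.2).integrable_mul hI.2.1).const_mul (a q)
  rw [integral_finsetSum _ hi]
  refine Finset.sum_congr rfl fun q _ => ?_
  have h1 := IsWienerIntegral.of_stepFun (i := q.2) hP (Finsupp.single q.1 1)
  have e1 : stepInt q.2 (Finsupp.single q.1 (1 : ℝ)) = (coord q.1 q.2 : PathSpace T d → ℝ) := by
    ext ω; simp [stepInt]
  have e2 : stepFun (Finsupp.single q.1 (1 : ℝ)) = (Icc 0 (q.1 : ℝ)).indicator fun _ => (1 : ℝ) := by
    ext s; simp [stepFun]
  rw [e1, e2] at h1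
  rw [integral_const_mul, h1.integral_mul hP hH hH1 hT.le hI, coord_cmPath hH hH1 hT hf]

lemma wienerInt_isCoordLimit (hP : IsFBM H T d P) (hH : 1 / 2 < H) (hH1 : H < 1) (hT : 0 ≤ T)
    (i : Fin d) (hf : f ∈ Hphi H T) : IsCoordLimit P (wienerInt H P i f) :=
  (isWienerIntegral_wienerInt hP hH hH1 hT i hf).isCoordLimit

lemma measurable_wienerInt (hP : IsFBM H T d P) (hH : 1 / 2 < H) (hH1 : H < 1) (hT : 0 ≤ T)
    (i : Fin d) (hf : f ∈ Hphi H T) : Measurable (wienerInt H P i f) :=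
  (isWienerIntegral_wienerInt hP hH hH1 hT i hf).1

lemma integrable_stochExp (hP : IsFBM H T d P) (hH : 1 / 2 < H) (hH1 : H < 1) (hT : 0 ≤ T)
    (i : Fin d) (hf : f ∈ Hphi H T) : Integrable (stochExp H P i f) P := by
  have h := (wienerInt_isCoordLimit hP hH hH1 hT i hf).integrable_exp_mul hP 1
  refine (h.mul_const (Real.exp (-((1 / 2) * phiInner H T f f)))).congr (ae_of_all _ fun ω => ?_)
  simp only [stochExp, one_mul, ← Real.exp_add]
  rw [sub_eq_add_neg]

/-- The Cameron–Martin theorem: under the measure with density `𝓔_i(f)` the shifted path is again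
a fractional Brownian motion. -/
theorem map_sub_cmPath (hP : IsFBM H T d P) (hH : 1 / 2 < H) (hH1 : H < 1) (hT : 0 < T)
    (i : Fin d) (hf : f ∈ Hphi H T) :
    (P.withDensity fun ω => ENNReal.ofReal (stochExp H P i f ω)).map
      (fun ω => ω - cmPath H T i f) = P := by
  have := hP.isProbabilityMeasure
  have hIl := wienerInt_isCoordLimit hP hH hH1 hT.le i hf
  have hI := isWienerIntegral_wienerInt hP hH hH1 hT.le i hf
  have hEm : Measurable (stochExp H P i f) :=
    ((measurable_wienerInt hP hH hH1 hT.le i hf).sub_const _).exp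
  have hE := integrable_stochExp hP hH hH1 hT.le i hf
  have := isFiniteMeasure_withDensity_ofReal hE.2
  refine measure_pathSpace_ext fun a => ?_
  have hL := hP.isCoordLimit_coordComb a
  rw [Measure.map_map (measurable_coordComb a) (measurable_sub_path _)]
  symm
  have hset : integrableExpSet (coordComb a) P = univ :=
    eq_univ_of_forall fun r => hL.integrable_exp_mul hP r
  -- The exponent under the density is Gaussian with variance r²Var + 2r Cov + |f|². The covariance
  -- is the value of the combination on the Cameron–Martin path, so it cancels the translation, and
  -- |f|² cancels the normalisation of the exponential.
  have hmgf : mgf (coordComb a) P = mgf (coordComb a ∘ fun ω => ω - cmPath H T i f)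
      (P.withDensity fun ω => ENNReal.ofReal (stochExp H P i f ω)) := by
    ext r
    rw [mgf, mgf, hL.mgf_eq hP r, integral_withDensity_eq_integral_toReal_smul
      hEm.ennreal_ofReal (ae_of_all _ fun ω => ENNReal.ofReal_lt_top)]
    have e1 : ∀ ω, (ENNReal.ofReal (stochExp H P i f ω)).toReal •
        Real.exp (r * (coordComb a ∘ fun ω => ω - cmPath H T i f) ω) =
        Real.exp (-(1 / 2) * phiInner H T f f - r * coordComb a (cmPath H T i f)) *
          Real.exp ((r • coordComb a + wienerInt H P i f) ω) := by
      intro ω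
      rw [stochExp, ENNReal.toReal_ofReal (Real.exp_pos _).le, smul_eq_mul, ← Real.exp_add,
        ← Real.exp_add, Function.comp_apply, coordComb_sub_path]
      simp only [Pi.add_apply, Pi.smul_apply, smul_eq_mul]
      congr 1; ring
    simp_rw [e1]
    rw [integral_const_mul, ((hL.smul r).add hP hIl).integral_exp hP, ← Real.exp_add]
    have e2 : ∫ ω, (r • coordComb a + wienerInt H P i f) ω *
        (r • coordComb a + wienerInt H P i f) ω ∂P =
        r ^ 2 * (∫ ω, coordComb a ω * coordComb a ω ∂P) +
          2 * r * coordComb a (cmPath H T i f) + phiInner H T f f := by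
      have i1 := (hL.1.integrable_mul hL.1).const_mul (r ^ 2)
      have i2 := (hL.1.integrable_mul hIl.1).const_mul (2 * r)
      have i3 : Integrable (fun ω => wienerInt H P i f ω * wienerInt H P i f ω) P :=
        hIl.1.integrable_mul hIl.1
      have h3 := hI.integral_mul hP hH hH1 hT.le hI
      rw [if_pos rfl] at h3
      rw [← integral_coordComb_mul_wienerInt hP hH hH1 hT i hf a, ← h3, ← integral_const_mul,
        ← integral_const_mul]
      have s1 : ∀ ω, (r • coordComb a + wienerInt H P i f) ω *
          (r • coordComb a + wienerInt H P i f) ω =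
          r ^ 2 * (coordComb a ω * coordComb a ω) +
            2 * r * (coordComb a ω * wienerInt H P i f ω) +
            wienerInt H P i f ω * wienerInt H P i f ω := by
        intro ω
        simp only [Pi.add_apply, Pi.smul_apply, smul_eq_mul]
        ring
      simp_rw [s1]
      have i12 : Integrable (fun ω => r ^ 2 * (coordComb a ω * coordComb a ω) +
          2 * r * (coordComb a ω * wienerInt H P i f ω)) P := i1.add i2
      rw [integral_add i12 i3]
      congr 1
      exact integral_add i1 i2
    rw [e2]
    congr 1; ring
  -- The generating function is finite on all of ℝ, so equality there extends to the complex plane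
  -- and identifies the laws.
  refine Measure.ext_of_complexMGF_eq (measurable_coordComb a).aemeasurable
    ((measurable_coordComb a).comp (measurable_sub_path _)).aemeasurable (funext fun z => ?_)
  exact eqOn_complexMGF_of_mgf hmgf (by simp [hset])

/-- Translation by a Cameron–Martin path preserves null sets. -/
theorem quasiMeasurePreserving_sub_cmPath (hP : IsFBM H T d P) (hH : 1 / 2 < H) (hH1 : H < 1)
    (hT : 0 < T) (i : Fin d) (hf : f ∈ Hphi H T) :
    Measure.QuasiMeasurePreserving (fun ω => ω - cmPath H T i f) P P := by
  refine ⟨measurable_sub_path _, ?_⟩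
  have hEm : Measurable (stochExp H P i f) :=
    ((measurable_wienerInt hP hH hH1 hT.le i hf).sub_const _).exp
  -- The density is strictly positive, so P is absolutely continuous with respect to the tilted
  -- measure; pushing both forward turns the latter into P.
  have h1 : P ≪ P.withDensity fun ω => ENNReal.ofReal (stochExp H P i f ω) :=
    withDensity_absolutelyContinuous' hEm.ennreal_ofReal.aemeasurable
      (ae_of_all _ fun ω => by simp [stochExp, Real.exp_pos])
  have h2 := h1.map (measurable_sub_path (cmPath H T i f))
  rwa [map_sub_cmPath hP hH hH1 hT i hf] at h2

/-- The Wiener integral of the shifted path. -/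
theorem wienerInt_sub_cmPath (hP : IsFBM H T d P) (hH : 1 / 2 < H) (hH1 : H < 1)
    (hT : 0 < T) (i j : Fin d) {f' : ℝ → ℝ} (hf : f ∈ Hphi H T) (hf' : f' ∈ Hphi H T) :
    ∀ᵐ ω ∂P, wienerInt H P j f' (ω - cmPath H T i f) =
      wienerInt H P j f' ω - if j = i then phiInner H T f' f else 0 := by
  obtain ⟨-, hI, g, -, hg, hgI⟩ := isWienerIntegral_wienerInt hP hH hH1 hT.le j hf'
  obtain ⟨ns, hns, hae⟩ := (tendstoInMeasure_of_tendsto_eLpNorm two_ne_zero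
    (fun n => (hP.memLp_stepInt j (g n)).1) hI.1 hgI).exists_seq_tendsto_ae
  -- The formula holds pathwise for elementary integrals. Preservation of null sets lets the almost
  -- sure limit be taken at the translated path as well.
  have hae' := (quasiMeasurePreserving_sub_cmPath hP hH hH1 hT i hf).ae hae
  have hlim : Tendsto (fun n => if j = i then phiInner H T (stepFun (g n)) f else 0) atTop
      (𝓝 (if j = i then phiInner H T f' f else 0)) := by
    split_ifs
    · refine phiInner_continuous hH hH1 hT.le hf' hf (fun n => stepFun_mem_Hphi hH hT.le _)
        (fun _ => hf) hg ?_
      simp only [sub_self, phiNorm, phiInner_zero_left, Real.sqrt_zero]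
      exact tendsto_const_nhds
    · exact tendsto_const_nhds
  filter_upwards [hae, hae'] with ω h1 h2
  refine tendsto_nhds_unique h2 ?_
  simp_rw [stepInt_sub_path, stepInt_cmPath hH hH1 hT hf]
  exact h1.sub (hlim.comp hns.tendsto_atTop)

end WongZakai

/-! ### From the hyperbolic system to the stochastic equation. -/

namespace WongZakai

variable {H T : ℝ} {d K : ℕ} {P : Measure (PathSpace T d)} {e : ℕ → ℝ → ℝ} {σ : ℝ → Fin d → ℝ}

/-- The link between the two sides: the projection coefficients are the increments that define the
characteristics. Thus translation by the path of `sigmaK` moves the Gaussian coordinates along a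
characteristic. -/
lemma coeff_sigmaK {s t : ℝ} (hs : 0 ≤ s) (hst : s ≤ t) (ht : t ≤ T) (i : Fin d) :
    sigmaK H T e K σ i s t = ∑ k : Fin K, Sig H T e σ i k s t • e k := by
  unfold sigmaK Sig
  simp_rw [phiInner_indicator hs hst ht (fun s => σ s i)]

lemma sigmaK_mem_Hphi (hH : 1 / 2 < H) (hH1 : H < 1) (he : IsCONS H T e) (i : Fin d) (s t : ℝ) :
    sigmaK H T e K σ i s t ∈ Hphi H T :=
  sum_mem_Hphi hH hH1 _ fun k _ => smul_mem_Hphi _ (he.mem k)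

lemma phiInner_sum_smul (hH : 1 / 2 < H) (hH1 : H < 1) (hT : 0 ≤ T) (he : IsCONS H T e)
    (α : Fin K → ℝ) (k : Fin K) : phiInner H T (e k) (∑ l : Fin K, α l • e l) = α k := by
  have hm : ∀ l ∈ (Finset.univ : Finset (Fin K)), α l • e l ∈ Hphi H T :=
    fun l _ => smul_mem_Hphi _ (he.mem l)
  rw [phiInner_sum_right hH hH1 hT _ hm (he.mem k)]
  simp [phiInner_smul_right, he.orthonormal, Fin.val_inj]

lemma phiInner_sum_smul_self (hH : 1 / 2 < H) (hH1 : H < 1) (hT : 0 ≤ T) (he : IsCONS H T e)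
    (α : Fin K → ℝ) :
    phiInner H T (∑ l : Fin K, α l • e l) (∑ l : Fin K, α l • e l) = ∑ k, α k ^ 2 := by
  have hm : ∀ l ∈ (Finset.univ : Finset (Fin K)), α l • e l ∈ Hphi H T :=
    fun l _ => smul_mem_Hphi _ (he.mem l)
  rw [phiInner_sum_left hH hH1 hT _ hm (sum_mem_Hphi hH hH1 _ hm)]
  simp_rw [phiInner_smul_left, phiInner_sum_smul hH hH1 hT he, sq]

lemma stochExp_sigmaK_ae (hH : 1 / 2 < H) (hH1 : H < 1) (hT : 0 ≤ T) (he : IsCONS H T e)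
    (hP : IsFBM H T d P) {s t : ℝ} (hs : 0 ≤ s) (hst : s ≤ t) (ht : t ≤ T) (i : Fin d) :
    ∀ᵐ ω ∂P, stochExp H P i (sigmaK H T e K σ i s t) ω = Real.exp (∑ k : Fin K,
      (wienerInt H P i (e k) ω * Sig H T e σ i k s t - (1 / 2) * Sig H T e σ i k s t ^ 2)) := by
  rw [coeff_sigmaK hs hst ht]
  filter_upwards [wienerInt_sum_smul hP hH hH1 hT i Finset.univ
    (fun k : Fin K => Sig H T e σ i k s t) (F := fun k : Fin K => e k) fun k => he.mem k] with ω hω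
  rw [stochExp, phiInner_sum_smul_self hH hH1 hT he, hω, Finset.sum_sub_distrib, Finset.mul_sum]
  simp only [mul_comm]

lemma wienerInt_sub_cmPath_sigmaK_ae (hH : 1 / 2 < H) (hH1 : H < 1) (hT : 0 < T)
    (he : IsCONS H T e) (hP : IsFBM H T d P) {s t : ℝ} (hs : 0 ≤ s) (hst : s ≤ t) (ht : t ≤ T)
    (i : Fin d) : ∀ᵐ ω ∂P, ∀ (k : Fin K) (j : Fin d),
      wienerInt H P j (e k) (ω - cmPath H T i (sigmaK H T e K σ i s t)) =
        wienerInt H P j (e k) ω - if j = i then Sig H T e σ i k s t else 0 := by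
  rw [ae_all_iff]
  intro k
  rw [ae_all_iff]
  intro j
  filter_upwards [wienerInt_sub_cmPath hP hH hH1 hT i j
    (sigmaK_mem_Hphi hH hH1 he (K := K) (σ := σ) i s t) (he.mem k)] with ω hω
  rw [hω, coeff_sigmaK hs hst ht, phiInner_sum_smul hH hH1 hT.le he]

/-- Independence is not needed: each induction step is Cauchy–Schwarz, which doubles r, so r is kept
general. For one variable, exp(2r|Y|) ≤ exp(2rY) + exp(-2rY). -/
lemma integrable_exp_mul_sum_abs (hP : IsFBM H T d P) {ι : Type*} (S : Finset ι)
    {Y : ι → PathSpace T d → ℝ} (hY : ∀ q, IsCoordLimit P (Y q)) (r : ℝ) :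
    Integrable (fun ω => Real.exp (r * ∑ q ∈ S, |Y q ω|)) P := by
  classical
  have := hP.isProbabilityMeasure
  induction S using Finset.induction_on generalizing r with
  | empty => simp
  | insert q S hq ih =>
    have hm : ∀ p, AEStronglyMeasurable (fun ω => |Y p ω|) P := fun p => (hY p).1.1.norm
    have h1 : MemLp (fun ω => Real.exp (r * |Y q ω|)) 2 P := by
      rw [memLp_two_iff_integrable_sq
        (Real.continuous_exp.comp_aestronglyMeasurable ((hm q).const_mul r))]
      refine (((hY q).integrable_exp_mul hP (2 * r)).add
        ((hY q).integrable_exp_mul hP (-(2 * r)))).mono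
        ((Real.continuous_exp.comp_aestronglyMeasurable ((hm q).const_mul r)).pow 2)
        (ae_of_all _ fun ω => ?_)
      rw [Real.norm_of_nonneg (by positivity), Pi.add_apply, Real.norm_of_nonneg (by positivity),
        ← Real.exp_nat_mul]
      rcases abs_cases (Y q ω) with ⟨h, -⟩ | ⟨h, -⟩
      · rw [h]
        refine le_of_eq_of_le ?_ (le_add_of_nonneg_right (Real.exp_pos _).le)
        congr 1; push_cast; ring
      · rw [h]
        refine le_of_eq_of_le ?_ (le_add_of_nonneg_left (Real.exp_pos _).le)
        congr 1; push_cast; ring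
    have h2 : MemLp (fun ω => Real.exp (r * ∑ p ∈ S, |Y p ω|)) 2 P := by
      rw [memLp_two_iff_integrable_sq (ih r).1]
      refine (ih (2 * r)).congr (ae_of_all _ fun ω => ?_)
      simp only [← Real.exp_nat_mul]
      congr 1; push_cast; ring
    refine (h1.integrable_mul h2).congr (ae_of_all _ fun ω => ?_)
    simp only [Pi.mul_apply, ← Real.exp_add]
    rw [Finset.sum_insert hq, mul_add]

lemma memLp_two_of_exp_bound (hP : IsFBM H T d P) {ι : Type*} (S : Finset ι)
    {Y : ι → PathSpace T d → ℝ} (hY : ∀ q, IsCoordLimit P (Y q)) {C r : ℝ}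
    {Z : PathSpace T d → ℝ} (hZ : AEStronglyMeasurable Z P)
    (hb : ∀ ω, |Z ω| ≤ C * Real.exp (r * ∑ q ∈ S, |Y q ω|)) : MemLp Z 2 P := by
  rw [memLp_two_iff_integrable_sq hZ]
  refine ((integrable_exp_mul_sum_abs hP S hY (2 * r)).const_mul (C ^ 2)).mono (hZ.pow 2)
    (ae_of_all _ fun ω => ?_)
  rw [Real.norm_of_nonneg (sq_nonneg _), Real.norm_of_nonneg (by positivity), ← sq_abs]
  refine (pow_le_pow_left₀ (abs_nonneg _) (hb ω) 2).trans_eq ?_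
  rw [mul_pow, ← Real.exp_nat_mul]
  congr 2; push_cast; ring

/-- The Gaussian coordinates turn solutions of the hyperbolic system into mild solutions of the
stochastic equation. -/
theorem isMildSolution_comp_gaussCoords (hH : 1 / 2 < H) (hH1 : H < 1) (hT : 0 < T)
    (hP : IsFBM H T d P) (he : IsCONS H T e) {b : ℝ → (Fin d → ℝ) → Fin d → ℝ} {c : Fin d → ℝ}
    (hbσ : CoeffAssumption T b σ) {u : ℝ → (Fin K → Fin d → ℝ) → Fin d → ℝ}
    (huc : Continuous fun p : ℝ × (Fin K → Fin d → ℝ) => u p.1 p.2)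
    (hub : ∃ C R : ℝ, ∀ t ∈ Icc 0 T, ∀ x, ‖u t x‖ ≤ C * Real.exp (R * ∑ k, ∑ j, |x k j|))
    (hu : IsMildPDESolution H T e K b σ c u) :
    IsMildSolution H P e K b σ c fun t ω => u t (gaussCoords H P e K ω) := by
  have := hP.isProbabilityMeasure
  have hei : ∀ k, IntervalIntegrable (e k) volume 0 T := fun k =>
    intervalIntegrable_of_mem_Hphi hH hH1 hT (he.mem k)
  have hint : ∀ i (k : Fin K), IntervalIntegrable (fun s => σ s i * Phi H T (e k) s) volume 0 T :=
    fun i k => intervalIntegrable_mul_Phi hH hT (hei k)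
      ((continuous_apply i).comp_continuousOn hbσ.σ_cont)
  let z : PathSpace T d → Fin K → Fin d → ℝ := fun ω k j => wienerInt H P j (e k) ω
  have hz : Measurable z := measurable_pi_lambda _ fun k => measurable_pi_lambda _ fun j =>
    measurable_wienerInt hP hH hH1 hT.le j (he.mem k)
  have hut : ∀ t, Continuous (u t) := fun t =>
    huc.comp (by fun_prop : Continuous fun x : Fin K → Fin d → ℝ => (t, x))
  let a : Fin d → Fin K → ℝ → ℝ := fun i k => sigPrimitive H T e σ i k
  have ha : ∀ i k, Continuous (a i k) := fun i k => continuous_sigPrimitive hT (hint i k)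
  have hsub : ∀ s ∈ Icc 0 T, ∀ t ∈ Icc 0 T, ∀ i k, a i k t - a i k s = Sig H T e σ i k s t :=
    fun s hs t ht i k => sigPrimitive_sub (hint i k) hs ht
  have hshift : ∀ s ∈ Icc 0 T, ∀ t ∈ Icc 0 T, ∀ i (x : Fin K → Fin d → ℝ),
      shift a i s t x = (fun k j => x k j - SigMat H T e K σ i s t k j) := by
    intro s hs t ht i x
    ext k j
    simp [shift, SigMat, hsub s hs t ht]
  have hker : ∀ s ∈ Icc 0 T, ∀ t ∈ Icc 0 T, ∀ i (x : Fin K → Fin d → ℝ),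
      expKer a i s t x = Real.exp (∑ k : Fin K,
        (x k i * Sig H T e σ i k s t - (1 / 2) * Sig H T e σ i k s t ^ 2)) := by
    intro s hs t ht i x
    simp [expKer, hsub s hs t ht]
  have hmild : ∀ t ∈ Icc 0 T, ∀ (x : Fin K → Fin d → ℝ) i, u t x i =
      c i * Real.exp (∑ k : Fin K,
        (x k i * Sig H T e σ i k 0 t - (1 / 2) * Sig H T e σ i k 0 t ^ 2)) +
      ∫ s in (0 : ℝ)..t, b s (u s (fun k j => x k j - SigMat H T e K σ i s t k j)) i *
        Real.exp (∑ k : Fin K,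
          (x k i * Sig H T e σ i k s t - (1 / 2) * Sig H T e σ i k s t ^ 2)) :=
    fun t ht x i => hu.equation t ht x i
  have hbc : Continuous fun p : ℝ × (Fin d → ℝ) => b (clip T p.1) p.2 :=
    hbσ.b_cont.comp_continuous (by fun_prop : Continuous fun p : ℝ × (Fin d → ℝ) =>
      (clip T p.1, p.2)) fun p => ⟨clip_mem hT.le _, mem_univ _⟩
  refine ⟨fun t _ => ((hut t).measurable.comp hz : Measurable fun ω => u t (z ω)),
    ae_of_all _ fun ω => ?_, ⟨2, one_lt_two, fun i t ht => ?_⟩, fun i t ht => ?_⟩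
  · exact (huc.comp (by fun_prop : Continuous fun t : ℝ => (t, z ω))).continuousOn
  · obtain ⟨C, R, hCR⟩ := hub
    have h2 : ENNReal.ofReal 2 = 2 := by simp
    rw [h2]
    refine memLp_two_of_exp_bound hP (Finset.univ : Finset (Fin K × Fin d))
      (Y := fun q ω => z ω q.1 q.2) (fun q => wienerInt_isCoordLimit hP hH hH1 hT.le _ (he.mem _))
      (C := C) (r := R) ?_ fun ω => ?_
    · exact (((continuous_apply i).comp (hut t)).measurable.comp hz).aestronglyMeasurable
    · rw [Fintype.sum_prod_type]
      exact (norm_le_pi_norm (u t (z ω)) i).trans (hCR t ht (z ω))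
  · have hGc : Continuous fun p : ℝ × (Fin K → Fin d → ℝ) =>
        b (clip T p.1) (u p.1 (shift a i p.1 t p.2)) i * expKer a i p.1 t p.2 := by
      have h1 : Continuous fun p : ℝ × (Fin K → Fin d → ℝ) => shift a i p.1 t p.2 :=
        continuous_shift i ha continuous_fst continuous_const continuous_snd
      have h2 : Continuous fun p : ℝ × (Fin K → Fin d → ℝ) => expKer a i p.1 t p.2 :=
        continuous_expKer i ha continuous_fst continuous_const continuous_snd
      have h3 : Continuous fun p : ℝ × (Fin K → Fin d → ℝ) => u p.1 (shift a i p.1 t p.2) :=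
        huc.comp (continuous_fst.prodMk h1)
      have h4 : Continuous fun p : ℝ × (Fin K → Fin d → ℝ) =>
          b (clip T p.1) (u p.1 (shift a i p.1 t p.2)) := hbc.comp (continuous_fst.prodMk h3)
      exact ((continuous_apply i).comp h4).mul h2
    -- The version of the Wick products is the mild integrand of (2) evaluated at z. It is
    -- continuous in (s, x), hence jointly measurable; the clip only affects times outside [0,T].
    refine ⟨fun s ω => b (clip T s) (u s (shift a i s t (z ω))) i * expKer a i s t (z ω),
      hGc.measurable.comp (measurable_fst.prodMk (hz.comp measurable_snd)), fun s hs => ?_, ?_⟩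
    · have hs' : s ∈ Icc 0 T := ⟨hs.1, hs.2.trans ht.2⟩
      -- The exceptional set may depend on s, which the notion of version permits.
      filter_upwards [stochExp_sigmaK_ae hH hH1 hT.le he hP hs.1 hs.2 ht.2 i (K := K) (σ := σ),
        wienerInt_sub_cmPath_sigmaK_ae hH hH1 hT he hP hs.1 hs.2 ht.2 i (K := K) (σ := σ)]
        with ω h1 h2
      have h3 : z (ω - cmPath H T i (sigmaK H T e K σ i s t)) = shift a i s t (z ω) := by
        rw [hshift s hs' t ht]
        ext k j
        exact h2 k j
      have h4 : wickExp H P i (sigmaK H T e K σ i s t) (fun ω => b s (u s (z ω)) i) ω =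
          b s (u s (shift a i s t (z ω))) i * expKer a i s t (z ω) := by
        rw [wickExp, translate, h1, h3, hker s hs' t ht]
      rw [clip_of_mem hs']
      exact h4.symm
    -- Only the initial term needs an exceptional set; the integral identity is the deterministic
    -- equation at x = z and holds for every path.
    · filter_upwards [stochExp_sigmaK_ae hH hH1 hT.le he hP le_rfl ht.1 ht.2 i (K := K) (σ := σ)]
        with ω h1
      refine ⟨(hGc.comp (by fun_prop : Continuous fun s : ℝ => (s, z ω))).intervalIntegrable _ _, ?_⟩
      rw [h1]
      refine (hmild t ht (z ω) i).trans ?_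
      congr 1
      refine intervalIntegral.integral_congr fun s hs => ?_
      rw [uIcc_of_le ht.1] at hs
      have hs' : s ∈ Icc 0 T := ⟨hs.1, hs.2.trans ht.2⟩
      simp only [clip_of_mem hs']
      rw [hker s hs' t ht, hshift s hs' t ht]

end WongZakai

theorem theorem1 (H : ℝ) (hH : 1 / 2 < H) (hH1 : H < 1) (T : ℝ) (hT : 0 < T) (d : ℕ)
    (P : Measure (WongZakai.PathSpace T d)) (hP : WongZakai.IsFBM H T d P)
    (e : ℕ → ℝ → ℝ) (he : WongZakai.IsCONS H T e) (K : ℕ)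
    (b : ℝ → (Fin d → ℝ) → Fin d → ℝ) (σ : ℝ → Fin d → ℝ) (c : Fin d → ℝ)
    (hbσ : WongZakai.CoeffAssumption T b σ) :
    ∃ (X : ℝ → WongZakai.PathSpace T d → Fin d → ℝ)
      (u : ℝ → Matrix (Fin K) (Fin d) ℝ → Fin d → ℝ),
      WongZakai.IsMildSolution H P e K b σ c X ∧
      (∀ t ∈ Icc 0 T, ∀ ω, X t ω = u t (WongZakai.gaussCoords H P e K ω)) ∧
      WongZakai.IsMildPDESolution H T e K b σ c u ∧
      ((∀ k < K, ContinuousOn (WongZakai.Phi H T (e k)) (Icc 0 T)) →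
        WongZakai.IsClassicalSolution H T e K b σ c u) := by
  obtain ⟨u, huc, hub, hu, hcl⟩ := WongZakai.exists_hyperbolic_solution (K := K) (e := e) hH hT
    (fun k => WongZakai.intervalIntegrable_of_mem_Hphi hH hH1 hT (he.mem k)) c hbσ
  exact ⟨fun t ω => u t (WongZakai.gaussCoords H P e K ω), u,
    WongZakai.isMildSolution_comp_gaussCoords hH hH1 hT hP he hbσ huc hub hu,
    fun _ _ _ => rfl, hu, hcl⟩
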